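/- Let $n\ge 3$, $N=B(0,2)\subset\mathbb R^n$, let $F_1:N\setminus\{0\}\to N\setminus\overline{B}(0,1)$, $F_1(x)=\left(\frac{|x|}2+1\right)\frac{x}{|x|}$, and let $g_0$ be the Euclidean metric. Let $g$ be any smooth symmetric metric on $B(0,1)$ that is bounded from above and below by positive constants, and let $\widetilde g$ be the singular metric on $N$ that equals $(F_1)_*g_0=(F_1^{-1})^*g_0$ on $N\setminus\overline B(0,1)$ and $g$ on $B(0,1)$. To a metric $g$ (with matrix $(g_{ij})$, inverse $(g^{ij})$ and $|g|=\det g$) associate the conductivity $\sigma^{ij}=|g|^{1/2}g^{ij}$; let $\widetilde\sigma$ be the conductivity of $\widetilde g$ and $\gamma=1$ that of $g_0$. For a conductivity $\sigma$ on $N$ a solution is a real-valued $u\in H^1(N)$ with $\nabla\cdot\sigma\nabla u=0$ in $N$ in the sense of distributions. Its boundary value $u|_{\partial N}\in H^{1/2}(\partial N)$ is its Sobolev trace, and its Neumann data $\nu\cdot\sigma\nabla u|_{\partial N}$ is the linear functional on $H^{1/2}(\partial N)$ given by $w|_{\partial N}\mapsto\int_N\sigma\nabla u\cdot\nabla w\,dx$,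 $w\in H^1(N)$. (1) For $\sigma=\gamma$ and for $\sigma=\widetilde\sigma$: for every bounded $f\in H^{1/2}(\partial N)$ there is exactly one bounded solution $u$ with $u|_{\partial N}=f$, and for every $f\in H^{1/2}(\partial N)$ there is exactly one solution $u$ with $u|_{\partial N}=f$. The Dirichlet-to-Neumann maps $f\mapsto\nu\cdot\sigma\nabla u|_{\partial N}$ so defined are the same for both conductivities, $\Lambda_{\widetilde g}=\Lambda_{g_0}$, both for bounded solutions and for all $H^1$ solutions. (2) The Cauchy data $\{(u|_{\partial N},\nu\cdot\sigma\nabla u|_{\partial N})\}$ of all bounded solutions are the same for $\sigma=\widetilde\sigma$ and $\sigma=\gamma$, and so are the Cauchy data of all solutions: $C_1(\widetilde\sigma)=C_1(\gamma)$. In particular the boundary measurements do not depend on the metric $g$ in $B(0,1)$. -/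

import Mathlib

open MeasureTheory Set Filter Topology
open scoped ENNReal ContDiff Matrix Gradient

noncomputable section

namespace Cloaking

/-- Euclidean space `ℝⁿ`. -/
abbrev E (n : ℕ) : Type := EuclideanSpace ℝ (Fin n)

/-! ### The singular transformation and the singular metric -/

/-- The map `F₁(x) = (|x|/2 + 1) x/|x|`, which blows up the origin to the closed unit ball. -/
def blowUp {n : ℕ} (x : E n) : E n := (‖x‖ / 2 + 1) • (‖x‖⁻¹ • x)

/-- The inverse `y ↦ 2 (|y| - 1) y/|y|` of `blowUp`. -/
def blowDown {n : ℕ} (y : E n) : E n := (2 * (‖y‖ - 1)) • (‖y‖⁻¹ • y)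

theorem norm_blowUp {n : ℕ} {x : E n} (hx : x ≠ 0) : ‖blowUp x‖ = ‖x‖ / 2 + 1 := by
  have h : ‖x‖ ≠ 0 := norm_ne_zero_iff.2 hx
  rw [blowUp, norm_smul, norm_smul, norm_inv, norm_norm, inv_mul_cancel₀ h, mul_one,
    Real.norm_of_nonneg (by positivity)]

theorem norm_blowDown {n : ℕ} {y : E n} (hy : 1 < ‖y‖) : ‖blowDown y‖ = 2 * (‖y‖ - 1) := by
  have h : ‖y‖ ≠ 0 := by linarith
  rw [blowDown, norm_smul, norm_smul, norm_inv, norm_norm, inv_mul_cancel₀ h, mul_one,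
    Real.norm_of_nonneg (by linarith)]

/-- `blowDown` is the inverse of the bijection `blowUp` from `B(0,2) \ {0}` onto
`B(0,2) \ closure B(0,1)`. -/
theorem blowDown_invOn (n : ℕ) :
    InvOn (blowDown (n := n)) blowUp (Metric.ball 0 2 \ {0})
      (Metric.ball 0 2 \ Metric.closedBall 0 1) := by
  constructor
  · rintro x ⟨-, hx⟩
    have hx' : x ≠ 0 := by simpa using hx
    have h : ‖x‖ ≠ 0 := norm_ne_zero_iff.2 hx'
    have h2 : ‖x‖ / 2 + 1 ≠ 0 := by positivity
    rw [blowDown, norm_blowUp hx', blowUp, smul_smul, smul_smul, smul_smul]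
    conv_rhs => rw [← one_smul ℝ x]
    congr 1
    field_simp
    ring
  · rintro y ⟨-, hy⟩
    have hy' : 1 < ‖y‖ := by simpa using hy
    have h : ‖y‖ ≠ 0 := by linarith
    have h2 : ‖y‖ - 1 ≠ 0 := by linarith
    rw [blowUp, norm_blowDown hy', blowDown, smul_smul, smul_smul, smul_smul]
    conv_rhs => rw [← one_smul ℝ y]
    congr 1
    field_simp
    ring

theorem blowUp_mapsTo (n : ℕ) :
    MapsTo (blowUp (n := n)) (Metric.ball 0 2 \ {0})
      (Metric.ball 0 2 \ Metric.closedBall 0 1) := by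
  rintro x ⟨h2, hx⟩
  have hx' : x ≠ 0 := by simpa using hx
  have h : 0 < ‖x‖ := norm_pos_iff.2 hx'
  have h2' : ‖x‖ < 2 := by simpa using h2
  simp only [Set.mem_sdiff, mem_ball_zero_iff, mem_closedBall_zero_iff, norm_blowUp hx', not_le]
  constructor <;> linarith

theorem blowDown_mapsTo (n : ℕ) :
    MapsTo (blowDown (n := n)) (Metric.ball 0 2 \ Metric.closedBall 0 1)
      (Metric.ball 0 2 \ {0}) := by
  rintro y ⟨h2, hy⟩
  have hy' : 1 < ‖y‖ := by simpa using hy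
  have h2' : ‖y‖ < 2 := by simpa using h2
  have h : ‖blowDown y‖ = 2 * (‖y‖ - 1) := norm_blowDown hy'
  refine ⟨?_, ?_⟩
  · rw [mem_ball_zero_iff, h]
    linarith
  · rw [mem_singleton_iff, ← norm_eq_zero, h]
    intro h0
    linarith

/-- The Jacobian matrix `(∂ψᵖ/∂yᵏ)` (row `p`, column `k`). -/
def jacobian {n : ℕ} (ψ : E n → E n) (y : E n) : Matrix (Fin n) (Fin n) ℝ :=
  Matrix.of fun p k => fderiv ℝ ψ y (EuclideanSpace.single k 1) p

/-- The pull-back `(ψ^* g)_{jk}(y) = ∑_{p,q} ∂_j ψᵖ(y) ∂_k ψ^q(y) g_{pq}(ψ y)`. -/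
def pullbackMetric {n : ℕ} (ψ : E n → E n) (g : E n → Matrix (Fin n) (Fin n) ℝ) (y : E n) :
    Matrix (Fin n) (Fin n) ℝ :=
  (jacobian ψ y)ᵀ * g (ψ y) * jacobian ψ y

/-- The Euclidean metric `g₀`. -/
def euclideanMetric (n : ℕ) : E n → Matrix (Fin n) (Fin n) ℝ := fun _ => 1

open Classical in
/-- The singular metric: the push-forward `(F₁)_* g₀ = (F₁⁻¹)^* g₀` for `|y| > 1`, and the metric
`g` in the unit ball. -/
def cloakMetric {n : ℕ} (g : E n → Matrix (Fin n) (Fin n) ℝ) (y : E n) :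
    Matrix (Fin n) (Fin n) ℝ :=
  if 1 < ‖y‖ then pullbackMetric blowDown (euclideanMetric n) y else g y

/-- The conductivity `σ^{ij} = |g|^{1/2} g^{ij}` of a metric `g`. -/
def conductivity {n : ℕ} (g : E n → Matrix (Fin n) (Fin n) ℝ) (x : E n) :
    Matrix (Fin n) (Fin n) ℝ :=
  Real.sqrt (g x).det • (g x)⁻¹

/-- A regular metric on `Ω`: smooth, symmetric, and bounded from above and below by positive
constants. -/
structure IsRegularMetricOn {n : ℕ} (Ω : Set (E n)) (g : E n → Matrix (Fin n) (Fin n) ℝ) :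
    Prop where
  smooth : ∀ i j, ContDiffOn ℝ ∞ (fun x => g x i j) Ω
  symm : ∀ x ∈ Ω, (g x).IsSymm
  bounds : ∃ c C : ℝ, 0 < c ∧ ∀ x ∈ Ω, ∀ ξ : Fin n → ℝ,
    c * (ξ ⬝ᵥ ξ) ≤ ξ ⬝ᵥ (g x *ᵥ ξ) ∧ ξ ⬝ᵥ (g x *ᵥ ξ) ≤ C * (ξ ⬝ᵥ ξ)

/-! ### The Sobolev space `H¹(N)` on `N = B(0,2)` and boundary values -/

/-- The region `N = B(0,2)`. -/
def N (n : ℕ) : Set (E n) := Metric.ball 0 2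

/-- `u ∈ H¹(N)` and `G` is its weak gradient. -/
structure IsH1 {n : ℕ} (u : E n → ℝ) (G : E n → E n) : Prop where
  memLp : MemLp u 2 (volume.restrict (N n))
  memLp_grad : MemLp G 2 (volume.restrict (N n))
  weak : ∀ φ : E n → ℝ, ContDiff ℝ ∞ φ → HasCompactSupport φ → tsupport φ ⊆ N n →
    ∫ x in N n, u x • ∇ φ x = -∫ x in N n, φ x • G x

/-- Surface measure on `∂N`, the sphere of radius `2` (as a measure on `ℝⁿ` carried by the
sphere): the image of surface measure on the unit sphere under `θ ↦ 2θ`, times `2ⁿ⁻¹`. -/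
def surfaceMeasure (n : ℕ) : Measure (E n) :=
  (2 : ℝ≥0∞) ^ (n - 1) •
    Measure.map (fun (θ : Metric.sphere (0 : E n) 1) => (2 : ℝ) • (θ : E n)) volume.toSphere

/-- `L²(∂N)`. -/
abbrev BoundaryL2 (n : ℕ) := Lp ℝ 2 (surfaceMeasure n)

/-- `u ∈ H¹(N)`, with weak gradient `G`, has the boundary trace `u|_{∂N} = f`: some functions that
are smooth up to the boundary converge to `u` in `H¹(N)`, and their restrictions to `∂N` converge
to `f` in `L²(∂N)`. -/
def HasTrace {n : ℕ} (u : E n → ℝ) (G : E n → E n) (f : BoundaryL2 n) : Prop :=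
  IsH1 u G ∧ ∃ φ : ℕ → E n → ℝ, (∀ k, ContDiff ℝ ∞ (φ k)) ∧
    Tendsto (fun k => eLpNorm (φ k - u) 2 (volume.restrict (N n))) atTop (𝓝 0) ∧
    Tendsto (fun k => eLpNorm (∇ (φ k) - G) 2 (volume.restrict (N n))) atTop (𝓝 0) ∧
    Tendsto (fun k => eLpNorm (φ k - ⇑f) 2 (surfaceMeasure n)) atTop (𝓝 0)

theorem integrable_smul_of_memLp {n : ℕ} {V : Type*} [NormedAddCommGroup V] [NormedSpace ℝ V]
    {u : E n → ℝ} {G : E n → V} (hu : MemLp u 2 (volume.restrict (N n)))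
    (hG : MemLp G 2 (volume.restrict (N n))) :
    IntegrableOn (fun x => u x • G x) (N n) := by
  have h := hG.smul (r := 1) hu
  exact memLp_one_iff_integrable.1 h

theorem continuous_gradient {n : ℕ} {φ : E n → ℝ} (hφ : ContDiff ℝ ∞ φ) :
    Continuous (∇ φ) :=
  (InnerProductSpace.toDual ℝ (E n)).symm.continuous.comp (hφ.continuous_fderiv (by simp))

theorem memLp_of_continuous {n : ℕ} {V : Type*} [NormedAddCommGroup V]
    {f : E n → V} (hf : Continuous f) (hc : HasCompactSupport f) :
    MemLp f 2 (volume.restrict (N n)) :=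
  (hf.memLp_of_hasCompactSupport hc).restrict _

theorem hasCompactSupport_gradient {n : ℕ} {φ : E n → ℝ} (hc : HasCompactSupport φ) :
    HasCompactSupport (∇ φ) :=
  (hc.fderiv ℝ).comp_left (map_zero (InnerProductSpace.toDual ℝ (E n)).symm)

theorem IsH1.add {n : ℕ} {u v : E n → ℝ} {G H : E n → E n} (hu : IsH1 u G) (hv : IsH1 v H) :
    IsH1 (u + v) (G + H) where
  memLp := hu.memLp.add hv.memLp
  memLp_grad := hu.memLp_grad.add hv.memLp_grad
  weak φ hφ hc hs := by
    have h1 := memLp_of_continuous hφ.continuous hc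
    have h2 := memLp_of_continuous (continuous_gradient hφ) (hasCompactSupport_gradient hc)
    simp only [Pi.add_apply, add_smul, smul_add]
    rw [integral_add (integrable_smul_of_memLp hu.memLp h2)
      (integrable_smul_of_memLp hv.memLp h2),
      integral_add (integrable_smul_of_memLp h1 hu.memLp_grad)
      (integrable_smul_of_memLp h1 hv.memLp_grad), hu.weak φ hφ hc hs, hv.weak φ hφ hc hs,
      neg_add]

theorem IsH1.const_smul {n : ℕ} {u : E n → ℝ} {G : E n → E n} (c : ℝ) (hu : IsH1 u G) :
    IsH1 (c • u) (c • G) where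
  memLp := hu.memLp.const_smul c
  memLp_grad := hu.memLp_grad.const_smul c
  weak φ hφ hc hs := by
    have h1 : ∀ x, (c • u) x • ∇ φ x = c • (u x • ∇ φ x) := fun x => by
      rw [Pi.smul_apply, smul_eq_mul, mul_smul]
    have h2 : ∀ x, φ x • (c • G) x = c • (φ x • G x) := fun x => by
      rw [Pi.smul_apply, smul_comm]
    simp only [h1, h2]
    rw [integral_smul, integral_smul, hu.weak φ hφ hc hs, smul_neg]

theorem gradient_add {n : ℕ} {φ ψ : E n → ℝ} (hφ : ContDiff ℝ ∞ φ) (hψ : ContDiff ℝ ∞ ψ) :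
    ∇ (φ + ψ) = ∇ φ + ∇ ψ := by
  funext x
  simp only [gradient, Pi.add_apply]
  rw [fderiv_add (hφ.differentiable (by simp) x) (hψ.differentiable (by simp) x), map_add]

theorem gradient_const_smul {n : ℕ} {φ : E n → ℝ} (c : ℝ) (hφ : ContDiff ℝ ∞ φ) :
    ∇ (c • φ) = c • ∇ φ := by
  funext x
  simp only [gradient, Pi.smul_apply]
  rw [fderiv_const_smul (hφ.differentiable (by simp) x) c, map_smulₛₗ]
  simp

theorem tendsto_eLpNorm_add {n : ℕ} {V : Type*} [NormedAddCommGroup V] {μ : Measure (E n)}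
    {a b : ℕ → E n → V} {u v : E n → V}
    (ha : ∀ k, AEStronglyMeasurable (a k - u) μ) (hb : ∀ k, AEStronglyMeasurable (b k - v) μ)
    (h1 : Tendsto (fun k => eLpNorm (a k - u) 2 μ) atTop (𝓝 0))
    (h2 : Tendsto (fun k => eLpNorm (b k - v) 2 μ) atTop (𝓝 0)) :
    Tendsto (fun k => eLpNorm (a k + b k - (u + v)) 2 μ) atTop (𝓝 0) := by
  have h := h1.add h2
  rw [add_zero] at h
  refine tendsto_of_tendsto_of_tendsto_of_le_of_le tendsto_const_nhds h (fun k => zero_le)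
    (fun k => ?_)
  have : a k + b k - (u + v) = (a k - u) + (b k - v) := by abel
  simp only [this]
  exact eLpNorm_add_le (ha k) (hb k) (by norm_num)

theorem tendsto_eLpNorm_const_smul {n : ℕ} {V : Type*} [NormedAddCommGroup V] [NormedSpace ℝ V]
    {μ : Measure (E n)} {a : ℕ → E n → V} {u : E n → V} (c : ℝ)
    (h1 : Tendsto (fun k => eLpNorm (a k - u) 2 μ) atTop (𝓝 0)) :
    Tendsto (fun k => eLpNorm (c • a k - c • u) 2 μ) atTop (𝓝 0) := by
  have h := ENNReal.Tendsto.const_mul (a := ‖c‖ₑ) h1 (Or.inr enorm_ne_top)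
  rw [mul_zero] at h
  refine h.congr (fun k => ?_)
  rw [← smul_sub, eLpNorm_const_smul]

theorem HasTrace.add {n : ℕ} {u v : E n → ℝ} {G H : E n → E n} {f k : BoundaryL2 n}
    (hu : HasTrace u G f) (hv : HasTrace v H k) : HasTrace (u + v) (G + H) (f + k) := by
  obtain ⟨hu0, φ, hφ, h1, h2, h3⟩ := hu
  obtain ⟨hv0, ψ, hψ, k1, k2, k3⟩ := hv
  refine ⟨hu0.add hv0, fun j => φ j + ψ j, fun j => (hφ j).add (hψ j), ?_, ?_, ?_⟩
  · exact tendsto_eLpNorm_add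
      (fun j => (hφ j).continuous.aestronglyMeasurable.sub hu0.memLp.1)
      (fun j => (hψ j).continuous.aestronglyMeasurable.sub hv0.memLp.1) h1 k1
  · simp only [gradient_add (hφ _) (hψ _)]
    exact tendsto_eLpNorm_add
      (fun j => (continuous_gradient (hφ j)).aestronglyMeasurable.sub hu0.memLp_grad.1)
      (fun j => (continuous_gradient (hψ j)).aestronglyMeasurable.sub hv0.memLp_grad.1) h2 k2
  · refine (tendsto_eLpNorm_add
      (fun j => (hφ j).continuous.aestronglyMeasurable.sub (Lp.aestronglyMeasurable f))
      (fun j => (hψ j).continuous.aestronglyMeasurable.sub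
        (Lp.aestronglyMeasurable k)) h3 k3).congr (fun j => ?_)
    refine eLpNorm_congr_ae ?_
    filter_upwards [Lp.coeFn_add f k] with x hx
    simp only [Pi.sub_apply, hx]

theorem HasTrace.const_smul {n : ℕ} {u : E n → ℝ} {G : E n → E n} {f : BoundaryL2 n} (c : ℝ)
    (hu : HasTrace u G f) : HasTrace (c • u) (c • G) (c • f) := by
  obtain ⟨hu0, φ, hφ, h1, h2, h3⟩ := hu
  refine ⟨hu0.const_smul c, fun j => c • φ j, fun j => (hφ j).const_smul c, ?_, ?_, ?_⟩
  · exact tendsto_eLpNorm_const_smul c h1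
  · simp only [gradient_const_smul c (hφ _)]
    exact tendsto_eLpNorm_const_smul c h2
  · refine (tendsto_eLpNorm_const_smul c h3).congr (fun j => ?_)
    refine eLpNorm_congr_ae ?_
    filter_upwards [Lp.coeFn_smul c f] with x hx
    simp only [Pi.sub_apply, hx]

theorem hasTrace_zero (n : ℕ) : HasTrace (0 : E n → ℝ) 0 0 := by
  have hg : ∇ (0 : E n → ℝ) = 0 := by
    funext x
    simp [gradient]
  refine ⟨⟨MemLp.zero, MemLp.zero, fun φ _ _ _ => by simp⟩, fun _ => 0,
    fun _ => contDiff_const, ?_, ?_, ?_⟩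
  · simp
  · simp [hg]
  · have : ∀ k : ℕ, eLpNorm ((0 : E n → ℝ) - ⇑(0 : BoundaryL2 n)) 2 (surfaceMeasure n) = 0 := by
      intro k
      rw [eLpNorm_congr_ae (g := 0)]
      · simp
      · filter_upwards [Lp.coeFn_zero ℝ 2 (surfaceMeasure n)] with x hx
        rw [Pi.sub_apply, hx, sub_self, Pi.zero_apply]
    exact tendsto_const_nhds.congr (fun k => (this k).symm)

/-- `H^{1/2}(∂N)`, the space of boundary traces of functions in `H¹(N)`. -/
def HHalf (n : ℕ) : Submodule ℝ (BoundaryL2 n) where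
  carrier := {f | ∃ u G, HasTrace u G f}
  add_mem' := by
    rintro f k ⟨u, G, hu⟩ ⟨v, H, hv⟩
    exact ⟨_, _, hu.add hv⟩
  zero_mem' := ⟨_, _, hasTrace_zero n⟩
  smul_mem' := by
    rintro c f ⟨u, G, hu⟩
    exact ⟨_, _, hu.const_smul c⟩

/-! ### Weak solutions, currents and the Dirichlet-to-Neumann map -/

/-- The current `σ G`, where `G = ∇u`. -/
def flux {n : ℕ} (σ : E n → Matrix (Fin n) (Fin n) ℝ) (G : E n → E n) (x : E n) : E n :=
  Matrix.toEuclideanLin (σ x) (G x)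

/-- `u ∈ H¹(N)`, with weak gradient `G`, solves `∇ · σ ∇u = 0` in `N` in the sense of
distributions: the current is a locally integrable field, whose distributional divergence
vanishes. -/
structure IsSolution {n : ℕ} (σ : E n → Matrix (Fin n) (Fin n) ℝ) (u : E n → ℝ)
    (G : E n → E n) : Prop where
  isH1 : IsH1 u G
  locInt : LocallyIntegrableOn (flux σ G) (N n)
  weak : ∀ φ : E n → ℝ, ContDiff ℝ ∞ φ → HasCompactSupport φ → tsupport φ ⊆ N n →
    ∫ x in N n, inner ℝ (flux σ G x) (∇ φ x) = 0

/-- The conormal derivative `ν · σ ∇u|_{∂N}` of a solution (with `G = ∇u`) is the functional `h` on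
`H^{1/2}(∂N)`: by Green's formula `⟨h, w|_{∂N}⟩ = ∫_N σ ∇u · ∇w` for all `w ∈ H¹(N)`. -/
def HasConormal {n : ℕ} (σ : E n → Matrix (Fin n) (Fin n) ℝ) (G : E n → E n)
    (h : Module.Dual ℝ (HHalf n)) : Prop :=
  ∀ (w : E n → ℝ) (W : E n → E n) (k : HHalf n), HasTrace w W k →
    IntegrableOn (fun x => inner ℝ (flux σ G x) (W x)) (N n) ∧
      h k = ∫ x in N n, inner ℝ (flux σ G x) (W x)

/-- The functions that are (essentially) bounded on `N`. -/
def boundedFunctions (n : ℕ) : Set (E n → ℝ) :=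
  {u | ∃ M : ℝ, ∀ᵐ x ∂(volume.restrict (N n)), |u x| ≤ M}

/-- The (essentially) bounded elements of `H^{1/2}(∂N)`. -/
def boundedData (n : ℕ) : Set (HHalf n) :=
  {f | ∃ M : ℝ, ∀ᵐ x ∂(surfaceMeasure n), |(f : BoundaryL2 n) x| ≤ M}

/-- `Λ` is the Dirichlet-to-Neumann map of the conductivity `σ` for solutions in the class `S` and
boundary values in `D ⊆ H^{1/2}(∂N)`: for each `f ∈ D` the Dirichlet problem `∇ · σ ∇u = 0` in `N`,
`u|_{∂N} = f`, has exactly one solution `u ∈ H¹(N) ∩ S` (up to null sets), and `Λ f` is its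
conormal derivative. This determines `Λ` on `D`. -/
def IsDNMap {n : ℕ} (S : Set (E n → ℝ)) (D : Set (HHalf n))
    (σ : E n → Matrix (Fin n) (Fin n) ℝ) (Λ : HHalf n →ₗ[ℝ] Module.Dual ℝ (HHalf n)) : Prop :=
  ∀ f ∈ D,
    (∃ u G, u ∈ S ∧ IsSolution σ u G ∧ HasTrace u G f ∧ HasConormal σ G (Λ f)) ∧
    ∀ u G v H, u ∈ S → IsSolution σ u G → HasTrace u G f →
      v ∈ S → IsSolution σ v H → HasTrace v H f → u =ᵐ[volume.restrict (N n)] v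

/-- The Cauchy data `(u|_{∂N}, ν · σ ∇u|_{∂N})` of all solutions `u ∈ H¹(N) ∩ S`. -/
def cauchyData {n : ℕ} (S : Set (E n → ℝ)) (σ : E n → Matrix (Fin n) (Fin n) ℝ) :
    Set (HHalf n × Module.Dual ℝ (HHalf n)) :=
  {p | ∃ u G, u ∈ S ∧ IsSolution σ u G ∧ HasTrace u G p.1 ∧ HasConormal σ G p.2}

end Cloaking

end

/-!
For the push-forward conductivity the change of variables `x = blowDown y` preserves the Dirichlet
form: it turns a harmonic function `v` on `N` into a solution `v ∘ blowDown` on `1 < |y| < 2`, and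
it is the identity on `∂N`. What has to be shown is that this correspondence survives at the cloaked
ball, although the transformation is singular at the origin and the conductivity degenerates at
`|y| = 1`.

*From harmonic functions to solutions.* A weakly harmonic `v` is smooth near the origin
(`exists_smooth_of_isDivFree`: it agrees with its convolution with a smooth radial kernel, because
testing the equation with radial functions shows that such averages do not depend on the radius).
Hence `v ∘ blowDown` is Lipschitz continuous up to the unit sphere, on which it takes the constant
value `v 0`; continued by this constant, it is in `H¹(N)` and has the trace of `v`
(`exists_hasTrace_pull`). The current of the continued function vanishes in the unit ball. Outside
it is bounded by the gradient, and its radial component carries the additional factor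
`(|y| - 1)^(n-1)`. So no current enters the cloaked ball: testing with `κφ`, for cutoff functions
`κ` that vanish near the ball and have gradients of size `(|y| - 1)⁻¹`, and letting `κ` tend to one
shows that the equation holds in all of `N` (`isSolution_pull`). The conormal derivative can be
computed with functions that vanish near the cloaked ball, for which the change of variables is
smooth, so it is that of `v` (`integral_flux_pullGrad_eq`, `hasConormal_pull`).

*Uniqueness.* For both conductivities the form `∫ σ G · G` is finite for `G ∈ L²` and positive
definite almost everywhere (`isAdmissible_cloakMetric`). The difference of two solutions with the
same trace has trace zero, hence is an `H¹` limit of test functions (`HasTrace.isH10`), and may be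
inserted in the equation: its gradient vanishes, and so does the difference itself by the Poincaré
inequality (`IsSolution.ae_eq`). In particular all solutions for the singular conductivity are
transforms of harmonic functions.

*Existence.* The Dirichlet problem for the Laplace equation is solved by orthogonal projection in
`L²` (`exists_dirichlet`); bounded boundary values give bounded solutions by the maximum principle
(`HasTrace.bounded`), and the transformation preserves boundedness. The pairing of a divergence free
field with gradients depends only on the trace, which yields the linear Dirichlet-to-Neumann map
(`exists_dnMap`). Each boundary value thus has exactly one solution for either conductivity, with
equal conormal derivatives, and equality of the Cauchy data follows.
-/

noncomputable section

namespace Cloaking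

/-! ### Gradients, cutoff functions and `L²` limits -/

/-- Lebesgue measure on `N`. -/
abbrev volN (n : ℕ) : Measure (E n) := volume.restrict (N n)

theorem measurableSet_N (n : ℕ) : MeasurableSet (N n) := Metric.isOpen_ball.measurableSet

instance isFiniteMeasure_volN (n : ℕ) : IsFiniteMeasure (volN n) :=
  ⟨by simpa [N] using (measure_ball_lt_top : volume (Metric.ball (0 : E n) 2) < ⊤)⟩

instance isFiniteMeasure_surfaceMeasure (n : ℕ) : IsFiniteMeasure (surfaceMeasure n) := by
  refine ⟨?_⟩
  rw [surfaceMeasure, Measure.smul_apply]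
  exact ENNReal.mul_lt_top (by simp) (measure_lt_top _ _)

theorem hasGradientAt_mul {n : ℕ} {f g : E n → ℝ} {F G : E n} {x : E n}
    (hf : HasGradientAt f F x) (hg : HasGradientAt g G x) :
    HasGradientAt (fun y => f y * g y) (f x • G + g x • F) x := by
  rw [hasGradientAt_iff_hasFDerivAt] at *
  refine (hf.mul hg).congr_fderiv ?_
  rw [map_add, map_smul, map_smul]

theorem hasGradientAt_comp {n : ℕ} {f : E n → ℝ} {h : ℝ → ℝ} {h' : ℝ} {F : E n} {x : E n}
    (hh : HasDerivAt h h' (f x)) (hf : HasGradientAt f F x) :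
    HasGradientAt (fun y => h (f y)) (h' • F) x := by
  rw [hasGradientAt_iff_hasFDerivAt] at *
  refine (hh.comp_hasFDerivAt x hf).congr_fderiv ?_
  rw [map_smul]

theorem hasGradientAt_norm_sq {n : ℕ} (x : E n) :
    HasGradientAt (fun y : E n => ‖y‖ ^ 2) ((2 : ℝ) • x) x := by
  rw [hasGradientAt_iff_hasFDerivAt]
  refine (hasStrictFDerivAt_norm_sq x).hasFDerivAt.congr_fderiv ?_
  ext y
  simp [InnerProductSpace.toDual_apply_apply, two_mul]

theorem hasGradientAt_of_contDiff {n : ℕ} {f : E n → ℝ} (hf : ContDiff ℝ ∞ f) (x : E n) :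
    HasGradientAt f (∇ f x) x :=
  (hf.differentiable (by simp) x).hasGradientAt

theorem gradient_mul {n : ℕ} {f g : E n → ℝ} (hf : ContDiff ℝ ∞ f) (hg : ContDiff ℝ ∞ g)
    (x : E n) : ∇ (fun y => f y * g y) x = f x • ∇ g x + g x • ∇ f x :=
  (hasGradientAt_mul (hasGradientAt_of_contDiff hf x) (hasGradientAt_of_contDiff hg x)).gradient

theorem gradient_sub {n : ℕ} {φ ψ : E n → ℝ} (hφ : ContDiff ℝ ∞ φ) (hψ : ContDiff ℝ ∞ ψ) :
    ∇ (φ - ψ) = ∇ φ - ∇ ψ := by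
  have h : φ - ψ = φ + (-1 : ℝ) • ψ := by ext x; simp [sub_eq_add_neg]
  have h2 : ContDiff ℝ ∞ ((-1 : ℝ) • ψ) := hψ.const_smul (-1 : ℝ)
  rw [h, gradient_add hφ h2, gradient_const_smul (-1) hψ]
  ext x; simp [sub_eq_add_neg]

theorem exists_deriv_smoothTransition_bound :
    ∃ M : ℝ, 0 < M ∧ ∀ t, |deriv Real.smoothTransition t| ≤ M := by
  have hc : Continuous (deriv Real.smoothTransition) :=
    (Real.smoothTransition.contDiff (n := 1)).continuous_deriv le_rfl
  have hs : HasCompactSupport (deriv Real.smoothTransition) := by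
    refine HasCompactSupport.intro (isCompact_Icc (a := (0 : ℝ)) (b := 1)) (fun t ht => ?_)
    rw [mem_Icc, not_and_or, not_le, not_le] at ht
    rcases ht with ht | ht
    · have : Real.smoothTransition =ᶠ[𝓝 t] fun _ => 0 := by
        filter_upwards [Iio_mem_nhds ht] with s hs
        exact Real.smoothTransition.zero_of_nonpos (le_of_lt hs)
      rw [this.deriv_eq, deriv_const]
    · have : Real.smoothTransition =ᶠ[𝓝 t] fun _ => 1 := by
        filter_upwards [Ioi_mem_nhds ht] with s hs
        exact Real.smoothTransition.one_of_one_le (le_of_lt hs)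
      rw [this.deriv_eq, deriv_const]
  obtain ⟨C, hC⟩ := hs.exists_bound_of_continuous hc
  exact ⟨|C| + 1, by positivity, fun t => (hC t).trans ((le_abs_self C).trans (by simp))⟩

theorem deriv_smoothTransition_of_neg {t : ℝ} (ht : t < 0) : deriv Real.smoothTransition t = 0 := by
  have : Real.smoothTransition =ᶠ[𝓝 t] fun _ => 0 := by
    filter_upwards [Iio_mem_nhds ht] with s hs
    exact Real.smoothTransition.zero_of_nonpos (le_of_lt hs)
  rw [this.deriv_eq, deriv_const]

theorem deriv_smoothTransition_of_gt {t : ℝ} (ht : 1 < t) : deriv Real.smoothTransition t = 0 := by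
  have : Real.smoothTransition =ᶠ[𝓝 t] fun _ => 1 := by
    filter_upwards [Ioi_mem_nhds ht] with s hs
    exact Real.smoothTransition.one_of_one_le (le_of_lt hs)
  rw [this.deriv_eq, deriv_const]

/-- The radial cutoff `x ↦ S(a|x|² + b)`, where `S` is the standard smooth transition from `0` (on
`(-∞, 0]`) to `1` (on `[1, ∞)`). -/
def cutoff {n : ℕ} (a b : ℝ) (x : E n) : ℝ := Real.smoothTransition (a * ‖x‖ ^ 2 + b)

theorem contDiff_cutoff {n : ℕ} (a b : ℝ) : ContDiff ℝ ∞ (cutoff (n := n) a b) :=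
  (Real.smoothTransition.contDiff (n := ⊤)).comp
    ((contDiff_const.mul (contDiff_norm_sq ℝ)).add contDiff_const)

theorem cutoff_nonneg {n : ℕ} (a b : ℝ) (x : E n) : 0 ≤ cutoff a b x :=
  Real.smoothTransition.nonneg _

theorem cutoff_le_one {n : ℕ} (a b : ℝ) (x : E n) : cutoff a b x ≤ 1 :=
  Real.smoothTransition.le_one _

theorem cutoff_eq_zero {n : ℕ} {a b : ℝ} {x : E n} (h : a * ‖x‖ ^ 2 + b ≤ 0) : cutoff a b x = 0 :=
  Real.smoothTransition.zero_of_nonpos h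

theorem cutoff_eq_one {n : ℕ} {a b : ℝ} {x : E n} (h : 1 ≤ a * ‖x‖ ^ 2 + b) : cutoff a b x = 1 :=
  Real.smoothTransition.one_of_one_le h

theorem gradient_cutoff {n : ℕ} (a b : ℝ) (x : E n) :
    ∇ (cutoff a b) x = (deriv Real.smoothTransition (a * ‖x‖ ^ 2 + b) * (2 * a)) • x := by
  have h1 : HasGradientAt (fun y : E n => a * ‖y‖ ^ 2 + b) (a • (2 : ℝ) • x) x := by
    refine hasGradientAt_comp (h := fun t => a * t + b) ?_ (hasGradientAt_norm_sq x)
    simpa using ((hasDerivAt_id _).const_mul a).add_const b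
  have h2 := (Real.smoothTransition.contDiff (n := 1)).differentiable (by simp)
    (a * ‖x‖ ^ 2 + b)
  have h3 := hasGradientAt_comp (f := fun y : E n => a * ‖y‖ ^ 2 + b) h2.hasDerivAt h1
  have h4 : ∇ (cutoff a b) x = _ := h3.gradient
  rw [h4, smul_smul, smul_smul]
  congr 1
  ring

theorem memLp_volN_of_continuous {n : ℕ} {V : Type*} [NormedAddCommGroup V]
    {f : E n → V} (hf : Continuous f) : MemLp f 2 (volN n) := by
  obtain ⟨C, hC⟩ := (isCompact_closedBall (0 : E n) 2).exists_bound_of_continuousOn hf.continuousOn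
  refine MemLp.of_bound hf.aestronglyMeasurable C ?_
  filter_upwards [ae_restrict_mem (measurableSet_N n)] with x hx
  exact hC x (Metric.ball_subset_closedBall hx)

theorem surfaceMeasure_ae_norm {n : ℕ} : ∀ᵐ x ∂(surfaceMeasure n), ‖x‖ = 2 := by
  refine Measure.ae_smul_measure ?_ _
  have hm : Measurable (fun θ : Metric.sphere (0 : E n) 1 => (2 : ℝ) • (θ : E n)) := by fun_prop
  rw [ae_map_iff hm.aemeasurable (measurableSet_eq_fun measurable_norm measurable_const)]
  refine Eventually.of_forall (fun θ => ?_)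
  rw [norm_smul, norm_eq_of_mem_sphere]
  norm_num

theorem memLp_surface_of_continuous {n : ℕ} {f : E n → ℝ} (hf : Continuous f) :
    MemLp f 2 (surfaceMeasure n) := by
  obtain ⟨C, hC⟩ := (isCompact_closedBall (0 : E n) 2).exists_bound_of_continuousOn hf.continuousOn
  refine MemLp.of_bound hf.aestronglyMeasurable C ?_
  filter_upwards [surfaceMeasure_ae_norm] with x hx
  exact hC x (by simp [hx])

/-- Pairing in `L²` is controlled by the product of the norms. -/
theorem enorm_integral_inner_le {n : ℕ} {μ : Measure (E n)} {F D : E n → E n}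
    (hF : MemLp F 2 μ) (hD : MemLp D 2 μ) :
    ‖∫ x, inner ℝ (F x) (D x) ∂μ‖ₑ ≤ eLpNorm F 2 μ * eLpNorm D 2 μ := by
  refine (enorm_integral_le_lintegral_enorm _).trans ?_
  rw [← eLpNorm_one_eq_lintegral_enorm]
  have h := eLpNorm_le_eLpNorm_mul_eLpNorm_of_nnnorm (p := 2) (q := 2) (r := 1) hF.1 hD.1
    (fun a b => inner ℝ a b) 1 (by
      refine Eventually.of_forall (fun x => ?_)
      rw [one_mul]
      exact nnnorm_inner_le_nnnorm _ _)
  simpa using h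

theorem integrable_inner {n : ℕ} {μ : Measure (E n)} {F D : E n → E n}
    (hF : MemLp F 2 μ) (hD : MemLp D 2 μ) : Integrable (fun x => inner ℝ (F x) (D x)) μ := by
  refine (hF.norm.integrable_mul hD.norm).mono' (hF.1.inner hD.1) (Eventually.of_forall fun x => ?_)
  exact norm_inner_le_norm _ _

/-- If the pairing with `F ∈ L²` takes the value `c` on fields arbitrarily close to `G` in `L²`, it
takes the value `c` at `G`. -/
theorem integral_inner_eq_of_approx {n : ℕ} {μ : Measure (E n)} {F G : E n → E n} {c : ℝ}
    (hF : MemLp F 2 μ) (hG : MemLp G 2 μ)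
    (h : ∀ ε : ℝ≥0∞, ε ≠ 0 → ∃ B : E n → E n, MemLp B 2 μ ∧ eLpNorm (B - G) 2 μ ≤ ε ∧
      ‖∫ x, inner ℝ (F x) (B x) ∂μ - c‖ₑ ≤ ε) :
    ∫ x, inner ℝ (F x) (G x) ∂μ = c := by
  rw [← sub_eq_zero, ← enorm_eq_zero]
  by_contra hne
  set a := ‖∫ x, inner ℝ (F x) (G x) ∂μ - c‖ₑ with ha
  set K := eLpNorm F 2 μ + 1 with hK
  have hKt : K ≠ ⊤ := ENNReal.add_ne_top.2 ⟨hF.2.ne, by simp⟩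
  have hK1 : K ≠ 0 := by simp [hK]
  have hat : a ≠ ⊤ := enorm_ne_top
  -- the error is at most `K * ε = a / 2`
  obtain ⟨B, hB, hBG, hBc⟩ := h (a / 2 / K)
    (ENNReal.div_ne_zero.2 ⟨ENNReal.div_ne_zero.2 ⟨hne, by simp⟩, hKt⟩)
  have h1 : ∫ x, inner ℝ (F x) (G x) ∂μ - c =
      (∫ x, inner ℝ (F x) (B x) ∂μ - c) - ∫ x, inner ℝ (F x) ((B - G) x) ∂μ := by
    simp only [Pi.sub_apply, inner_sub_right]
    rw [integral_sub (integrable_inner hF hB) (integrable_inner hF hG)]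
    ring
  have h2 : a ≤ a / 2 / K + eLpNorm F 2 μ * (a / 2 / K) := by
    calc a = _ := by rw [ha, h1]
      _ ≤ _ := enorm_sub_le
      _ ≤ _ := add_le_add hBc ((enorm_integral_inner_le hF (hB.sub hG)).trans
        (mul_le_mul_right hBG _))
  have h3 : a / 2 / K + eLpNorm F 2 μ * (a / 2 / K) = a / 2 := by
    have : a / 2 / K + eLpNorm F 2 μ * (a / 2 / K) = K * (a / 2 / K) := by rw [hK]; ring
    rw [this, ENNReal.mul_div_cancel hK1 hKt]
  rw [h3] at h2
  exact absurd h2 (not_le.2 (ENNReal.half_lt_self hne hat))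

theorem tendsto_zero_iff_approx {ι : Type*} {a : ι → ℝ≥0∞} {l : Filter ι} :
    Tendsto a l (𝓝 0) ↔ ∀ ε : ℝ≥0∞, ε ≠ 0 → ∀ᶠ k in l, a k ≤ ε := by
  rw [ENNReal.tendsto_nhds_zero]
  simp [pos_iff_ne_zero]

/-- A primitive of a smooth function is smooth. -/
theorem exists_smooth_primitive {h : ℝ → ℝ} (hh : ContDiff ℝ ∞ h) (a : ℝ) :
    ContDiff ℝ ∞ (fun s => ∫ t in a..s, h t) ∧
      ∀ s, HasDerivAt (fun s => ∫ t in a..s, h t) (h s) s := by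
  have hd : ∀ s, HasDerivAt (fun s => ∫ t in a..s, h t) (h s) s := fun s =>
    hh.continuous.integral_hasStrictDerivAt a s |>.hasDerivAt
  refine ⟨?_, hd⟩
  rw [contDiff_infty_iff_deriv]
  refine ⟨fun s => (hd s).differentiableAt, ?_⟩
  rwa [funext fun s => (hd s).deriv]

/-! ### Approximation of `H¹` functions by smooth functions -/

/-- A smooth function is in `H¹(N)`, with its gradient as weak gradient. -/
theorem isH1_of_contDiff {n : ℕ} {φ : E n → ℝ} (hφ : ContDiff ℝ ∞ φ) : IsH1 φ (∇ φ) where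
  memLp := memLp_volN_of_continuous hφ.continuous
  memLp_grad := memLp_volN_of_continuous (continuous_gradient hφ)
  weak ψ hψ hc hs := by
    have hgs : tsupport (∇ ψ) ⊆ N n := by
      refine subset_trans ?_ ((tsupport_fderiv_subset ℝ).trans hs)
      exact tsupport_comp_subset (map_zero (InnerProductSpace.toDual ℝ (E n)).symm) _
    have e1 : ∫ x in N n, φ x • ∇ ψ x = ∫ x, φ x • ∇ ψ x := by
      refine setIntegral_eq_integral_of_forall_compl_eq_zero (fun x hx => ?_)
      rw [image_eq_zero_of_notMem_tsupport (fun h => hx (hgs h)), smul_zero]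
    have e2 : ∫ x in N n, ψ x • ∇ φ x = ∫ x, ψ x • ∇ φ x := by
      refine setIntegral_eq_integral_of_forall_compl_eq_zero (fun x hx => ?_)
      rw [image_eq_zero_of_notMem_tsupport (fun h => hx (hs h)), zero_smul]
    have i1 : Integrable (fun x => φ x • ∇ ψ x) :=
      (hφ.continuous.smul (continuous_gradient hψ)).integrable_of_hasCompactSupport
        ((hasCompactSupport_gradient hc).smul_left)
    have i2 : Integrable (fun x => ψ x • ∇ φ x) :=
      (hψ.continuous.smul (continuous_gradient hφ)).integrable_of_hasCompactSupport
        (hc.smul_right)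
    change ∫ x in N n, φ x • ∇ ψ x = -∫ x in N n, ψ x • ∇ φ x
    rw [e1, e2]
    refine ext_inner_left ℝ (fun v => ?_)
    rw [inner_neg_right, ← integral_inner i1, ← integral_inner i2]
    have hf : ∀ (f : E n → ℝ) x, inner ℝ v (∇ f x) = fderiv ℝ f x v := fun f x => by
      rw [real_inner_comm, inner_gradient_left]
    simp only [inner_smul_right, hf]
    have c1 : Continuous (fun x => fderiv ℝ φ x v) :=
      (hφ.continuous_fderiv (by simp)).clm_apply continuous_const
    have c2 : Continuous (fun x => fderiv ℝ ψ x v) :=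
      (hψ.continuous_fderiv (by simp)).clm_apply continuous_const
    have k2 : HasCompactSupport (fun x => fderiv ℝ ψ x v) := hc.fderiv_apply ℝ v
    rw [integral_mul_fderiv_eq_neg_fderiv_mul_of_integrable (𝕜 := ℝ)
      ((c1.mul hψ.continuous).integrable_of_hasCompactSupport hc.mul_left)
      ((hφ.continuous.mul c2).integrable_of_hasCompactSupport k2.mul_left)
      ((hφ.continuous.mul hψ.continuous).integrable_of_hasCompactSupport hc.mul_left)
      (fun x _ => hφ.differentiable (by simp) x) (fun x _ => hψ.differentiable (by simp) x)]
    simp only [mul_comm]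

theorem enorm_integral_smul_le {n : ℕ} {V : Type*} [NormedAddCommGroup V] [NormedSpace ℝ V]
    {μ : Measure (E n)} {f : E n → ℝ} {D : E n → V} (hf : MemLp f 2 μ) (hD : MemLp D 2 μ) :
    ‖∫ x, f x • D x ∂μ‖ₑ ≤ eLpNorm f 2 μ * eLpNorm D 2 μ := by
  refine (enorm_integral_le_lintegral_enorm _).trans ?_
  rw [← eLpNorm_one_eq_lintegral_enorm]
  exact eLpNorm_smul_le_mul_eLpNorm (p := 2) (q := 2) (r := 1) hD.1 hf.1

theorem eq_zero_of_enorm_le_mul {V : Type*} [NormedAddCommGroup V] {a : V} {K : ℝ≥0∞}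
    (hK : K ≠ ⊤) (h : ∀ ε : ℝ≥0∞, ε ≠ 0 → ‖a‖ₑ ≤ ε * K) : a = 0 := by
  rw [← enorm_eq_zero, ← nonpos_iff_eq_zero]
  refine ENNReal.le_of_forall_pos_le_add fun δ hδ _ => ?_
  have hK1 : K + 1 ≠ ⊤ := ENNReal.add_ne_top.2 ⟨hK, by simp⟩
  refine (h (δ / (K + 1)) (ENNReal.div_ne_zero.2 ⟨by simpa using hδ.ne', hK1⟩)).trans ?_
  rw [zero_add]
  calc (δ : ℝ≥0∞) / (K + 1) * K ≤ δ / (K + 1) * (K + 1) := by gcongr; simp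
    _ = δ := ENNReal.div_mul_cancel (by simp) hK1

/-- `H¹(N)` is closed: a limit of smooth functions whose gradients converge is in `H¹(N)`. -/
theorem isH1_of_approx {n : ℕ} {u : E n → ℝ} {G : E n → E n} (hu : MemLp u 2 (volN n))
    (hG : MemLp G 2 (volN n))
    (h : ∀ ε : ℝ≥0∞, ε ≠ 0 → ∃ φ : E n → ℝ, ContDiff ℝ ∞ φ ∧
      eLpNorm (φ - u) 2 (volN n) ≤ ε ∧ eLpNorm (∇ φ - G) 2 (volN n) ≤ ε) : IsH1 u G where
  memLp := hu
  memLp_grad := hG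
  weak ψ hψ hc hs := by
    have m1 : MemLp ψ 2 (volN n) := memLp_volN_of_continuous hψ.continuous
    have m2 : MemLp (∇ ψ) 2 (volN n) := memLp_volN_of_continuous (continuous_gradient hψ)
    rw [← sub_eq_zero, sub_neg_eq_add]
    refine eq_zero_of_enorm_le_mul (K := eLpNorm (∇ ψ) 2 (volN n) + eLpNorm ψ 2 (volN n))
      (ENNReal.add_ne_top.2 ⟨m2.2.ne, m1.2.ne⟩) (fun ε hε => ?_)
    obtain ⟨φ, hφ, h1, h2⟩ := h ε hε
    have w := (isH1_of_contDiff hφ).weak ψ hψ hc hs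
    have n1 : MemLp φ 2 (volN n) := memLp_volN_of_continuous hφ.continuous
    have n2 : MemLp (∇ φ) 2 (volN n) := memLp_volN_of_continuous (continuous_gradient hφ)
    have e1 : ∫ x in N n, (φ - u) x • ∇ ψ x =
        (∫ x in N n, φ x • ∇ ψ x) - ∫ x in N n, u x • ∇ ψ x := by
      simp only [Pi.sub_apply, sub_smul]
      exact integral_sub (integrable_smul_of_memLp n1 m2) (integrable_smul_of_memLp hu m2)
    have e2 : ∫ x in N n, ψ x • (∇ φ - G) x =
        (∫ x in N n, ψ x • ∇ φ x) - ∫ x in N n, ψ x • G x := by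
      simp only [Pi.sub_apply, smul_sub]
      exact integral_sub (integrable_smul_of_memLp m1 n2) (integrable_smul_of_memLp m1 hG)
    have e3 : (∫ x in N n, u x • ∇ ψ x) + ∫ x in N n, ψ x • G x =
        -((∫ x in N n, (φ - u) x • ∇ ψ x) + ∫ x in N n, ψ x • (∇ φ - G) x) := by
      rw [e1, e2, w]; abel
    rw [e3, enorm_neg, mul_add]
    refine (enorm_add_le _ _).trans (add_le_add ?_ ?_)
    · exact (enorm_integral_smul_le (n1.sub hu) m2).trans (mul_le_mul_left h1 _)
    · refine (enorm_integral_smul_le m1 (n2.sub hG)).trans ?_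
      rw [mul_comm]
      exact mul_le_mul_left h2 _

theorem HasTrace.exists_approx {n : ℕ} {u : E n → ℝ} {G : E n → E n} {f : BoundaryL2 n}
    (h : HasTrace u G f) {ε : ℝ≥0∞} (hε : ε ≠ 0) : ∃ φ : E n → ℝ, ContDiff ℝ ∞ φ ∧
      eLpNorm (φ - u) 2 (volN n) ≤ ε ∧ eLpNorm (∇ φ - G) 2 (volN n) ≤ ε ∧
      eLpNorm (φ - ⇑f) 2 (surfaceMeasure n) ≤ ε := by
  obtain ⟨-, φ, hφ, h1, h2, h3⟩ := h
  obtain ⟨k, k1, k2, k3⟩ := ((tendsto_zero_iff_approx.1 h1 ε hε).and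
    ((tendsto_zero_iff_approx.1 h2 ε hε).and (tendsto_zero_iff_approx.1 h3 ε hε))).exists
  exact ⟨φ k, hφ k, k1, k2, k3⟩

theorem hasTrace_of_approx {n : ℕ} {u : E n → ℝ} {G : E n → E n} {f : BoundaryL2 n}
    (hu : MemLp u 2 (volN n)) (hG : MemLp G 2 (volN n))
    (h : ∀ ε : ℝ≥0∞, ε ≠ 0 → ∃ φ : E n → ℝ, ContDiff ℝ ∞ φ ∧
      eLpNorm (φ - u) 2 (volN n) ≤ ε ∧ eLpNorm (∇ φ - G) 2 (volN n) ≤ ε ∧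
      eLpNorm (φ - ⇑f) 2 (surfaceMeasure n) ≤ ε) : HasTrace u G f := by
  refine ⟨isH1_of_approx hu hG fun ε hε => ?_, ?_⟩
  · obtain ⟨φ, h0, h1, h2, -⟩ := h ε hε
    exact ⟨φ, h0, h1, h2⟩
  · have hk : ∀ k : ℕ, ((k : ℝ≥0∞) + 1)⁻¹ ≠ 0 := fun k => by simp
    choose φ h0 h1 h2 h3 using fun k : ℕ => h _ (hk k)
    have hl : Tendsto (fun k : ℕ => ((k : ℝ≥0∞) + 1)⁻¹) atTop (𝓝 0) := by
      have := (tendsto_add_atTop_iff_nat 1).2 ENNReal.tendsto_inv_nat_nhds_zero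
      simpa using this
    refine ⟨φ, h0, ?_, ?_, ?_⟩ <;>
    exact tendsto_of_tendsto_of_tendsto_of_le_of_le tendsto_const_nhds hl (fun k => zero_le) ‹_›

theorem HasTrace.sub {n : ℕ} {u v : E n → ℝ} {G H : E n → E n} {f k : BoundaryL2 n}
    (hu : HasTrace u G f) (hv : HasTrace v H k) : HasTrace (u - v) (G - H) (f - k) := by
  have h := hu.add (hv.const_smul (-1))
  have e1 : u + (-1 : ℝ) • v = u - v := by ext x; simp [sub_eq_add_neg]
  have e2 : G + (-1 : ℝ) • H = G - H := by ext x; simp [sub_eq_add_neg]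
  have e3 : f + (-1 : ℝ) • k = f - k := by rw [neg_one_smul, sub_eq_add_neg]
  rwa [e1, e2, e3] at h

theorem IsH1.congr_ae {n : ℕ} {u v : E n → ℝ} {G H : E n → E n} (h : IsH1 u G)
    (huv : u =ᵐ[volN n] v) (hGH : G =ᵐ[volN n] H) : IsH1 v H where
  memLp := (memLp_congr_ae huv).1 h.memLp
  memLp_grad := (memLp_congr_ae hGH).1 h.memLp_grad
  weak ψ hψ hc hs := by
    have e1 : ∫ x in N n, v x • ∇ ψ x = ∫ x in N n, u x • ∇ ψ x :=
      integral_congr_ae (by filter_upwards [huv] with x hx; rw [hx])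
    have e2 : ∫ x in N n, ψ x • H x = ∫ x in N n, ψ x • G x :=
      integral_congr_ae (by filter_upwards [hGH] with x hx; rw [hx])
    rw [e1, e2, h.weak ψ hψ hc hs]

theorem HasTrace.congr_ae {n : ℕ} {u v : E n → ℝ} {G H : E n → E n} {f : BoundaryL2 n}
    (h : HasTrace u G f) (huv : u =ᵐ[volN n] v) (hGH : G =ᵐ[volN n] H) : HasTrace v H f := by
  obtain ⟨h0, φ, hφ, h1, h2, h3⟩ := h
  refine ⟨h0.congr_ae huv hGH, φ, hφ, h1.congr fun k => ?_, h2.congr fun k => ?_, h3⟩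
  · exact eLpNorm_congr_ae ((EventuallyEq.refl _ _).sub huv)
  · exact eLpNorm_congr_ae ((EventuallyEq.refl _ _).sub hGH)

/-- A smooth function has its restriction to `∂N` as trace. -/
theorem hasTrace_of_contDiff {n : ℕ} {φ : E n → ℝ} (hφ : ContDiff ℝ ∞ φ) :
    HasTrace φ (∇ φ) ((memLp_surface_of_continuous hφ.continuous).toLp φ) := by
  refine ⟨isH1_of_contDiff hφ, fun _ => φ, fun _ => hφ, by simp, by simp, ?_⟩
  refine tendsto_const_nhds.congr fun _ => Eq.symm ?_
  rw [eLpNorm_congr_ae (g := 0), eLpNorm_zero]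
  filter_upwards [(memLp_surface_of_continuous hφ.continuous).coeFn_toLp] with x hx
  simp [hx]

/-- The test functions on `N`: smooth functions with compact support in `N`. -/
structure IsTest {n : ℕ} (φ : E n → ℝ) : Prop where
  smooth : ContDiff ℝ ∞ φ
  compact : HasCompactSupport φ
  supp : tsupport φ ⊆ N n

theorem isTest_of_eq_zero {n : ℕ} {φ : E n → ℝ} (hφ : ContDiff ℝ ∞ φ) {R : ℝ} (hR : R < 2)
    (h : ∀ x, R < ‖x‖ → φ x = 0) : IsTest φ := by
  have hs : tsupport φ ⊆ Metric.closedBall 0 R := by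
    refine closure_minimal (fun x hx => ?_) Metric.isClosed_closedBall
    rw [mem_closedBall_zero_iff]
    by_contra hlt
    exact hx (h x (not_le.1 hlt))
  exact ⟨hφ, (isCompact_closedBall _ _).of_isClosed_subset (isClosed_tsupport _) hs,
    hs.trans (Metric.closedBall_subset_ball hR)⟩

theorem IsTest.exists_radius {n : ℕ} {φ : E n → ℝ} (hφ : IsTest φ) :
    ∃ R : ℝ, 1 < R ∧ R < 2 ∧ ∀ x, R < ‖x‖ → φ x = 0 := by
  obtain ⟨R, hR, hs⟩ : ∃ R < 2, tsupport φ ⊆ Metric.closedBall 0 R := by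
    rcases (tsupport φ).eq_empty_or_nonempty with h | h
    · exact ⟨0, by norm_num, by simp [h]⟩
    · obtain ⟨x, hx, hm⟩ := hφ.compact.exists_isMaxOn h continuous_norm.continuousOn
      refine ⟨‖x‖, by simpa [N] using hφ.supp hx, fun y hy => ?_⟩
      simpa using hm hy
  refine ⟨max R (3 / 2), lt_max_of_lt_right (by norm_num), max_lt hR (by norm_num),
    fun x hx => image_eq_zero_of_notMem_tsupport fun hx' => ?_⟩
  have := hs hx'
  rw [mem_closedBall_zero_iff] at this
  exact absurd hx (not_lt.2 (this.trans (le_max_left _ _)))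

/-- `u` lies in the closure `H¹₀(N)` of the test functions in `H¹(N)`, and `G` is its weak
gradient. -/
structure IsH10 {n : ℕ} (u : E n → ℝ) (G : E n → E n) : Prop where
  memLp : MemLp u 2 (volN n)
  memLp_grad : MemLp G 2 (volN n)
  approx : ∀ ε : ℝ≥0∞, ε ≠ 0 → ∃ φ : E n → ℝ, IsTest φ ∧
    eLpNorm (φ - u) 2 (volN n) ≤ ε ∧ eLpNorm (∇ φ - G) 2 (volN n) ≤ ε

/-- A square integrable field that is orthogonal to the gradients of all test functions is
orthogonal to the gradients of all functions in `H¹₀(N)`. -/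
theorem IsH10.integral_inner_eq_zero {n : ℕ} {u : E n → ℝ} {G F : E n → E n} (h : IsH10 u G)
    (hF : MemLp F 2 (volN n))
    (hw : ∀ φ : E n → ℝ, IsTest φ → ∫ x in N n, inner ℝ (F x) (∇ φ x) = 0) :
    ∫ x in N n, inner ℝ (F x) (G x) = 0 := by
  refine integral_inner_eq_of_approx hF h.memLp_grad fun ε hε => ?_
  obtain ⟨φ, hφ, -, h2⟩ := h.approx ε hε
  refine ⟨∇ φ, memLp_volN_of_continuous (continuous_gradient hφ.smooth), h2, ?_⟩
  rw [hw φ hφ]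
  simp

/-- Functions in `H¹₀(N)` have vanishing trace. -/
theorem IsH10.hasTrace {n : ℕ} {u : E n → ℝ} {G : E n → E n} (h : IsH10 u G) :
    HasTrace u G 0 := by
  refine hasTrace_of_approx h.memLp h.memLp_grad fun ε hε => ?_
  obtain ⟨φ, hφ, h1, h2⟩ := h.approx ε hε
  refine ⟨φ, hφ.smooth, h1, h2, ?_⟩
  obtain ⟨R, -, hR, h0⟩ := hφ.exists_radius
  rw [eLpNorm_congr_ae (g := 0)]
  · simp
  · filter_upwards [Lp.coeFn_zero ℝ 2 (surfaceMeasure n), surfaceMeasure_ae_norm] with x hx hx2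
    rw [Pi.sub_apply, hx, h0 x (by rw [hx2]; exact hR)]
    simp

/-! ### Functions with vanishing trace -/

/-- Dominated convergence in `L²`. -/
theorem tendsto_eLpNorm_of_dominated {n : ℕ} {V : Type*} [NormedAddCommGroup V]
    {μ : Measure (E n)} {F : ℕ → E n → V} {G : E n → V} {g : E n → ℝ}
    (hF : ∀ k, AEStronglyMeasurable (F k) μ) (hg : MemLp g 2 μ)
    (hb : ∀ k, ∀ᵐ x ∂μ, ‖F k x‖ ≤ g x)
    (hlim : ∀ᵐ x ∂μ, Tendsto (fun k => F k x) atTop (𝓝 (G x))) :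
    Tendsto (fun k => eLpNorm (F k - G) 2 μ) atTop (𝓝 0) := by
  have hG : AEStronglyMeasurable G μ := aestronglyMeasurable_of_tendsto_ae _ hF hlim
  have hsq : ∀ k, eLpNorm (F k - G) 2 μ = (∫⁻ x, ‖F k x - G x‖ₑ ^ 2 ∂μ) ^ (1 / 2 : ℝ) := by
    intro k
    rw [eLpNorm_eq_lintegral_rpow_enorm_toReal (by simp) (by simp)]
    simp
  simp only [hsq]
  have key : Tendsto (fun k => ∫⁻ x, ‖F k x - G x‖ₑ ^ 2 ∂μ) atTop (𝓝 (∫⁻ _, 0 ∂μ)) := by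
    refine tendsto_lintegral_of_dominated_convergence' (fun x => (2 * ‖g x‖ₑ) ^ 2)
      (fun k => ((hF k).sub hG).enorm.pow_const 2) ?_ ?_ ?_
    · intro k
      have hall : ∀ᵐ x ∂μ, ∀ k, ‖F k x‖ ≤ g x := ae_all_iff.2 hb
      filter_upwards [hall, hlim] with x hx hl
      have hGx : ‖G x‖ ≤ g x := le_of_tendsto hl.norm (Eventually.of_forall hx)
      have h0 : ∀ a : V, ‖a‖ ≤ g x → ‖a‖ₑ ≤ ‖g x‖ₑ := fun a ha => by
        rw [enorm_le_iff_norm_le]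
        exact ha.trans (le_abs_self _)
      gcongr
      rw [two_mul]
      exact enorm_sub_le.trans (add_le_add (h0 _ (hx k)) (h0 _ hGx))
    · have h1 : eLpNorm ((2 : ℝ) • g) 2 μ < ⊤ := (hg.const_smul (2 : ℝ)).2
      have h2 : eLpNorm ((2 : ℝ) • g) 2 μ = (∫⁻ x, (2 * ‖g x‖ₑ) ^ 2 ∂μ) ^ (1 / 2 : ℝ) := by
        rw [eLpNorm_eq_lintegral_rpow_enorm_toReal (by simp) (by simp)]
        have : ‖(2 : ℝ)‖ₑ = 2 := by
          rw [Real.enorm_eq_ofReal (by norm_num), ENNReal.ofReal_ofNat]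
        simp [enorm_mul, this]
      rw [h2] at h1
      exact (ENNReal.rpow_lt_top_iff_of_pos (by norm_num)).1 h1 |>.ne
    · filter_upwards [hlim] with x hx
      have : Tendsto (fun k => F k x - G x) atTop (𝓝 0) := by
        simpa using hx.sub_const (G x)
      simpa [Function.comp_def] using (ENNReal.continuous_pow 2).tendsto _ |>.comp this.enorm
  rw [lintegral_zero] at key
  simpa [Function.comp_def] using
    (ENNReal.continuous_rpow_const (y := (1 / 2 : ℝ))).tendsto 0 |>.comp key

/-- Integration in polar coordinates. -/
theorem lintegral_polar {n : ℕ} (hn : 1 ≤ n) {f : E n → ℝ≥0∞} (hf : Measurable f) :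
    ∫⁻ x, f x = ∫⁻ θ : Metric.sphere (0 : E n) 1, ∫⁻ r in Ioi (0 : ℝ),
      ENNReal.ofReal (r ^ (n - 1)) * f (r • (θ : E n)) ∂volume ∂(volume.toSphere) := by
  have : Nonempty (Fin n) := ⟨⟨0, hn⟩⟩
  have h0 : ∫⁻ x, f x = ∫⁻ x in ({0}ᶜ : Set (E n)), f x := by
    rw [restrict_compl_singleton]
  rw [h0, ← lintegral_subtype_comap (measurableSet_singleton _).compl]
  have hp := (volume : Measure (E n)).measurePreserving_homeomorphUnitSphereProd
  have h1 : ∀ x : ({0}ᶜ : Set (E n)), f x =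
      (fun p => f ((homeomorphUnitSphereProd (E n)).symm p : ({0}ᶜ : Set (E n))))
        (homeomorphUnitSphereProd (E n) x) := fun x => by simp
  have hm : Measurable (fun p : Metric.sphere (0 : E n) 1 × Ioi (0 : ℝ) =>
      f ((homeomorphUnitSphereProd (E n)).symm p : ({0}ᶜ : Set (E n)))) :=
    hf.comp (measurable_subtype_coe.comp (homeomorphUnitSphereProd (E n)).symm.measurable)
  rw [lintegral_congr h1, hp.lintegral_comp hm, lintegral_prod _ hm.aemeasurable]
  refine lintegral_congr fun θ => ?_
  have hd : Module.finrank ℝ (E n) = n := by simp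
  have hmθ : Measurable fun r : Ioi (0 : ℝ) =>
      f ((homeomorphUnitSphereProd (E n)).symm (θ, r) : ({0}ᶜ : Set (E n))) :=
    hm.comp measurable_prodMk_left
  rw [Measure.volumeIoiPow, lintegral_withDensity_eq_lintegral_mul _ (by fun_prop) hmθ,
    ← lintegral_subtype_comap measurableSet_Ioi]
  refine lintegral_congr fun r => ?_
  simp [hd]

theorem lintegral_surfaceMeasure {n : ℕ} {f : E n → ℝ≥0∞} (hf : Measurable f) :
    ∫⁻ x, f x ∂(surfaceMeasure n) = 2 ^ (n - 1) *
      ∫⁻ θ : Metric.sphere (0 : E n) 1, f ((2 : ℝ) • (θ : E n)) ∂(volume.toSphere) := by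
  rw [surfaceMeasure, lintegral_smul_measure, lintegral_map hf (by fun_prop), smul_eq_mul]

theorem eLpNorm_two_sq {α V : Type*} [MeasurableSpace α] [NormedAddCommGroup V] {μ : Measure α}
    (f : α → V) : eLpNorm f 2 μ ^ 2 = ∫⁻ x, ‖f x‖ₑ ^ 2 ∂μ := by
  have := eLpNorm_nnreal_pow_eq_lintegral (μ := μ) (f := f) (p := 2) (by simp)
  simpa using this

theorem sq_lintegral_le {α : Type*} [MeasurableSpace α] {μ : Measure α} {g : α → ℝ≥0∞}
    (hg : AEMeasurable g μ) : (∫⁻ x, g x ∂μ) ^ 2 ≤ μ univ * ∫⁻ x, g x ^ 2 ∂μ := by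
  have h := ENNReal.lintegral_mul_le_Lp_mul_Lq μ (p := 2) (q := 2)
    Real.HolderConjugate.two_two (f := fun _ => 1) aemeasurable_const hg
  simp only [Pi.mul_apply, one_mul, ENNReal.one_rpow, lintegral_const] at h
  calc (∫⁻ x, g x ∂μ) ^ 2 ≤ ((μ univ) ^ (1 / 2 : ℝ) * (∫⁻ x, g x ^ (2 : ℝ) ∂μ) ^ (1 / 2 : ℝ)) ^ 2 := by
        gcongr
    _ = _ := by
        rw [mul_pow, ← ENNReal.rpow_natCast, ← ENNReal.rpow_natCast, ← ENNReal.rpow_mul,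
          ← ENNReal.rpow_mul]
        norm_num

/-- The fundamental theorem of calculus along the segment `[rθ, 2θ]`, with the Cauchy-Schwarz
inequality. -/
theorem enorm_sq_ray_le {n : ℕ} {φ : E n → ℝ} (hφ : ContDiff ℝ ∞ φ) {δ : ℝ}
    {θ : E n} (hθ : ‖θ‖ = 1) {r : ℝ} (hr : r ∈ Ioo (2 - δ) 2) :
    ‖φ (r • θ)‖ₑ ^ 2 ≤ 2 * (‖φ ((2 : ℝ) • θ)‖ₑ ^ 2 +
      ENNReal.ofReal δ * ∫⁻ t in Ioo (2 - δ) 2, ‖∇ φ (t • θ)‖ₑ ^ 2) := by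
  have hc : Continuous fun t : ℝ => inner ℝ (∇ φ (t • θ)) θ :=
    ((continuous_gradient hφ).comp (continuous_id.smul continuous_const)).inner continuous_const
  have hd : ∀ t : ℝ, HasDerivAt (fun t : ℝ => φ (t • θ)) (inner ℝ (∇ φ (t • θ)) θ) t := fun t => by
    have h1 := (hasGradientAt_of_contDiff hφ (t • θ)).hasFDerivAt
    have h2 : HasDerivAt (fun t : ℝ => t • θ) θ t := by
      simpa using (hasDerivAt_id t).smul_const θ
    simpa [Function.comp_def] using h1.comp_hasDerivAt t h2
  have ftc : ∫ t in r..2, inner ℝ (∇ φ (t • θ)) θ = φ ((2 : ℝ) • θ) - φ (r • θ) :=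
    intervalIntegral.integral_eq_sub_of_hasDerivAt (fun t _ => hd t) (hc.intervalIntegrable _ _)
  have hD : ‖φ ((2 : ℝ) • θ) - φ (r • θ)‖ₑ ≤ ∫⁻ t in Ioo (2 - δ) 2, ‖∇ φ (t • θ)‖ₑ := by
    rw [← ftc, intervalIntegral.integral_of_le hr.2.le, ← restrict_Ioo_eq_restrict_Ioc]
    refine (enorm_integral_le_lintegral_enorm _).trans ?_
    refine (lintegral_mono fun t => ?_).trans (lintegral_mono_set (Ioo_subset_Ioo_left hr.1.le))
    rw [enorm_le_iff_norm_le]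
    exact (norm_inner_le_norm _ _).trans (by rw [hθ, mul_one])
  have hsq : ‖φ ((2 : ℝ) • θ) - φ (r • θ)‖ₑ ^ 2 ≤
      ENNReal.ofReal δ * ∫⁻ t in Ioo (2 - δ) 2, ‖∇ φ (t • θ)‖ₑ ^ 2 := by
    calc _ ≤ (∫⁻ t in Ioo (2 - δ) 2, ‖∇ φ (t • θ)‖ₑ) ^ 2 := by gcongr
      _ ≤ _ := sq_lintegral_le ((continuous_gradient hφ).comp
        (continuous_id.smul continuous_const)).enorm.measurable.aemeasurable
      _ = _ := by rw [Measure.restrict_apply_univ, Real.volume_Ioo]; congr 2; ring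
  calc ‖φ (r • θ)‖ₑ ^ 2 = ‖φ ((2 : ℝ) • θ) - (φ ((2 : ℝ) • θ) - φ (r • θ))‖ₑ ^ 2 := by
        congr 2; ring
    _ ≤ (‖φ ((2 : ℝ) • θ)‖ₑ + ‖φ ((2 : ℝ) • θ) - φ (r • θ)‖ₑ) ^ 2 := by
        gcongr; exact enorm_sub_le
    _ ≤ 2 * (‖φ ((2 : ℝ) • θ)‖ₑ ^ 2 + ‖φ ((2 : ℝ) • θ) - φ (r • θ)‖ₑ ^ 2) := by
        have := ENNReal.rpow_add_le_mul_rpow_add_rpow ‖φ ((2 : ℝ) • θ)‖ₑ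
          ‖φ ((2 : ℝ) • θ) - φ (r • θ)‖ₑ (p := 2) (by norm_num)
        norm_num at this
        exact this
    _ ≤ _ := by gcongr

/-- The spherical shell `2 - δ < |x| < 2`, which lies along `∂N`. -/
def shell (n : ℕ) (δ : ℝ) : Set (E n) := {x | 2 - δ < ‖x‖ ∧ ‖x‖ < 2}

theorem measurableSet_shell (n : ℕ) (δ : ℝ) : MeasurableSet (shell n δ) :=
  (measurableSet_lt measurable_const measurable_norm).inter
    (measurableSet_lt measurable_norm measurable_const)

/-- Integrals over a shell in polar coordinates. -/
theorem lintegral_shell {n : ℕ} (hn : 1 ≤ n) {f : E n → ℝ≥0∞} (hf : Measurable f) {δ : ℝ}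
    (hδ : δ ≤ 1) :
    ∫⁻ x in shell n δ, f x = ∫⁻ θ : Metric.sphere (0 : E n) 1, ∫⁻ r in Ioo (2 - δ) 2,
      ENNReal.ofReal (r ^ (n - 1)) * f (r • (θ : E n)) ∂volume ∂(volume.toSphere) := by
  rw [← lintegral_indicator (measurableSet_shell n δ),
    lintegral_polar hn (hf.indicator (measurableSet_shell n δ))]
  refine lintegral_congr fun θ => ?_
  have hθ : ‖(θ : E n)‖ = 1 := norm_eq_of_mem_sphere θ
  have hsub : Ioo (2 - δ) 2 ⊆ Ioi (0 : ℝ) := fun r hr => by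
    have := hr.1; simp only [mem_Ioi]; linarith
  rw [← inter_eq_self_of_subset_left hsub, ← setLIntegral_indicator measurableSet_Ioo]
  refine setLIntegral_congr_fun measurableSet_Ioi fun r hr => ?_
  have hr0 : (0 : ℝ) < r := hr
  have hmem : r • (θ : E n) ∈ shell n δ ↔ r ∈ Ioo (2 - δ) 2 := by
    simp [shell, norm_smul, hθ, abs_of_pos hr0]
  by_cases h : r ∈ Ioo (2 - δ) 2
  · simp only [indicator_of_mem h, indicator_of_mem (hmem.2 h)]
  · simp only [indicator_of_notMem h, indicator_of_notMem (fun h' => h (hmem.1 h')), mul_zero]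

/-- The `L²` norm on a thin shell along `∂N` is controlled by the `L²` norm of the gradient there
and the `L²` norm on `∂N`. -/
theorem eLpNorm_shell_le {n : ℕ} (hn : 1 ≤ n) {φ : E n → ℝ} (hφ : ContDiff ℝ ∞ φ) {δ : ℝ}
    (hδ1 : δ ≤ 1) :
    eLpNorm φ 2 (volume.restrict (shell n δ)) ≤
      2 ^ n * ENNReal.ofReal δ * eLpNorm (∇ φ) 2 (volume.restrict (shell n δ)) +
        2 * eLpNorm φ 2 (surfaceMeasure n) := by
  have hcφ : Measurable fun x => ‖φ x‖ₑ ^ 2 := (hφ.continuous.enorm.measurable).pow_const 2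
  have hcg : Measurable fun x => ‖∇ φ x‖ₑ ^ 2 :=
    ((continuous_gradient hφ).enorm.measurable).pow_const 2
  set d := ENNReal.ofReal δ with hd
  have hd1 : d ≤ 1 := by rw [hd]; exact ENNReal.ofReal_le_one.2 hδ1
  have hpow : (2 : ℝ≥0∞) ^ n = 2 * 2 ^ (n - 1) := by
    rw [← pow_succ', Nat.sub_add_cancel hn]
  set I : Metric.sphere (0 : E n) 1 → ℝ≥0∞ :=
    fun θ => ∫⁻ t in Ioo (2 - δ) 2, ‖∇ φ (t • (θ : E n))‖ₑ ^ 2 with hI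
  have hIm : Measurable I := by
    refine Measurable.lintegral_prod_right' (f := fun p : Metric.sphere (0 : E n) 1 × ℝ =>
      ‖∇ φ (p.2 • (p.1 : E n))‖ₑ ^ 2) ?_
    exact hcg.comp (by fun_prop)
  have hIle : ∫⁻ θ, I θ ∂(volume.toSphere) ≤ ∫⁻ x in shell n δ, ‖∇ φ x‖ₑ ^ 2 := by
    rw [lintegral_shell hn hcg hδ1]
    refine lintegral_mono fun θ => setLIntegral_mono' measurableSet_Ioo fun t ht => ?_
    have ht1 : 1 ≤ t := by have := ht.1; linarith
    calc ‖∇ φ (t • (θ : E n))‖ₑ ^ 2 = 1 * ‖∇ φ (t • (θ : E n))‖ₑ ^ 2 := (one_mul _).symm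
      _ ≤ _ := by
        gcongr
        rw [ENNReal.one_le_ofReal]
        exact one_le_pow₀ ht1
  have hmain : ∫⁻ x in shell n δ, ‖φ x‖ₑ ^ 2 ≤
      2 * d * (∫⁻ x, ‖φ x‖ₑ ^ 2 ∂(surfaceMeasure n)) +
        2 ^ n * d ^ 2 * ∫⁻ x in shell n δ, ‖∇ φ x‖ₑ ^ 2 := by
    calc ∫⁻ x in shell n δ, ‖φ x‖ₑ ^ 2
        ≤ ∫⁻ θ : Metric.sphere (0 : E n) 1, ∫⁻ r in Ioo (2 - δ) 2,
            2 ^ (n - 1) * (2 * (‖φ ((2 : ℝ) • (θ : E n))‖ₑ ^ 2 + d * I θ)) ∂volume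
              ∂(volume.toSphere) := by
          rw [lintegral_shell hn hcφ hδ1]
          refine lintegral_mono fun θ => setLIntegral_mono' measurableSet_Ioo fun r hr => ?_
          refine mul_le_mul' ?_ (enorm_sq_ray_le hφ (norm_eq_of_mem_sphere θ) hr)
          rw [← ENNReal.ofReal_ofNat, ← ENNReal.ofReal_pow (by norm_num)]
          refine ENNReal.ofReal_le_ofReal (pow_le_pow_left₀ ?_ hr.2.le _)
          have := hr.1; linarith
      _ = 2 ^ n * d * ∫⁻ θ : Metric.sphere (0 : E n) 1,
            (‖φ ((2 : ℝ) • (θ : E n))‖ₑ ^ 2 + d * I θ) ∂(volume.toSphere) := by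
          simp only [setLIntegral_const, Real.volume_Ioo]
          rw [← lintegral_const_mul _ (by
            exact (hcφ.comp (by fun_prop : Measurable fun θ : Metric.sphere (0 : E n) 1 =>
              (2 : ℝ) • (θ : E n))).add (hIm.const_mul d))]
          refine lintegral_congr fun θ => ?_
          have : (2 : ℝ) - (2 - δ) = δ := by ring
          rw [this, hpow]
          ring
      _ = 2 ^ n * d * ∫⁻ θ : Metric.sphere (0 : E n) 1,
            ‖φ ((2 : ℝ) • (θ : E n))‖ₑ ^ 2 ∂(volume.toSphere) +
          2 ^ n * d ^ 2 * ∫⁻ θ, I θ ∂(volume.toSphere) := by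
          rw [lintegral_add_right _ (hIm.const_mul d), lintegral_const_mul _ hIm]
          ring
      _ ≤ _ := by
          rw [lintegral_surfaceMeasure hcφ, hpow]
          gcongr ?_ + _ * ?_
          apply le_of_eq
          ring
  rw [← ENNReal.pow_le_pow_left_iff (two_ne_zero), eLpNorm_two_sq]
  refine hmain.trans ?_
  rw [← eLpNorm_two_sq, ← eLpNorm_two_sq]
  set Y := eLpNorm (∇ φ) 2 (volume.restrict (shell n δ))
  set Z := eLpNorm φ 2 (surfaceMeasure n)
  have h1 : (1 : ℝ≥0∞) ≤ 2 ^ n := one_le_pow₀ (by norm_num)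
  calc 2 * d * Z ^ 2 + 2 ^ n * d ^ 2 * Y ^ 2 ≤ 2 * 2 * Z ^ 2 + 2 ^ n * 2 ^ n * d ^ 2 * Y ^ 2 := by
        gcongr
        · exact hd1.trans (by norm_num)
        · exact le_mul_of_one_le_right' h1
    _ ≤ 2 * 2 * Z ^ 2 + 2 ^ n * 2 ^ n * d ^ 2 * Y ^ 2 + 2 * (2 ^ n * d * Y) * (2 * Z) :=
        le_self_add
    _ = (2 ^ n * d * Y + 2 * Z) ^ 2 := by ring

theorem exists_shell_small {n : ℕ} {V : Type*} [NormedAddCommGroup V] {f : E n → V}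
    (hf : MemLp f 2 (volN n)) {ε : ℝ≥0∞} (hε : ε ≠ 0) :
    ∀ᶠ k : ℕ in atTop, eLpNorm f 2 (volume.restrict (shell n (1 / (k + 1)))) ≤ ε := by
  have hlim : Tendsto (fun k : ℕ => eLpNorm ((shell n (1 / ((k : ℝ) + 1))).indicator f - 0) 2
      (volN n)) atTop (𝓝 0) := by
    refine tendsto_eLpNorm_of_dominated (g := fun x => ‖f x‖)
      (fun k => hf.1.indicator (measurableSet_shell _ _)) hf.norm
      (fun k => Eventually.of_forall fun x => norm_indicator_le_norm_self _ _) ?_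
    filter_upwards [ae_restrict_mem (measurableSet_N n)] with x hx
    have hx2 : 0 < 2 - ‖x‖ := by
      have : ‖x‖ < 2 := by simpa [N] using hx
      linarith
    refine tendsto_const_nhds.congr' ?_
    filter_upwards [tendsto_one_div_add_atTop_nhds_zero_nat.eventually (gt_mem_nhds hx2)] with k hk
    rw [indicator_of_notMem]
    · rfl
    · intro h
      have := h.1
      linarith
  filter_upwards [tendsto_zero_iff_approx.1 hlim ε hε] with k hk
  rw [sub_zero, eLpNorm_indicator_eq_eLpNorm_restrict (measurableSet_shell _ _),
    Measure.restrict_restrict (measurableSet_shell _ _)] at hk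
  have : shell n (1 / ((k : ℝ) + 1)) ∩ N n = shell n (1 / (k + 1)) :=
    inter_eq_self_of_subset_left fun x hx => by simpa [N] using hx.2
  rwa [this] at hk

/-- Functions with vanishing trace are limits of test functions: they are cut off in a shell of
width `δ`, where the gradient `O(1/δ)` of the cutoff is compensated by the `O(δ)` in
`eLpNorm_shell_le`. -/
theorem HasTrace.isH10 {n : ℕ} (hn : 1 ≤ n) {u : E n → ℝ} {G : E n → E n}
    (h : HasTrace u G 0) : IsH10 u G := by
  refine ⟨h.1.memLp, h.1.memLp_grad, fun ε hε => ?_⟩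
  obtain ⟨M, hM, hSM⟩ := exists_deriv_smoothTransition_bound
  set K : ℝ≥0∞ := 1 + ENNReal.ofReal (4 * M) * 2 ^ n with hK
  have hKt : K ≠ ⊤ := by
    rw [hK]
    exact ENNReal.add_ne_top.2 ⟨by simp, ENNReal.mul_ne_top ENNReal.ofReal_ne_top (by simp)⟩
  have hK1 : 1 ≤ K := le_self_add
  have hK0 : K ≠ 0 := (zero_lt_one.trans_le hK1).ne'
  have hε2 : ε / 2 ≠ 0 := ENNReal.div_ne_zero.2 ⟨hε, by simp⟩
  have hη1 : ε / 2 / K ≠ 0 := ENNReal.div_ne_zero.2 ⟨hε2, hKt⟩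
  obtain ⟨m, hmu, hmG⟩ := ((exists_shell_small h.1.memLp hη1).and
    (exists_shell_small h.1.memLp_grad hη1)).exists
  set δ : ℝ := 1 / ((m : ℝ) + 1) with hδ
  have hδ0 : 0 < δ := by positivity
  have hδ1 : δ ≤ 1 := by
    rw [hδ, div_le_one (by positivity)]; simp
  set L : ℝ≥0∞ := K + ENNReal.ofReal (4 * M / δ) * 2 with hL
  have hLt : L ≠ ⊤ := ENNReal.add_ne_top.2
    ⟨hKt, ENNReal.mul_ne_top ENNReal.ofReal_ne_top (by simp)⟩
  have hL0 : L ≠ 0 := (zero_lt_one.trans_le (hK1.trans le_self_add)).ne'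
  obtain ⟨φ, hφ, h1, h2, h3⟩ := h.exists_approx
    (ENNReal.div_ne_zero.2 ⟨hε2, hLt⟩ : ε / 2 / L ≠ 0)
  have h3' : eLpNorm φ 2 (surfaceMeasure n) ≤ ε / 2 / L := by
    rwa [eLpNorm_congr_ae (g := φ)] at h3
    filter_upwards [Lp.coeFn_zero ℝ 2 (surfaceMeasure n)] with x hx
    rw [Pi.sub_apply, hx, Pi.zero_apply, sub_zero]
  set χ : E n → ℝ := cutoff (-1 / δ) (4 / δ - 1) with hχ
  have hχs : ContDiff ℝ ∞ χ := contDiff_cutoff _ _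
  have harg : ∀ x : E n, -1 / δ * ‖x‖ ^ 2 + (4 / δ - 1) = (4 - ‖x‖ ^ 2) / δ - 1 := fun x => by
    field_simp; ring
  -- off the shell, `4 - |x|² > 2δ`
  have hoff : ∀ x : E n, x ∈ N n → x ∉ shell n δ → 1 < (4 - ‖x‖ ^ 2) / δ - 1 := by
    intro x hx hxs
    have hx2 : ‖x‖ < 2 := by simpa [N] using hx
    have hle : ‖x‖ ≤ 2 - δ := by
      by_contra hlt
      exact hxs ⟨not_le.1 hlt, hx2⟩
    have : 2 < (4 - ‖x‖ ^ 2) / δ := by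
      rw [lt_div_iff₀ hδ0]
      nlinarith [norm_nonneg x]
    linarith
  have hNs : (volN n).restrict (shell n δ) = volume.restrict (shell n δ) := by
    rw [Measure.restrict_restrict (measurableSet_shell _ _),
      inter_eq_self_of_subset_left fun x hx => by simpa [N] using hx.2]
  have hshell : ∀ {V : Type} [NormedAddCommGroup V] (F : E n → V),
      eLpNorm ((shell n δ).indicator F) 2 (volN n) =
        eLpNorm F 2 (volume.restrict (shell n δ)) := fun F => by
    rw [eLpNorm_indicator_eq_eLpNorm_restrict (measurableSet_shell _ _), hNs]
  have hrest : ∀ {V : Type} [NormedAddCommGroup V] (F : E n → V),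
      eLpNorm F 2 (volume.restrict (shell n δ)) ≤ eLpNorm F 2 (volN n) := fun F => by
    rw [← hNs]; exact eLpNorm_mono_measure _ Measure.restrict_le_self
  have mφ : AEStronglyMeasurable φ (volN n) := hφ.continuous.aestronglyMeasurable
  have mg : AEStronglyMeasurable (∇ φ) (volN n) := (continuous_gradient hφ).aestronglyMeasurable
  have mχ : AEStronglyMeasurable χ (volN n) := hχs.continuous.aestronglyMeasurable
  have mgχ : AEStronglyMeasurable (∇ χ) (volN n) := (continuous_gradient hχs).aestronglyMeasurable
  have hχ1 : ∀ x, |χ x| ≤ 1 := fun x => by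
    rw [abs_of_nonneg (cutoff_nonneg _ _ _)]; exact cutoff_le_one _ _ _
  have hχ2 : ∀ x, |χ x - 1| ≤ 1 := fun x => by
    rw [abs_sub_comm, abs_of_nonneg (sub_nonneg.2 (cutoff_le_one _ _ _))]
    simpa using cutoff_nonneg _ _ x
  have hχN : ∀ x, x ∈ N n → x ∉ shell n δ → χ x = 1 := fun x hx hxs =>
    cutoff_eq_one (by rw [harg]; exact (hoff x hx hxs).le)
  -- the part of the error that is due to the cutoff
  have herr : ∀ {V : Type} [NormedAddCommGroup V] [NormedSpace ℝ V] (F : E n → V),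
      eLpNorm (fun x => (χ x - 1) • F x) 2 (volN n) ≤
        eLpNorm F 2 (volume.restrict (shell n δ)) := fun F => by
    rw [← hshell]
    refine eLpNorm_mono_ae ?_
    filter_upwards [ae_restrict_mem (measurableSet_N n)] with x hx
    by_cases hxs : x ∈ shell n δ
    · rw [indicator_of_mem hxs, norm_smul]
      exact mul_le_of_le_one_left (norm_nonneg _) (hχ2 x)
    · rw [indicator_of_notMem hxs, hχN x hx hxs]
      simp
  have hmul : ∀ {V : Type} [NormedAddCommGroup V] [NormedSpace ℝ V] (F : E n → V),
      eLpNorm (fun x => χ x • F x) 2 (volN n) ≤ eLpNorm F 2 (volN n) := fun F => by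
    refine eLpNorm_mono fun x => ?_
    rw [norm_smul]
    exact mul_le_of_le_one_left (norm_nonneg _) (hχ1 x)
  have hgradχ : eLpNorm (fun x => φ x • ∇ χ x) 2 (volN n) ≤
      ENNReal.ofReal (4 * M / δ) * eLpNorm φ 2 (volume.restrict (shell n δ)) := by
    rw [← hshell]
    refine eLpNorm_le_mul_eLpNorm_of_ae_le_mul ?_ 2
    filter_upwards [ae_restrict_mem (measurableSet_N n)] with x hx
    have hx2 : ‖x‖ < 2 := by simpa [N] using hx
    rw [hχ, gradient_cutoff, harg]
    by_cases hxs : x ∈ shell n δ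
    · rw [indicator_of_mem hxs, norm_smul, norm_smul, mul_comm]
      gcongr
      rw [Real.norm_eq_abs, abs_mul]
      have : |2 * (-1 / δ)| = 2 / δ := by
        rw [show 2 * (-1 / δ) = -(2 / δ) by ring, abs_neg, abs_of_pos (by positivity)]
      rw [this]
      calc |deriv Real.smoothTransition ((4 - ‖x‖ ^ 2) / δ - 1)| * (2 / δ) * ‖x‖
          ≤ M * (2 / δ) * 2 := by gcongr; exact hSM _
        _ = 4 * M / δ := by ring
    · rw [indicator_of_notMem hxs, deriv_smoothTransition_of_gt (hoff x hx hxs)]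
      simp
  have hsum : ε / 2 + ε / 2 = ε := ENNReal.add_halves ε
  have hη12 : ε / 2 / L ≤ ε / 2 / K := ENNReal.div_le_div_left le_self_add _
  have hη1' : ε / 2 / K ≤ ε / 2 := ENNReal.div_le_of_le_mul (le_mul_of_one_le_right' hK1)
  refine ⟨fun x => χ x * φ x, ?_, ?_, ?_⟩
  · refine isTest_of_eq_zero (hχs.mul hφ) (R := 2 - δ / 4) (by linarith) fun x hx => ?_
    rw [hχ, cutoff_eq_zero, zero_mul]
    rw [harg, sub_nonpos, div_le_one hδ0]
    nlinarith [norm_nonneg x]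
  · have e : (fun x => χ x * φ x) - u =
        (fun x => χ x • (φ - u) x) + fun x => (χ x - 1) • u x := by
      ext x; simp only [Pi.sub_apply, Pi.add_apply, smul_eq_mul]; ring
    rw [e]
    refine (eLpNorm_add_le (mχ.smul (mφ.sub h.1.memLp.1))
      ((mχ.sub aestronglyMeasurable_const).smul h.1.memLp.1) (by norm_num)).trans ?_
    rw [← hsum]
    exact add_le_add ((hmul _).trans (h1.trans (hη12.trans hη1')))
      ((herr u).trans (hmu.trans hη1'))
  · have e : ∇ (fun x => χ x * φ x) - G = (fun x => χ x • (∇ φ - G) x) +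
        ((fun x => (χ x - 1) • G x) + fun x => φ x • ∇ χ x) := by
      ext1 x
      simp only [Pi.sub_apply, Pi.add_apply]
      rw [gradient_mul hχs hφ, smul_sub, sub_smul, one_smul]
      abel
    rw [e]
    refine (eLpNorm_add_le (mχ.smul (mg.sub h.1.memLp_grad.1))
      (((mχ.sub aestronglyMeasurable_const).smul h.1.memLp_grad.1).add (mφ.smul mgχ))
      (by norm_num)).trans ?_
    refine (add_le_add_right (eLpNorm_add_le
      ((mχ.sub aestronglyMeasurable_const).smul h.1.memLp_grad.1) (mφ.smul mgχ)
      (by norm_num)) _).trans ?_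
    have hg : eLpNorm (∇ φ) 2 (volume.restrict (shell n δ)) ≤ ε / 2 / L + ε / 2 / K := by
      have e2 : ∇ φ = (∇ φ - G) + G := by simp
      rw [e2]
      refine (eLpNorm_add_le ?_ ?_ (by norm_num)).trans
        (add_le_add ((hrest _).trans h2) hmG)
      · rw [← hNs]; exact (mg.sub h.1.memLp_grad.1).restrict
      · rw [← hNs]; exact h.1.memLp_grad.1.restrict
    have hd : ENNReal.ofReal (4 * M / δ) * ENNReal.ofReal δ = ENNReal.ofReal (4 * M) := by
      rw [← ENNReal.ofReal_mul (by positivity)]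
      congr 1
      field_simp
    have hg2 : eLpNorm (fun x => φ x • ∇ χ x) 2 (volN n) ≤
        ENNReal.ofReal (4 * M) * 2 ^ n * (ε / 2 / L + ε / 2 / K) +
          ENNReal.ofReal (4 * M / δ) * 2 * (ε / 2 / L) := by
      calc _ ≤ _ := hgradχ
        _ ≤ ENNReal.ofReal (4 * M / δ) * (2 ^ n * ENNReal.ofReal δ * (ε / 2 / L + ε / 2 / K) +
            2 * (ε / 2 / L)) := by
          gcongr
          exact (eLpNorm_shell_le hn hφ hδ1).trans (by gcongr)
        _ = 2 ^ n * (ENNReal.ofReal (4 * M / δ) * ENNReal.ofReal δ) * (ε / 2 / L + ε / 2 / K) +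
            ENNReal.ofReal (4 * M / δ) * 2 * (ε / 2 / L) := by ring
        _ = _ := by rw [hd]; ring
    calc _ ≤ ε / 2 / L + (ε / 2 / K + (ENNReal.ofReal (4 * M) * 2 ^ n * (ε / 2 / L + ε / 2 / K) +
          ENNReal.ofReal (4 * M / δ) * 2 * (ε / 2 / L))) :=
          add_le_add ((hmul _).trans h2) (add_le_add ((herr G).trans hmG) hg2)
      _ = K * (ε / 2 / K) + L * (ε / 2 / L) := by rw [hL, hK]; ring
      _ = ε := by rw [ENNReal.mul_div_cancel hK0 hKt, ENNReal.mul_div_cancel hL0 hLt, hsum]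

/-! ### The Dirichlet problem -/

theorem IsTest.add {n : ℕ} {φ ψ : E n → ℝ} (hφ : IsTest φ) (hψ : IsTest ψ) : IsTest (φ + ψ) := by
  obtain ⟨R, -, hR, h⟩ := hφ.exists_radius
  obtain ⟨R', -, hR', h'⟩ := hψ.exists_radius
  refine isTest_of_eq_zero (hφ.smooth.add hψ.smooth) (max_lt hR hR') fun x hx => ?_
  rw [Pi.add_apply, h x ((le_max_left _ _).trans_lt hx), h' x ((le_max_right _ _).trans_lt hx),
    add_zero]

theorem IsTest.const_smul {n : ℕ} {φ : E n → ℝ} (c : ℝ) (hφ : IsTest φ) : IsTest (c • φ) := by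
  obtain ⟨R, -, hR, h⟩ := hφ.exists_radius
  have hs : ContDiff ℝ ∞ (c • φ) := hφ.smooth.const_smul c
  refine isTest_of_eq_zero hs hR fun x hx => ?_
  rw [Pi.smul_apply, h x hx, smul_zero]

theorem isTest_zero {n : ℕ} : IsTest (0 : E n → ℝ) :=
  isTest_of_eq_zero contDiff_const (R := 1) (by norm_num) fun _ _ => rfl

theorem IsTest.sub {n : ℕ} {φ ψ : E n → ℝ} (hφ : IsTest φ) (hψ : IsTest ψ) : IsTest (φ - ψ) := by
  have h := hφ.add (hψ.const_smul (-1))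
  have e : φ + (-1 : ℝ) • ψ = φ - ψ := by ext x; simp [sub_eq_add_neg]
  rwa [e] at h

/-- The Poincaré inequality for test functions. -/
theorem exists_poincare {n : ℕ} (hn : 3 ≤ n) : ∃ C : ℝ≥0∞, C ≠ ⊤ ∧ ∀ φ : E n → ℝ, IsTest φ →
    eLpNorm φ 2 (volN n) ≤ C * eLpNorm (∇ φ) 2 (volN n) := by
  refine ⟨(eLpNormLESNormFDerivOfLeConst ℝ (volume : Measure (E n)) (N n) 2 2 : NNReal),
    ENNReal.coe_ne_top, fun φ hφ => ?_⟩
  have hsub : Function.support φ ⊆ N n := (subset_tsupport φ).trans hφ.supp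
  have h := eLpNorm_le_eLpNorm_fderiv (volume : Measure (E n)) (u := φ) (s := N n)
    (hφ.smooth.of_le (by simp)) hsub (p := 2) (by norm_num)
    (by simp only [finrank_euclideanSpace, Fintype.card_fin]; exact_mod_cast hn)
    Metric.isBounded_ball
  have e1 : eLpNorm φ 2 (volN n) = eLpNorm φ 2 volume :=
    eLpNorm_restrict_eq_of_support_subset hsub
  have e2 : eLpNorm (∇ φ) 2 (volN n) = eLpNorm (fderiv ℝ φ) 2 volume := by
    rw [eLpNorm_restrict_eq_of_support_subset]
    · refine eLpNorm_congr_norm_ae (Eventually.of_forall fun x => ?_)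
      simp [gradient]
    · refine subset_trans (subset_tsupport _) (subset_trans ?_
        ((tsupport_fderiv_subset ℝ).trans hφ.supp))
      exact tsupport_comp_subset (map_zero (InnerProductSpace.toDual ℝ (E n)).symm) _
  rw [e1, e2]
  exact_mod_cast h

theorem IsH10.ae_eq_zero {n : ℕ} (hn : 3 ≤ n) {u : E n → ℝ} {G : E n → E n} (h : IsH10 u G)
    (hG : G =ᵐ[volN n] 0) : u =ᵐ[volN n] 0 := by
  obtain ⟨C, hC, hP⟩ := exists_poincare hn
  rw [← eLpNorm_eq_zero_iff (p := 2) h.memLp.1 (by norm_num)]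
  have : eLpNorm u 2 (volN n) = ‖(eLpNorm u 2 (volN n)).toReal‖ₑ := by
    rw [Real.enorm_eq_ofReal ENNReal.toReal_nonneg, ENNReal.ofReal_toReal h.memLp.2.ne]
  rw [this, enorm_eq_zero]
  refine eq_zero_of_enorm_le_mul (K := 1 + C) (ENNReal.add_ne_top.2 ⟨by simp, hC⟩) fun ε hε => ?_
  rw [← this]
  obtain ⟨φ, hφ, h1, h2⟩ := h.approx ε hε
  have h2' : eLpNorm (∇ φ) 2 (volN n) ≤ ε := by
    rwa [eLpNorm_congr_ae (g := ∇ φ)] at h2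
    filter_upwards [hG] with x hx
    simp [hx]
  have e : u = φ - (φ - u) := by simp
  have mφ := hφ.smooth.continuous.aestronglyMeasurable (μ := volN n)
  calc eLpNorm u 2 (volN n) = eLpNorm (φ - (φ - u)) 2 (volN n) := by rw [← e]
    _ ≤ eLpNorm φ 2 (volN n) + eLpNorm (φ - u) 2 (volN n) :=
      eLpNorm_sub_le mφ (mφ.sub h.memLp.1) (by norm_num)
    _ ≤ C * ε + ε := add_le_add ((hP φ hφ).trans (by gcongr)) h1
    _ = ε * (1 + C) := by ring

/-- The gradients of test functions, as a subspace of `L²(N; ℝⁿ)`. -/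
def testGradients (n : ℕ) : Submodule ℝ (Lp (E n) 2 (volN n)) where
  carrier := {F | ∃ φ : E n → ℝ, IsTest φ ∧ F =ᵐ[volN n] ∇ φ}
  add_mem' := by
    rintro F H ⟨φ, hφ, hF⟩ ⟨ψ, hψ, hH⟩
    refine ⟨φ + ψ, hφ.add hψ, ?_⟩
    rw [gradient_add hφ.smooth hψ.smooth]
    exact (Lp.coeFn_add F H).trans (hF.add hH)
  zero_mem' := by
    refine ⟨0, isTest_zero, (Lp.coeFn_zero _ _ _).trans (Eventually.of_forall fun x => ?_)⟩
    simp [gradient]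
  smul_mem' := by
    rintro c F ⟨φ, hφ, hF⟩
    refine ⟨c • φ, hφ.const_smul c, ?_⟩
    rw [gradient_const_smul c hφ.smooth]
    exact (Lp.coeFn_smul c F).trans (hF.const_smul c)

/-- By the Poincaré inequality, the closure of the gradients of test functions consists of the
gradients of functions in `H¹₀(N)`. -/
theorem exists_isH10_of_mem_closure {n : ℕ} (hn : 3 ≤ n) {Z : Lp (E n) 2 (volN n)}
    (hZ : Z ∈ (testGradients n).topologicalClosure) : ∃ ζ : E n → ℝ, IsH10 ζ Z := by
  obtain ⟨C, hC, hP⟩ := exists_poincare hn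
  obtain ⟨F, hF, hlim⟩ := mem_closure_iff_seq_limit.1 hZ
  choose φ hφ hφF using hF
  have mφ : ∀ k, MemLp (φ k) 2 (volN n) := fun k => memLp_volN_of_continuous (hφ k).smooth.continuous
  have hcauchy : CauchySeq fun k => (mφ k).toLp (φ k) := by
    rw [EMetric.cauchySeq_iff]
    intro ε hε
    have hε' : 0 < ε / (C + 1) := ENNReal.div_pos hε.ne' (ENNReal.add_ne_top.2 ⟨hC, by simp⟩)
    obtain ⟨k0, hk0⟩ := EMetric.cauchySeq_iff.1 hlim.cauchySeq _ hε'
    refine ⟨k0, fun k hk j hj => ?_⟩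
    rw [Lp.edist_toLp_toLp]
    have h1 := hk0 k hk j hj
    rw [Lp.edist_def, eLpNorm_congr_ae ((hφF k).sub (hφF j)),
      ← gradient_sub (hφ k).smooth (hφ j).smooth] at h1
    calc _ ≤ C * eLpNorm (∇ (φ k - φ j)) 2 (volN n) := hP _ ((hφ k).sub (hφ j))
      _ ≤ (C + 1) * eLpNorm (∇ (φ k - φ j)) 2 (volN n) := by gcongr; simp
      _ < (C + 1) * (ε / (C + 1)) :=
        ENNReal.mul_lt_mul_right (by simp) (ENNReal.add_ne_top.2 ⟨hC, by simp⟩) h1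
      _ = ε := ENNReal.mul_div_cancel (by simp) (ENNReal.add_ne_top.2 ⟨hC, by simp⟩)
  obtain ⟨ζ, hζ⟩ := cauchySeq_tendsto_of_complete hcauchy
  refine ⟨ζ, Lp.memLp ζ, Lp.memLp Z, fun ε hε => ?_⟩
  rw [Lp.tendsto_Lp_iff_tendsto_eLpNorm'] at hζ hlim
  obtain ⟨k, k1, k2⟩ := ((tendsto_zero_iff_approx.1 hζ ε hε).and
    (tendsto_zero_iff_approx.1 hlim ε hε)).exists
  refine ⟨φ k, hφ k, ?_, ?_⟩
  · rwa [eLpNorm_congr_ae ((mφ k).coeFn_toLp.sub (EventuallyEq.refl _ _))] at k1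
  · rwa [eLpNorm_congr_ae ((hφF k).sub (EventuallyEq.refl _ _))] at k2

/-- The field `G` is divergence free in `N` in the sense of distributions. -/
def IsDivFree {n : ℕ} (G : E n → E n) : Prop :=
  ∀ φ : E n → ℝ, IsTest φ → ∫ x in N n, inner ℝ (G x) (∇ φ x) = 0

/-- Existence for the Dirichlet problem for the Laplace equation: the component of the gradient of
an extension of `f` that is orthogonal to the gradients of test functions. -/
theorem exists_dirichlet {n : ℕ} (hn : 3 ≤ n) (f : HHalf n) :
    ∃ v G, HasTrace v G (f : BoundaryL2 n) ∧ IsDivFree G := by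
  obtain ⟨w, W, hw⟩ := f.2
  set K := (testGradients n).topologicalClosure with hK
  have : CompleteSpace K := (testGradients n).isClosed_topologicalClosure.completeSpace_coe
  set W' : Lp (E n) 2 (volN n) := hw.1.memLp_grad.toLp W with hW'
  set Z : Lp (E n) 2 (volN n) := K.starProjection W' with hZ
  obtain ⟨ζ, hζ⟩ := exists_isH10_of_mem_closure hn (K.starProjection_apply_mem W')
  refine ⟨w - ζ, W - Z, by simpa using hw.sub hζ.hasTrace, fun φ hφ => ?_⟩
  have mg : MemLp (∇ φ) 2 (volN n) := memLp_volN_of_continuous (continuous_gradient hφ.smooth)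
  have hmem : mg.toLp (∇ φ) ∈ K :=
    (testGradients n).le_topologicalClosure ⟨φ, hφ, mg.coeFn_toLp⟩
  have h0 : inner ℝ (W' - Z) (mg.toLp (∇ φ)) = 0 :=
    K.starProjection_inner_eq_zero W' _ hmem
  rw [L2.inner_def] at h0
  rw [← h0]
  refine integral_congr_ae ?_
  filter_upwards [Lp.coeFn_sub W' Z, hw.1.memLp_grad.coeFn_toLp, mg.coeFn_toLp] with x h1 h2 h3
  rw [h1, h3, Pi.sub_apply, Pi.sub_apply, h2]

/-- The properties of a conductivity on which uniqueness rests: it is positive definite almost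
everywhere, and currents of square integrable fields are square integrable. -/
structure IsAdmissible {n : ℕ} (σ : E n → Matrix (Fin n) (Fin n) ℝ) : Prop where
  memLp_flux : ∀ G : E n → E n, MemLp G 2 (volN n) → MemLp (flux σ G) 2 (volN n)
  pos : ∀ᵐ x ∂(volN n), ∀ ξ : E n, ξ ≠ 0 → 0 < inner ℝ (Matrix.toEuclideanLin (σ x) ξ) ξ

theorem flux_sub {n : ℕ} (σ : E n → Matrix (Fin n) (Fin n) ℝ) (G H : E n → E n) :
    flux σ (G - H) = flux σ G - flux σ H := by
  ext1 x
  simp [flux]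

/-- Solutions are determined by their trace: the difference of two solutions is in `H¹₀(N)` and can
be used as a test function. -/
theorem IsSolution.ae_eq {n : ℕ} (hn : 3 ≤ n) {σ : E n → Matrix (Fin n) (Fin n) ℝ}
    (hσ : IsAdmissible σ) {u v : E n → ℝ} {G H : E n → E n} {f : BoundaryL2 n}
    (hu : IsSolution σ u G) (hv : IsSolution σ v H) (huf : HasTrace u G f)
    (hvf : HasTrace v H f) : u =ᵐ[volN n] v ∧ G =ᵐ[volN n] H := by
  have h0 : HasTrace (u - v) (G - H) 0 := by simpa using huf.sub hvf
  have h10 := h0.isH10 (by omega)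
  have mG := hσ.memLp_flux G hu.isH1.memLp_grad
  have mH := hσ.memLp_flux H hv.isH1.memLp_grad
  have hm : MemLp (flux σ (G - H)) 2 (volN n) := hσ.memLp_flux _ h10.memLp_grad
  have hz := h10.integral_inner_eq_zero hm (fun φ hφ => by
    have mφ : MemLp (∇ φ) 2 (volN n) := memLp_volN_of_continuous (continuous_gradient hφ.smooth)
    rw [flux_sub]
    simp only [Pi.sub_apply, inner_sub_left]
    rw [integral_sub (integrable_inner mG mφ) (integrable_inner mH mφ),
      hu.weak φ hφ.smooth hφ.compact hφ.supp, hv.weak φ hφ.smooth hφ.compact hφ.supp, sub_zero])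
  rw [integral_eq_zero_iff_of_nonneg_ae _ (integrable_inner hm h10.memLp_grad)] at hz
  · have hGH : G - H =ᵐ[volN n] 0 := by
      filter_upwards [hz, hσ.pos] with x hx hp
      by_contra hne
      exact (hp _ hne).ne' hx
    have huv := h10.ae_eq_zero hn hGH
    constructor
    · filter_upwards [huv] with x hx
      exact sub_eq_zero.1 hx
    · filter_upwards [hGH] with x hx
      exact sub_eq_zero.1 hx
  · filter_upwards [hσ.pos] with x hp
    by_cases hne : (G - H) x = 0
    · simp [flux, hne]
    · exact (hp _ hne).le

theorem conductivity_euclideanMetric (n : ℕ) :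
    conductivity (euclideanMetric n) = fun _ => (1 : Matrix (Fin n) (Fin n) ℝ) := by
  ext1 x
  simp [conductivity, euclideanMetric]

theorem flux_euclideanMetric {n : ℕ} (G : E n → E n) :
    flux (conductivity (euclideanMetric n)) G = G := by
  ext1 x
  rw [conductivity_euclideanMetric, flux]
  simp [Matrix.toEuclideanLin]

theorem isAdmissible_euclideanMetric (n : ℕ) :
    IsAdmissible (conductivity (euclideanMetric n)) where
  memLp_flux G hG := by rwa [flux_euclideanMetric]
  pos := Eventually.of_forall fun x ξ hξ => by
    rw [conductivity_euclideanMetric]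
    have : Matrix.toEuclideanLin (1 : Matrix (Fin n) (Fin n) ℝ) ξ = ξ := by
      simp [Matrix.toEuclideanLin]
    rw [this]
    exact real_inner_self_pos.2 hξ

theorem isSolution_euclideanMetric_iff {n : ℕ} {u : E n → ℝ} {G : E n → E n} :
    IsSolution (conductivity (euclideanMetric n)) u G ↔ IsH1 u G ∧ IsDivFree G := by
  constructor
  · intro h
    refine ⟨h.isH1, fun φ hφ => ?_⟩
    have := h.weak φ hφ.smooth hφ.compact hφ.supp
    rwa [flux_euclideanMetric] at this
  · rintro ⟨h1, h2⟩
    refine ⟨h1, ?_, fun φ a b c => ?_⟩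
    · rw [flux_euclideanMetric]
      exact (IntegrableOn.locallyIntegrableOn
        (memLp_one_iff_integrable.1 (h1.memLp_grad.mono_exponent (by norm_num))))
    · rw [flux_euclideanMetric]
      exact h2 φ ⟨a, b, c⟩

/-- The Dirichlet pairing of a divergence free field with the gradient of a function depends on the
trace of the function only. -/
theorem IsDivFree.integral_inner_eq {n : ℕ} (hn : 1 ≤ n) {G : E n → E n}
    (hG : MemLp G 2 (volN n)) (hd : IsDivFree G) {w w' : E n → ℝ} {W W' : E n → E n}
    {k : BoundaryL2 n} (hw : HasTrace w W k) (hw' : HasTrace w' W' k) :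
    ∫ x in N n, inner ℝ (G x) (W x) = ∫ x in N n, inner ℝ (G x) (W' x) := by
  have h0 : HasTrace (w - w') (W - W') 0 := by simpa using hw.sub hw'
  have h := (h0.isH10 hn).integral_inner_eq_zero hG hd
  simp only [Pi.sub_apply, inner_sub_right] at h
  rw [integral_sub (integrable_inner hG hw.1.memLp_grad)
    (integrable_inner hG hw'.1.memLp_grad)] at h
  exact sub_eq_zero.1 h

/-- The Dirichlet-to-Neumann map of the Laplace equation. -/
theorem exists_dnMap {n : ℕ} (hn : 3 ≤ n) :
    ∃ Λ : HHalf n →ₗ[ℝ] Module.Dual ℝ (HHalf n), ∀ (f : HHalf n) (v : E n → ℝ) (G : E n → E n),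
      HasTrace v G (f : BoundaryL2 n) → IsDivFree G →
      ∀ (w : E n → ℝ) (W : E n → E n) (k : HHalf n), HasTrace w W (k : BoundaryL2 n) →
        Λ f k = ∫ x in N n, inner ℝ (G x) (W x) := by
  choose v G hv hG using exists_dirichlet hn
  have m : ∀ f, MemLp (G f) 2 (volN n) := fun f => (hv f).1.memLp_grad
  have hadd : ∀ f f' k, ∫ x in N n, inner ℝ (G (f + f') x) (G k x) =
      (∫ x in N n, inner ℝ (G f x) (G k x)) + ∫ x in N n, inner ℝ (G f' x) (G k x) := by
    intro f f' k
    rw [← integral_add (integrable_inner (m f) (m k)) (integrable_inner (m f') (m k))]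
    simp only [← inner_add_left]
    have h := (hG k).integral_inner_eq (by omega) (m k) (hv (f + f')) ((hv f).add (hv f'))
    simpa only [real_inner_comm, Pi.add_apply] using h
  have hsmul : ∀ (c : ℝ) f k, ∫ x in N n, inner ℝ (G (c • f) x) (G k x) =
      c * ∫ x in N n, inner ℝ (G f x) (G k x) := by
    intro c f k
    rw [← integral_const_mul]
    simp only [← real_inner_smul_left]
    have h := (hG k).integral_inner_eq (by omega) (m k) (hv (c • f)) ((hv f).const_smul c)
    simpa only [real_inner_comm, Pi.smul_apply] using h
  have hsymm : ∀ f k, ∫ x in N n, inner ℝ (G f x) (G k x) =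
      ∫ x in N n, inner ℝ (G k x) (G f x) := fun f k => by simp only [real_inner_comm]
  refine ⟨LinearMap.mk₂ ℝ (fun f k => ∫ x in N n, inner ℝ (G f x) (G k x)) hadd hsmul
    (fun f k k' => ?_) (fun c f k => ?_), fun f u H hu hH w W k hw => ?_⟩
  · rw [hsymm, hadd, hsymm k, hsymm k']
  · rw [hsymm, hsmul, hsymm k, smul_eq_mul]
  · rw [LinearMap.mk₂_apply, (hG f).integral_inner_eq (by omega) (m f) (hv k) hw]
    have hGH := ((isSolution_euclideanMetric_iff.2 ⟨(hv f).1, hG f⟩).ae_eq hn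
      (isAdmissible_euclideanMetric n) (isSolution_euclideanMetric_iff.2 ⟨hu.1, hH⟩) (hv f) hu).2
    refine integral_congr_ae ?_
    filter_upwards [hGH] with x hx
    rw [hx]

/-! ### Bounded boundary values -/

/-- Smooth truncation at height `M`: a bounded smooth function `β` with `0 ≤ β' ≤ 1` and `β(s) = s`
for `|s| ≤ M`. -/
theorem exists_smooth_truncation {M : ℝ} (hM : 0 ≤ M) : ∃ β b : ℝ → ℝ, ContDiff ℝ ∞ β ∧
    Continuous b ∧ (∀ s, HasDerivAt β (b s) s) ∧ (∀ s, 0 ≤ b s) ∧ (∀ s, b s ≤ 1) ∧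
    (∀ s, |s| ≤ M → β s = s) ∧ ∃ C, ∀ s, |β s| ≤ C := by
  set b : ℝ → ℝ := fun t => Real.smoothTransition (((M + 1) ^ 2 - t ^ 2) / (2 * M + 1)) with hb
  have hpos : 0 < 2 * M + 1 := by positivity
  have hbs : ContDiff ℝ ∞ b := by
    refine (Real.smoothTransition.contDiff (n := ⊤)).comp ?_
    exact (contDiff_const.sub (contDiff_id.pow 2)).div_const _
  obtain ⟨h1, h2⟩ := exists_smooth_primitive hbs 0
  have hb0 : ∀ s, 0 ≤ b s := fun s => Real.smoothTransition.nonneg _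
  have hb1 : ∀ s, |s| ≤ M → b s = 1 := fun s hs => by
    refine Real.smoothTransition.one_of_one_le ?_
    rw [le_div_iff₀ hpos]
    nlinarith [sq_le_sq' (neg_le_of_abs_le hs) (le_of_abs_le hs)]
  have hbc : HasCompactSupport b := by
    refine HasCompactSupport.intro (isCompact_Icc (a := -(M + 1)) (b := M + 1)) fun t ht => ?_
    refine Real.smoothTransition.zero_of_nonpos (div_nonpos_of_nonpos_of_nonneg ?_ hpos.le)
    rw [sub_nonpos]
    by_contra hlt
    exact ht (abs_le.1 (abs_le_of_sq_le_sq (not_le.1 hlt).le (by positivity)))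
  have hbi : Integrable b := hbs.continuous.integrable_of_hasCompactSupport hbc
  refine ⟨_, b, h1, hbs.continuous, h2, hb0, fun s => Real.smoothTransition.le_one _,
    fun s hs => ?_, ∫ t, ‖b t‖, fun s => ?_⟩
  · have : ∫ t in (0 : ℝ)..s, b t = ∫ _ in (0 : ℝ)..s, (1 : ℝ) := by
      refine intervalIntegral.integral_congr fun t ht => hb1 t ?_
      have := abs_sub_left_of_mem_uIcc ht
      simp only [sub_zero] at this
      exact this.trans hs
    rw [this]
    simp
  · rw [← Real.norm_eq_abs]
    exact intervalIntegral.norm_integral_le_integral_norm_uIoc.trans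
      (setIntegral_le_integral hbi.norm (Eventually.of_forall fun t => norm_nonneg _))

/-- The chain rule for the truncation of a function with trace bounded by `M`: the trace does not
change. -/
theorem HasTrace.truncation {n : ℕ} {v : E n → ℝ} {G : E n → E n} {f : BoundaryL2 n}
    (hv : HasTrace v G f) {M : ℝ} (hf : ∀ᵐ x ∂(surfaceMeasure n), |f x| ≤ M) {β b : ℝ → ℝ}
    (hβ : ContDiff ℝ ∞ β) (hb : Continuous b) (hd : ∀ s, HasDerivAt β (b s) s)
    (hb0 : ∀ s, 0 ≤ b s) (hb1 : ∀ s, b s ≤ 1) (hid : ∀ s, |s| ≤ M → β s = s)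
    {C : ℝ} (hC : ∀ s, |β s| ≤ C) :
    HasTrace (fun x => β (v x)) (fun x => b (v x) • G x) f := by
  have hlip : ∀ s t, |β s - β t| ≤ |s - t| := by
    intro s t
    have h := Convex.norm_image_sub_le_of_norm_hasDerivWithin_le (f := β) (f' := b) (s := univ)
      (C := 1) (fun x _ => (hd x).hasDerivWithinAt)
      (fun x _ => by rw [Real.norm_of_nonneg (hb0 x)]; exact hb1 x) convex_univ
      (mem_univ t) (mem_univ s)
    simpa using h
  have hbn : ∀ s, ‖b s‖ ≤ 1 := fun s => by rw [Real.norm_of_nonneg (hb0 s)]; exact hb1 s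
  have mv := hv.1.memLp
  have mG := hv.1.memLp_grad
  have m1 : MemLp (fun x => β (v x)) 2 (volN n) :=
    MemLp.of_bound (hβ.continuous.comp_aestronglyMeasurable mv.1) C
      (Eventually.of_forall fun x => hC _)
  have mb : AEStronglyMeasurable (fun x => b (v x)) (volN n) := hb.comp_aestronglyMeasurable mv.1
  have m2 : MemLp (fun x => b (v x) • G x) 2 (volN n) :=
    mG.mono (mb.smul mG.1) (Eventually.of_forall fun x => by
      rw [norm_smul]; exact mul_le_of_le_one_left (norm_nonneg _) (hbn _))
  obtain ⟨-, φ, hφ, h1, h2, h3⟩ := hv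
  -- pass to a subsequence that converges almost everywhere
  obtain ⟨ns, hns, hae⟩ := (tendstoInMeasure_of_tendsto_eLpNorm (by norm_num)
    (fun k => (hφ k).continuous.aestronglyMeasurable) mv.1 h1).exists_seq_tendsto_ae
  have h1' := h1.comp hns.tendsto_atTop
  have h2' := h2.comp hns.tendsto_atTop
  have h3' := h3.comp hns.tendsto_atTop
  have hcomp : ∀ k, ContDiff ℝ ∞ (fun x => β (φ (ns k) x)) := fun k => hβ.comp (hφ (ns k))
  have hgrad : ∀ k x, ∇ (fun x => β (φ (ns k) x)) x = b (φ (ns k) x) • ∇ (φ (ns k)) x :=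
    fun k x => (hasGradientAt_comp (hd _) (hasGradientAt_of_contDiff (hφ (ns k)) x)).gradient
  have hb3 : Tendsto (fun k => eLpNorm ((fun x => b (φ (ns k) x) • G x) -
      (fun x => b (v x) • G x)) 2 (volN n)) atTop (𝓝 0) := by
    refine tendsto_eLpNorm_of_dominated (g := fun x => ‖G x‖)
      (fun k => (hb.comp (hφ (ns k)).continuous).aestronglyMeasurable.smul mG.1) mG.norm
      (fun k => Eventually.of_forall fun x => ?_) ?_
    · rw [norm_smul]; exact mul_le_of_le_one_left (norm_nonneg _) (hbn _)
    · filter_upwards [hae] with x hx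
      exact ((hb.tendsto _).comp hx).smul_const (G x)
  have hH : ∀ k, eLpNorm ((fun x => β (φ (ns k) x)) - fun x => β (v x)) 2 (volN n) ≤
      eLpNorm (φ (ns k) - v) 2 (volN n) := fun k => eLpNorm_mono fun x => hlip _ _
  have hg : ∀ k, eLpNorm (∇ (fun x => β (φ (ns k) x)) - fun x => b (v x) • G x) 2 (volN n) ≤
      eLpNorm (∇ (φ (ns k)) - G) 2 (volN n) + eLpNorm ((fun x => b (φ (ns k) x) • G x) -
        (fun x => b (v x) • G x)) 2 (volN n) := by
    intro k
    have mφ := (hb.comp (hφ (ns k)).continuous).aestronglyMeasurable (μ := volN n)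
    have mg := (continuous_gradient (hφ (ns k))).aestronglyMeasurable (μ := volN n)
    have e : (∇ (fun x => β (φ (ns k) x)) - fun x => b (v x) • G x) =
        (fun x => b (φ (ns k) x) • (∇ (φ (ns k)) - G) x) +
          ((fun x => b (φ (ns k) x) • G x) - (fun x => b (v x) • G x)) := by
      ext1 x
      simp only [Pi.sub_apply, Pi.add_apply, hgrad, smul_sub]
      abel
    rw [e]
    refine (eLpNorm_add_le (mφ.smul (mg.sub mG.1)) ((mφ.smul mG.1).sub m2.1)
      (by norm_num)).trans (add_le_add_left (eLpNorm_mono fun x => ?_) _)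
    rw [Pi.smul_apply', norm_smul]
    exact mul_le_of_le_one_left (norm_nonneg _) (hbn _)
  have hs : ∀ k, eLpNorm ((fun x => β (φ (ns k) x)) - ⇑f) 2 (surfaceMeasure n) ≤
      eLpNorm (φ (ns k) - ⇑f) 2 (surfaceMeasure n) := fun k => by
    refine eLpNorm_mono_ae ?_
    filter_upwards [hf] with x hx
    have := hlip (φ (ns k) x) (f x)
    rwa [hid _ hx] at this
  have t1 := tendsto_of_tendsto_of_tendsto_of_le_of_le tendsto_const_nhds h1' (fun k => zero_le) hH
  have t2 := tendsto_of_tendsto_of_tendsto_of_le_of_le tendsto_const_nhds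
    (by simpa using h2'.add hb3) (fun k => zero_le) hg
  have t3 := tendsto_of_tendsto_of_tendsto_of_le_of_le tendsto_const_nhds h3' (fun k => zero_le) hs
  refine ⟨isH1_of_approx m1 m2 fun ε hε => ?_, _, hcomp, t1, t2, t3⟩
  obtain ⟨k, k1, k2⟩ := ((tendsto_zero_iff_approx.1 t1 ε hε).and
    (tendsto_zero_iff_approx.1 t2 ε hε)).exists
  exact ⟨_, hcomp k, k1, k2⟩

/-- Weakly harmonic functions with bounded trace are bounded: truncation does not change the trace
and does not increase the Dirichlet energy, which is minimal at a weakly harmonic function. -/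
theorem HasTrace.bounded {n : ℕ} (hn : 3 ≤ n) {v : E n → ℝ} {G : E n → E n} {f : BoundaryL2 n}
    (hv : HasTrace v G f) (hG : IsDivFree G) {M : ℝ}
    (hf : ∀ᵐ x ∂(surfaceMeasure n), |f x| ≤ M) : v ∈ boundedFunctions n := by
  have hf' : ∀ᵐ x ∂(surfaceMeasure n), |f x| ≤ |M| := by
    filter_upwards [hf] with x hx
    exact hx.trans (le_abs_self M)
  obtain ⟨β, b, hβ, hb, hd, hb0, hb1, hid, C, hC⟩ := exists_smooth_truncation (abs_nonneg M)
  have hw := hv.truncation hf' hβ hb hd hb0 hb1 hid hC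
  have mG := hv.1.memLp_grad
  have h0 : HasTrace (v - fun x => β (v x)) (G - fun x => b (v x) • G x) 0 := by
    simpa using hv.sub hw
  have h10 := h0.isH10 (by omega)
  have hz := h10.integral_inner_eq_zero mG hG
  have hpt : ∀ x, inner ℝ (G x) ((G - fun x => b (v x) • G x) x) = (1 - b (v x)) * ‖G x‖ ^ 2 :=
    fun x => by
      rw [Pi.sub_apply, inner_sub_right, real_inner_smul_right, real_inner_self_eq_norm_sq]
      ring
  have hi := integrable_inner mG h10.memLp_grad
  simp only [hpt] at hz hi
  rw [integral_eq_zero_iff_of_nonneg (fun x => mul_nonneg (sub_nonneg.2 (hb1 _)) (sq_nonneg _))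
    hi] at hz
  have hgz : G - (fun x => b (v x) • G x) =ᵐ[volN n] 0 := by
    filter_upwards [hz] with x hx
    have e : (G - fun x => b (v x) • G x) x = (1 - b (v x)) • G x := by
      rw [Pi.sub_apply, sub_smul, one_smul]
    rw [e]
    rcases mul_eq_zero.1 hx with h | h
    · rw [h, zero_smul]; rfl
    · rw [norm_eq_zero.1 (pow_eq_zero_iff (two_ne_zero) |>.1 h), smul_zero]; rfl
  refine ⟨C, ?_⟩
  filter_upwards [h10.ae_eq_zero hn hgz] with x hx
  rw [sub_eq_zero.1 hx]
  exact hC _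

/-! ### Interior regularity of weakly harmonic functions -/

/-- A smooth radial averaging kernel, positive for `|z| < 1/2` and vanishing elsewhere. -/
def kernel {n : ℕ} (z : E n) : ℝ := cutoff (-4) 1 z

theorem contDiff_kernel {n : ℕ} : ContDiff ℝ ∞ (kernel (n := n)) := contDiff_cutoff _ _

theorem kernel_eq_zero {n : ℕ} {z : E n} (hz : 1 / 2 ≤ ‖z‖) : kernel z = 0 :=
  cutoff_eq_zero (by nlinarith)

theorem kernel_neg {n : ℕ} (z : E n) : kernel (-z) = kernel z := by
  simp [kernel, cutoff]

theorem abs_kernel_le {n : ℕ} (z : E n) : |kernel z| ≤ 1 := by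
  rw [kernel, abs_of_nonneg (cutoff_nonneg _ _ _)]
  exact cutoff_le_one _ _ _

theorem hasCompactSupport_kernel {n : ℕ} : HasCompactSupport (kernel (n := n)) := by
  refine HasCompactSupport.intro (isCompact_closedBall (0 : E n) (1 / 2)) fun z hz => ?_
  rw [mem_closedBall_zero_iff, not_le] at hz
  exact kernel_eq_zero hz.le

theorem integral_kernel_pos {n : ℕ} : 0 < ∫ z : E n, kernel z := by
  have hc : Continuous (kernel (n := n)) := contDiff_kernel.continuous
  refine hc.integral_pos_of_hasCompactSupport_nonneg_nonzero hasCompactSupport_kernel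
    (fun z => cutoff_nonneg _ _ _) (x := 0) ?_
  rw [kernel, cutoff_eq_one (by simp)]
  exact one_ne_zero

/-- The field `z ↦ kernel(z) z` is the gradient of a smooth function with support in the ball of
radius `1/2`. -/
theorem exists_kernel_potential (n : ℕ) : ∃ K : E n → ℝ, ContDiff ℝ ∞ K ∧
    (∀ z, 1 / 2 ≤ ‖z‖ → K z = 0) ∧ ∀ z, HasGradientAt K (kernel z • z) z := by
  set h : ℝ → ℝ := fun s => Real.smoothTransition (-4 * s + 1) with hh
  have hs : ContDiff ℝ ∞ h := (Real.smoothTransition.contDiff (n := ⊤)).comp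
    ((contDiff_const.mul contDiff_id).add contDiff_const)
  obtain ⟨h1, h2⟩ := exists_smooth_primitive hs 1
  refine ⟨fun z => 1 / 2 * ∫ t in (1 : ℝ)..‖z‖ ^ 2, h t,
    contDiff_const.mul (h1.comp (contDiff_norm_sq ℝ)), fun z hz => ?_, fun z => ?_⟩
  · have : ∫ t in (1 : ℝ)..‖z‖ ^ 2, h t = ∫ _ in (1 : ℝ)..‖z‖ ^ 2, (0 : ℝ) := by
      refine intervalIntegral.integral_congr fun t ht => ?_
      refine Real.smoothTransition.zero_of_nonpos ?_
      have h4 : 1 / 4 ≤ t := by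
        rcases Set.mem_uIcc.1 ht with ⟨h, -⟩ | ⟨h, -⟩
        · linarith
        · nlinarith
      linarith
    simp [this]
  · have h3 := hasGradientAt_comp (f := fun y : E n => ‖y‖ ^ 2) (h := fun s => 1 / 2 * ∫ t in (1 : ℝ)..s, h t)
      ((h2 (‖z‖ ^ 2)).const_mul (1 / 2)) (hasGradientAt_norm_sq z)
    have e : (1 / 2 * h (‖z‖ ^ 2)) • (2 : ℝ) • z = kernel z • z := by
      rw [smul_smul]
      congr 1
      simp only [hh, kernel, cutoff]
      ring
    rwa [e] at h3

/-- A divergence free field is orthogonal to the fields `kernel(z) z`, at every scale `r` and around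
every point of the unit ball. -/
theorem integral_kernel_inner_eq_zero {n : ℕ} {G : E n → E n} (hG : IsDivFree G)
    (hG0 : ∀ x, x ∉ N n → G x = 0) {x : E n} (hx : ‖x‖ < 1) {r : ℝ} (hr : 0 < r) (hr1 : r ≤ 1) :
    ∫ z, kernel z * inner ℝ (G (x + r • z)) z = 0 := by
  obtain ⟨K, hK, hK0, hKg⟩ := exists_kernel_potential n
  have hφ : IsTest fun y => K (r⁻¹ • (y - x)) := by
    have haff : ContDiff ℝ ∞ fun y : E n => r⁻¹ • (y - x) :=
      (contDiff_id.sub contDiff_const).const_smul r⁻¹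
    refine isTest_of_eq_zero (hK.comp haff)
      (R := 3 / 2) (by norm_num) fun y hy => hK0 _ ?_
    have h1 : 1 / 2 ≤ ‖y - x‖ := by
      have := norm_sub_norm_le y x
      linarith
    rw [norm_smul, norm_inv, Real.norm_of_nonneg hr.le]
    calc 1 / 2 ≤ ‖y - x‖ := h1
      _ ≤ r⁻¹ * ‖y - x‖ := le_mul_of_one_le_left (norm_nonneg _) (one_le_inv_iff₀.2 ⟨hr, hr1⟩)
  have hg : ∀ y, ∇ (fun y => K (r⁻¹ • (y - x))) y =
      (r⁻¹ * kernel (r⁻¹ • (y - x))) • (r⁻¹ • (y - x)) := fun y => by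
    refine HasGradientAt.gradient ?_
    rw [hasGradientAt_iff_hasFDerivAt]
    have h1 := (hKg (r⁻¹ • (y - x))).hasFDerivAt
    have h2 : HasFDerivAt (fun y : E n => r⁻¹ • (y - x)) (r⁻¹ • ContinuousLinearMap.id ℝ (E n)) y :=
      ((hasFDerivAt_id y).sub_const x).const_smul r⁻¹
    refine (h1.comp y h2).congr_fderiv ?_
    ext w
    simp [InnerProductSpace.toDual_apply_apply]
    ring
  have h := hG _ hφ
  rw [setIntegral_eq_integral_of_forall_compl_eq_zero
    (fun y hy => by rw [hG0 y hy, inner_zero_left])] at h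
  simp only [hg, real_inner_smul_right] at h
  have e : ∀ y, r⁻¹ * kernel (r⁻¹ • (y - x)) * (r⁻¹ * inner ℝ (G y) (y - x)) =
      (fun w => r⁻¹ * (kernel (r⁻¹ • w) * inner ℝ (G (x + w)) (r⁻¹ • w))) (y - x) := fun y => by
    simp only [real_inner_smul_right, add_sub_cancel]
    ring
  simp only [e] at h
  rw [integral_sub_right_eq_self (fun w => r⁻¹ * (kernel (r⁻¹ • w) *
    inner ℝ (G (x + w)) (r⁻¹ • w))) x, integral_const_mul, mul_eq_zero,
    or_iff_right (inv_ne_zero hr.ne')] at h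
  have h5 := Measure.integral_comp_smul (volume : Measure (E n))
    (fun w => kernel (r⁻¹ • w) * inner ℝ (G (x + w)) (r⁻¹ • w)) r
  rw [h, smul_zero] at h5
  simpa only [smul_smul, inv_mul_cancel₀ hr.ne', one_smul] using h5

theorem measurable_enorm_comp_add_smul {n : ℕ} {V : Type*} [NormedAddCommGroup V] {F : E n → V}
    (hF : StronglyMeasurable F) :
    Measurable fun p : E n × ℝ × E n => ‖F (p.1 + p.2.1 • p.2.2)‖ₑ :=
  hF.enorm.comp (by fun_prop)

/-- For a smooth function `φ`, the deviation of `φ` from its averages is controlled by the distance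
of its gradient from a divergence free field. -/
theorem enorm_integral_kernel_sub_le {n : ℕ} {G : E n → E n} (hGd : IsDivFree G)
    (hG0 : ∀ x, x ∉ N n → G x = 0) (hGi : Integrable G)
    {φ : E n → ℝ} (hφ : ContDiff ℝ ∞ φ) {x : E n} (hx : ‖x‖ < 1) :
    ‖∫ z, kernel z * (φ (x + z) - φ x)‖ₑ ≤
      ∫⁻ r in Ioc (0 : ℝ) 1, ∫⁻ z in Metric.ball (0 : E n) (1 / 2), ‖(∇ φ - G) (x + r • z)‖ₑ := by
  have hkc : Continuous (kernel (n := n)) := contDiff_kernel.continuous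
  have hgc : Continuous (∇ φ) := continuous_gradient hφ
  set F : E n → ℝ → ℝ := fun z r => kernel z * inner ℝ (∇ φ (x + r • z)) z with hF
  have hFc : Continuous (Function.uncurry F) := by
    simp only [hF, Function.uncurry_def]
    fun_prop
  have hd : ∀ (z : E n) (r : ℝ), HasDerivAt (fun r : ℝ => φ (x + r • z))
      (inner ℝ (∇ φ (x + r • z)) z) r := fun z r => by
    have h1 := (hasGradientAt_of_contDiff hφ (x + r • z)).hasFDerivAt
    have h2 : HasDerivAt (fun r : ℝ => x + r • z) z r := by
      simpa using ((hasDerivAt_id r).smul_const z).const_add x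
    simpa [Function.comp_def] using h1.comp_hasDerivAt r h2
  have hftc : ∀ z, kernel z * (φ (x + z) - φ x) = ∫ r in Ioc (0 : ℝ) 1, F z r := fun z => by
    have h := intervalIntegral.integral_eq_sub_of_hasDerivAt (a := 0) (b := 1)
      (fun r _ => hd z r) (Continuous.intervalIntegrable (by fun_prop) _ _)
    rw [one_smul, zero_smul, add_zero, intervalIntegral.integral_of_le zero_le_one] at h
    rw [← h, ← integral_const_mul]
  have hint : Integrable (Function.uncurry F)
      ((volume : Measure (E n)).prod (volume.restrict (Ioc (0 : ℝ) 1))) := by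
    have h1 : IntegrableOn (Function.uncurry F)
        (Metric.closedBall (0 : E n) (1 / 2) ×ˢ Icc (0 : ℝ) 1) (volume.prod volume) :=
      hFc.continuousOn.integrableOn_compact ((isCompact_closedBall _ _).prod isCompact_Icc)
    have h2 : (volume : Measure (E n)).prod (volume.restrict (Ioc (0 : ℝ) 1)) =
        (volume.prod volume).restrict (univ ×ˢ Ioc (0 : ℝ) 1) := by
      rw [← Measure.prod_restrict, Measure.restrict_univ]
    rw [h2]
    refine IntegrableOn.of_forall_sdiff_eq_zero h1 (MeasurableSet.univ.prod measurableSet_Ioc) ?_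
    rintro ⟨z, r⟩ ⟨⟨-, hr⟩, hzr⟩
    have hz : 1 / 2 ≤ ‖z‖ := by
      by_contra hlt
      exact hzr ⟨by simpa using (not_le.1 hlt).le, Ioc_subset_Icc_self hr⟩
    simp [hF, Function.uncurry, kernel_eq_zero hz]
  simp only [hftc]
  rw [integral_integral_swap hint]
  refine (enorm_integral_le_lintegral_enorm _).trans
    (setLIntegral_mono' measurableSet_Ioc fun r hr => ?_)
  have hz := integral_kernel_inner_eq_zero hGd hG0 hx hr.1 hr.2
  have i1 : Integrable fun z => F z r :=
    Continuous.integrable_of_hasCompactSupport (by simp only [hF]; fun_prop)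
      (hasCompactSupport_kernel.mul_right)
  have i2 : Integrable fun z => kernel z * inner ℝ (G (x + r • z)) z := by
    have h1 : Integrable fun z => G (x + r • z) := (hGi.comp_add_left x).comp_smul hr.1.ne'
    refine h1.norm.mono' (hkc.aestronglyMeasurable.mul
      (h1.1.inner continuous_id.aestronglyMeasurable)) (Eventually.of_forall fun z => ?_)
    rw [norm_mul]
    by_cases hz : 1 / 2 ≤ ‖z‖
    · rw [kernel_eq_zero hz]; simp
    · calc ‖kernel z‖ * ‖inner ℝ (G (x + r • z)) z‖ ≤ 1 * (‖G (x + r • z)‖ * 1) := by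
            gcongr
            · exact abs_kernel_le z
            · exact (norm_inner_le_norm _ _).trans (by gcongr; linarith)
        _ = ‖G (x + r • z)‖ := by ring
  have e : ∫ z, F z r = ∫ z, kernel z * inner ℝ ((∇ φ - G) (x + r • z)) z := by
    rw [← sub_zero (∫ z, F z r), ← hz, ← integral_sub i1 i2]
    refine integral_congr_ae (Eventually.of_forall fun z => ?_)
    simp only [hF, Pi.sub_apply, inner_sub_left]
    ring
  rw [e]
  refine (enorm_integral_le_lintegral_enorm _).trans ?_
  rw [← lintegral_indicator measurableSet_ball]
  refine lintegral_mono fun z => ?_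
  by_cases hz : 1 / 2 ≤ ‖z‖
  · rw [kernel_eq_zero hz]; simp
  · rw [indicator_of_mem (by simpa using hz), enorm_le_iff_norm_le, norm_mul]
    calc ‖kernel z‖ * ‖inner ℝ ((∇ φ - G) (x + r • z)) z‖ ≤ 1 * (‖(∇ φ - G) (x + r • z)‖ * 1) := by
          gcongr
          · exact abs_kernel_le z
          · exact (norm_inner_le_norm _ _).trans (by gcongr; linarith)
      _ = _ := by ring

theorem lintegral_ball_add_le {n : ℕ} {F : E n → ℝ≥0∞} {w : E n} (hw : ‖w‖ < 1) :
    ∫⁻ x in Metric.ball (0 : E n) 1, F (x + w) ≤ ∫⁻ x in N n, F x := by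
  rw [← lintegral_indicator measurableSet_ball, ← lintegral_indicator (measurableSet_N n),
    ← lintegral_add_right_eq_self ((N n).indicator F) w]
  refine lintegral_mono fun x => ?_
  by_cases hx : x ∈ Metric.ball (0 : E n) 1
  · have : x + w ∈ N n := by
      rw [N, mem_ball_zero_iff]
      rw [mem_ball_zero_iff] at hx
      exact (norm_add_le _ _).trans_lt (by linarith)
    rw [indicator_of_mem hx, indicator_of_mem this]
  · rw [indicator_of_notMem hx]; exact zero_le

theorem lintegral_enorm_le_eLpNorm {n : ℕ} {V : Type*} [NormedAddCommGroup V] {F : E n → V}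
    (hF : AEStronglyMeasurable F (volN n)) :
    ∫⁻ x in N n, ‖F x‖ₑ ≤ volN n univ ^ (1 / 2 : ℝ) * eLpNorm F 2 (volN n) := by
  rw [← eLpNorm_one_eq_lintegral_enorm, mul_comm]
  refine (eLpNorm_le_eLpNorm_mul_rpow_measure_univ (p := 1) (q := 2) (by norm_num) hF).trans ?_
  apply le_of_eq
  norm_num

/-- A weakly harmonic function is, up to a constant factor, equal to its average with weight
`kernel` at almost every point of the unit ball. -/
theorem ae_eq_average {n : ℕ} {v : E n → ℝ} {G : E n → E n} (hv : MemLp v 2 (volN n))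
    (hG : MemLp G 2 (volN n)) (hvm : StronglyMeasurable v) (hGm : StronglyMeasurable G)
    (hv0 : ∀ x, x ∉ N n → v x = 0) (hG0 : ∀ x, x ∉ N n → G x = 0) (hGd : IsDivFree G)
    (happ : ∀ ε : ℝ≥0∞, ε ≠ 0 → ∃ φ : E n → ℝ, ContDiff ℝ ∞ φ ∧
      eLpNorm (φ - v) 2 (volN n) ≤ ε ∧ eLpNorm (∇ φ - G) 2 (volN n) ≤ ε) :
    ∀ᵐ x ∂(volume.restrict (Metric.ball (0 : E n) 1)),
      (∫ z : E n, kernel z) * v x = ∫ z, kernel z * v (x + z) := by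
  have hkc : Continuous (kernel (n := n)) := contDiff_kernel.continuous
  have hgi : ∀ {V : Type} [NormedAddCommGroup V] {F : E n → V}, MemLp F 2 (volN n) →
      (∀ x, x ∉ N n → F x = 0) → Integrable F := fun {V} _ {F} hF h0 => by
    have h1 : IntegrableOn F (N n) := memLp_one_iff_integrable.1 (hF.mono_exponent (by norm_num))
    exact (integrableOn_iff_integrable_of_support_subset fun x hx => by
      by_contra h; exact hx (h0 x h)).1 h1
  have hvi := hgi hv hv0
  have hGi := hgi hG hG0
  set c := ∫ z : E n, kernel z with hc
  set T : E n → ℝ := fun x => ∫ z, kernel z * v (x + z) with hT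
  have hvT : ∀ x, Integrable fun z => kernel z * v (x + z) := fun x => by
    have h1 : Integrable fun z => v (x + z) := hvi.comp_add_left x
    refine h1.norm.mono' (hkc.aestronglyMeasurable.mul h1.1) (Eventually.of_forall fun z => ?_)
    rw [norm_mul]
    exact mul_le_of_le_one_left (norm_nonneg _) (abs_kernel_le z)
  have hTm : StronglyMeasurable T := by
    refine StronglyMeasurable.integral_prod_right' (f := fun p : E n × E n =>
      kernel p.2 * v (p.1 + p.2)) ?_
    exact (hkc.comp continuous_snd).stronglyMeasurable.mul
      (hvm.comp_measurable (by fun_prop))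
  set B : ℝ≥0∞ := volume (Metric.ball (0 : E n) (1 / 2)) with hB
  have hBt : B ≠ ⊤ := measure_ball_lt_top.ne
  set A : ℝ≥0∞ := volN n univ ^ (1 / 2 : ℝ) with hA
  have hAt : A ≠ ⊤ := ENNReal.rpow_ne_top_of_nonneg (by norm_num) (measure_ne_top _ _)
  have hsmall : ∀ ε : ℝ≥0∞, ε ≠ 0 →
      ∫⁻ x in Metric.ball (0 : E n) 1, ‖c * v x - T x‖ₑ ≤ ε * (A * (‖c‖ₑ + 2 * B)) := by
    intro ε hε
    obtain ⟨φ, hφ, h1, h2⟩ := happ ε hε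
    have hD : StronglyMeasurable (∇ φ - G) := (continuous_gradient hφ).stronglyMeasurable.sub hGm
    have hU : StronglyMeasurable (φ - v) := hφ.continuous.stronglyMeasurable.sub hvm
    have hDle : ∫⁻ x in N n, ‖(∇ φ - G) x‖ₑ ≤ A * ε :=
      (lintegral_enorm_le_eLpNorm hD.aestronglyMeasurable).trans (by gcongr)
    have hUle : ∫⁻ x in N n, ‖(φ - v) x‖ₑ ≤ A * ε :=
      (lintegral_enorm_le_eLpNorm hU.aestronglyMeasurable).trans (by gcongr)
    have iφ : ∀ x, Integrable fun z => kernel z * φ (x + z) := fun x =>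
      (hkc.mul (hφ.continuous.comp (continuous_const.add continuous_id))).integrable_of_hasCompactSupport
        hasCompactSupport_kernel.mul_right
    have ik : Integrable (kernel (n := n)) :=
      hkc.integrable_of_hasCompactSupport hasCompactSupport_kernel
    have hsplit : ∀ x, c * v x - T x = -(c * (φ - v) x) - (∫ z, kernel z * (φ (x + z) - φ x)) +
        ∫ z, kernel z * (φ - v) (x + z) := fun x => by
      simp only [hT, Pi.sub_apply, mul_sub]
      rw [integral_sub (iφ x) (ik.mul_const _), integral_sub (iφ x) (hvT x), integral_mul_const]
      ring
    have hpt : ∀ x ∈ Metric.ball (0 : E n) 1, ‖c * v x - T x‖ₑ ≤ ‖c‖ₑ * ‖(φ - v) x‖ₑ +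
        (∫⁻ r in Ioc (0 : ℝ) 1, ∫⁻ z in Metric.ball (0 : E n) (1 / 2), ‖(∇ φ - G) (x + r • z)‖ₑ) +
        ∫⁻ z in Metric.ball (0 : E n) (1 / 2), ‖(φ - v) (x + z)‖ₑ := fun x hx => by
      rw [hsplit]
      refine (enorm_add_le _ _).trans (add_le_add (enorm_sub_le.trans (add_le_add ?_ ?_)) ?_)
      · rw [enorm_neg, enorm_mul]
      · exact enorm_integral_kernel_sub_le hGd hG0 hGi hφ (by simpa using hx)
      · refine (enorm_integral_le_lintegral_enorm _).trans ?_
        rw [← lintegral_indicator measurableSet_ball]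
        refine lintegral_mono fun z => ?_
        by_cases hz : 1 / 2 ≤ ‖z‖
        · rw [kernel_eq_zero hz]; simp
        · rw [indicator_of_mem (by simpa using hz), enorm_le_iff_norm_le, norm_mul]
          exact mul_le_of_le_one_left (norm_nonneg _) (abs_kernel_le z)
    have mD := measurable_enorm_comp_add_smul hD
    have hDD : ∫⁻ x in Metric.ball (0 : E n) 1, ∫⁻ r in Ioc (0 : ℝ) 1,
        ∫⁻ z in Metric.ball (0 : E n) (1 / 2), ‖(∇ φ - G) (x + r • z)‖ₑ ≤ B * (A * ε) := by
      have m1 : Measurable (Function.uncurry fun (x : E n) (r : ℝ) =>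
          ∫⁻ z in Metric.ball (0 : E n) (1 / 2), ‖(∇ φ - G) (x + r • z)‖ₑ) :=
        Measurable.lintegral_prod_right' (f := fun p : (E n × ℝ) × E n =>
          ‖(∇ φ - G) (p.1.1 + p.1.2 • p.2)‖ₑ) (hD.enorm.comp (by fun_prop))
      rw [lintegral_lintegral_swap m1.aemeasurable]
      calc _ ≤ ∫⁻ _ in Ioc (0 : ℝ) 1, B * (A * ε) := by
            refine setLIntegral_mono' measurableSet_Ioc fun r hr => ?_
            have m2 : Measurable (Function.uncurry fun (x : E n) (z : E n) =>
                ‖(∇ φ - G) (x + r • z)‖ₑ) := by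
              simp only [Function.uncurry_def]
              exact hD.enorm.comp (by fun_prop)
            rw [lintegral_lintegral_swap m2.aemeasurable]
            calc _ ≤ ∫⁻ _ in Metric.ball (0 : E n) (1 / 2), A * ε := by
                  refine setLIntegral_mono' measurableSet_ball fun z hz => ?_
                  refine (lintegral_ball_add_le (F := fun y => ‖(∇ φ - G) y‖ₑ) ?_).trans hDle
                  rw [norm_smul, Real.norm_of_nonneg hr.1.le]
                  have : ‖z‖ < 1 / 2 := by simpa using hz
                  nlinarith [hr.2, norm_nonneg z]
              _ = B * (A * ε) := by rw [setLIntegral_const, mul_comm]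
        _ = B * (A * ε) := by simp
    have hUU : ∫⁻ x in Metric.ball (0 : E n) 1, ∫⁻ z in Metric.ball (0 : E n) (1 / 2),
        ‖(φ - v) (x + z)‖ₑ ≤ B * (A * ε) := by
      have m2 : Measurable (Function.uncurry fun (x : E n) (z : E n) => ‖(φ - v) (x + z)‖ₑ) := by
        simp only [Function.uncurry_def]
        exact hU.enorm.comp (by fun_prop)
      rw [lintegral_lintegral_swap m2.aemeasurable]
      calc _ ≤ ∫⁻ _ in Metric.ball (0 : E n) (1 / 2), A * ε := by
            refine setLIntegral_mono' measurableSet_ball fun z hz => ?_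
            refine (lintegral_ball_add_le (F := fun y => ‖(φ - v) y‖ₑ) ?_).trans hUle
            have : ‖z‖ < 1 / 2 := by simpa using hz
            linarith
        _ = B * (A * ε) := by rw [setLIntegral_const, mul_comm]
    have mU : Measurable fun x => ‖c‖ₑ * ‖(φ - v) x‖ₑ := hU.enorm.const_mul _
    have mDD : Measurable fun x : E n => ∫⁻ r in Ioc (0 : ℝ) 1,
        ∫⁻ z in Metric.ball (0 : E n) (1 / 2), ‖(∇ φ - G) (x + r • z)‖ₑ := by
      refine Measurable.lintegral_prod_right' (f := fun p : E n × ℝ =>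
        ∫⁻ z in Metric.ball (0 : E n) (1 / 2), ‖(∇ φ - G) (p.1 + p.2 • z)‖ₑ) ?_
      exact Measurable.lintegral_prod_right' (f := fun p : (E n × ℝ) × E n =>
          ‖(∇ φ - G) (p.1.1 + p.1.2 • p.2)‖ₑ) (hD.enorm.comp (by fun_prop))
    calc ∫⁻ x in Metric.ball (0 : E n) 1, ‖c * v x - T x‖ₑ ≤ _ :=
          setLIntegral_mono' measurableSet_ball hpt
      _ ≤ ‖c‖ₑ * (A * ε) + B * (A * ε) + B * (A * ε) := by
          have mS : Measurable fun x : E n => ‖c‖ₑ * ‖(φ - v) x‖ₑ + ∫⁻ r in Ioc (0 : ℝ) 1,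
            ∫⁻ z in Metric.ball (0 : E n) (1 / 2), ‖(∇ φ - G) (x + r • z)‖ₑ := mU.add mDD
          rw [lintegral_add_left mS, lintegral_add_left mU]
          refine add_le_add (add_le_add ?_ hDD) hUU
          rw [lintegral_const_mul _ hU.enorm]
          gcongr
          refine (lintegral_mono_set ?_).trans hUle
          exact Metric.ball_subset_ball (by norm_num)
      _ = ε * (A * (‖c‖ₑ + 2 * B)) := by ring
  have hKt : A * (‖c‖ₑ + 2 * B) ≠ ⊤ :=
    ENNReal.mul_ne_top hAt (ENNReal.add_ne_top.2 ⟨enorm_ne_top, ENNReal.mul_ne_top (by simp) hBt⟩)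
  have hfin : ∫⁻ x in Metric.ball (0 : E n) 1, ‖c * v x - T x‖ₑ ≠ ⊤ := by
    have := hsmall 1 one_ne_zero
    rw [one_mul] at this
    exact (this.trans_lt (lt_top_iff_ne_top.2 hKt)).ne
  have hz : ∫⁻ x in Metric.ball (0 : E n) 1, ‖c * v x - T x‖ₑ = 0 := by
    have e : ∫⁻ x in Metric.ball (0 : E n) 1, ‖c * v x - T x‖ₑ =
        ‖(∫⁻ x in Metric.ball (0 : E n) 1, ‖c * v x - T x‖ₑ).toReal‖ₑ := by
      rw [Real.enorm_eq_ofReal ENNReal.toReal_nonneg, ENNReal.ofReal_toReal hfin]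
    rw [e, enorm_eq_zero]
    refine eq_zero_of_enorm_le_mul hKt fun ε hε => ?_
    rw [← e]
    exact hsmall ε hε
  have mz : Measurable fun x => ‖c * v x - T x‖ₑ := ((hvm.const_mul c).sub hTm).enorm
  rw [lintegral_eq_zero_iff mz] at hz
  filter_upwards [hz] with x hx
  exact sub_eq_zero.1 (enorm_eq_zero.1 hx)

/-- Weyl's lemma: a weakly harmonic function is smooth in the unit ball. -/
theorem exists_smooth_of_isDivFree {n : ℕ} {v : E n → ℝ} {G : E n → E n} {f : BoundaryL2 n}
    (hv : HasTrace v G f) (hGd : IsDivFree G) :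
    ∃ V : E n → ℝ, ContDiff ℝ ∞ V ∧
      ∀ᵐ x ∂(volume.restrict (Metric.ball (0 : E n) 1)), v x = V x ∧ G x = ∇ V x := by
  have mv := hv.1.memLp
  have mG := hv.1.memLp_grad
  set v' : E n → ℝ := (N n).indicator (mv.1.mk v) with hv'
  set G' : E n → E n := (N n).indicator (mG.1.mk G) with hG'
  have ev : v =ᵐ[volN n] v' := by
    filter_upwards [mv.1.ae_eq_mk, ae_restrict_mem (measurableSet_N n)] with x h1 h2
    rw [hv', indicator_of_mem h2, h1]
  have eG : G =ᵐ[volN n] G' := by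
    filter_upwards [mG.1.ae_eq_mk, ae_restrict_mem (measurableSet_N n)] with x h1 h2
    rw [hG', indicator_of_mem h2, h1]
  have hvG := hv.congr_ae ev eG
  have hGd' : IsDivFree G' := fun φ hφ => by
    rw [← hGd φ hφ]
    refine integral_congr_ae ?_
    filter_upwards [eG] with x hx
    rw [hx]
  have hav := ae_eq_average hvG.1.memLp hvG.1.memLp_grad
    (mv.1.stronglyMeasurable_mk.indicator (measurableSet_N n))
    (mG.1.stronglyMeasurable_mk.indicator (measurableSet_N n))
    (fun x hx => indicator_of_notMem hx _) (fun x hx => indicator_of_notMem hx _) hGd'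
    (fun ε hε => by
      obtain ⟨φ, h0, h1, h2, -⟩ := hvG.exists_approx hε
      exact ⟨φ, h0, h1, h2⟩)
  have hvi : Integrable v' := by
    have h1 : IntegrableOn v' (N n) :=
      memLp_one_iff_integrable.1 (hvG.1.memLp.mono_exponent (by norm_num))
    exact (integrableOn_iff_integrable_of_support_subset fun x hx => by
      by_contra h; exact hx (indicator_of_notMem h _)).1 h1
  set c := ∫ z : E n, kernel z with hc
  have hc0 : c ≠ 0 := integral_kernel_pos.ne'
  set V : E n → ℝ := fun x => c⁻¹ * ∫ z, kernel z * v' (x + z) with hV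
  have hVs : ContDiff ℝ ∞ V := by
    have h1 := hasCompactSupport_kernel.contDiff_convolution_left (ContinuousLinearMap.mul ℝ ℝ)
      (contDiff_kernel (n := n)) hvi.locallyIntegrable (μ := volume)
    refine contDiff_const.mul ?_
    suffices h : (fun x => ∫ z, kernel z * v' (x + z)) =
        convolution kernel v' (ContinuousLinearMap.mul ℝ ℝ) volume by rw [h]; exact h1
    funext x
    rw [convolution_def, ← integral_neg_eq_self]
    refine integral_congr_ae (Eventually.of_forall fun z => ?_)
    simp [kernel_neg, sub_eq_add_neg]
  have hsub : Metric.ball (0 : E n) 1 ⊆ N n := Metric.ball_subset_ball (by norm_num)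
  have hrestr : ∀ {p : E n → Prop}, (∀ᵐ x ∂(volN n), p x) →
      ∀ᵐ x ∂(volume.restrict (Metric.ball (0 : E n) 1)), p x :=
    fun h => ae_restrict_of_ae_restrict_of_subset hsub h
  have hvV : ∀ᵐ x ∂(volume.restrict (Metric.ball (0 : E n) 1)), v x = V x := by
    filter_upwards [hav, hrestr ev] with x h1 h2
    rw [h2, hV]
    simp only
    rw [← h1, inv_mul_cancel_left₀ hc0]
  refine ⟨V, hVs, ?_⟩
  have hGi : IntegrableOn G (N n) := memLp_one_iff_integrable.1 (mG.mono_exponent (by norm_num))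
  have hgc : Continuous (∇ V) := continuous_gradient hVs
  have hloc : LocallyIntegrableOn (G - ∇ V) (Metric.ball (0 : E n) 1) :=
    (hGi.mono_set hsub).locallyIntegrableOn.sub
      (hgc.locallyIntegrable.locallyIntegrableOn _)
  have hzero := Metric.isOpen_ball.ae_eq_zero_of_integral_contDiff_smul_eq_zero hloc
    (fun ψ hψ hψc hψs => by
      have t : tsupport ψ ⊆ N n := hψs.trans hsub
      have m1 : MemLp ψ 2 (volN n) := memLp_volN_of_continuous hψ.continuous
      have m2 : MemLp (∇ V) 2 (volN n) := memLp_volN_of_continuous hgc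
      have e1 : ∫ x, ψ x • (G - ∇ V) x = ∫ x in N n, ψ x • (G - ∇ V) x := by
        refine (setIntegral_eq_integral_of_forall_compl_eq_zero fun x hx => ?_).symm
        rw [image_eq_zero_of_notMem_tsupport (fun h => hx (t h)), zero_smul]
      have w1 := hv.1.weak ψ hψ hψc t
      have w2 := (isH1_of_contDiff hVs).weak ψ hψ hψc t
      have e2 : ∫ x in N n, v x • ∇ ψ x = ∫ x in N n, V x • ∇ ψ x := by
        refine integral_congr_ae ?_
        have h1 := (ae_restrict_iff' measurableSet_ball).1 hvV
        filter_upwards [ae_restrict_of_ae h1] with x hx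
        by_cases hxb : x ∈ Metric.ball (0 : E n) 1
        · rw [hx hxb]
        · have : ∇ ψ x = 0 := by
            refine image_eq_zero_of_notMem_tsupport fun h => hxb (hψs ?_)
            exact (tsupport_fderiv_subset ℝ) ((tsupport_comp_subset
              (map_zero (InnerProductSpace.toDual ℝ (E n)).symm) _) h)
          rw [this, smul_zero, smul_zero]
      rw [e1]
      simp only [Pi.sub_apply, smul_sub]
      rw [integral_sub (integrable_smul_of_memLp m1 mG) (integrable_smul_of_memLp m1 m2)]
      rw [w1, w2, neg_inj] at e2
      rw [e2, sub_self])
  filter_upwards [hvV, (ae_restrict_iff' measurableSet_ball).2 hzero] with x h1 h2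
  exact ⟨h1, sub_eq_zero.1 h2⟩

/-! ### Radial linear maps and the singular transformation -/

/-- The symmetric linear map with eigenvalue `a` in the direction of `y` and `b` on the orthogonal
complement of `y` (for `y ≠ 0`). -/
def radialOp {n : ℕ} (y : E n) (a b : ℝ) : E n →L[ℝ] E n :=
  b • ContinuousLinearMap.id ℝ (E n) + ((a - b) / ‖y‖ ^ 2) • (innerSL ℝ y).smulRight y

theorem radialOp_apply {n : ℕ} (y : E n) (a b : ℝ) (ξ : E n) :
    radialOp y a b ξ = b • ξ + ((a - b) / ‖y‖ ^ 2 * inner ℝ y ξ) • y := by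
  simp [radialOp, smul_smul]

theorem radialOp_comp {n : ℕ} {y : E n} (hy : y ≠ 0) (a b c d : ℝ) (ξ : E n) :
    radialOp y a b (radialOp y c d ξ) = radialOp y (a * c) (b * d) ξ := by
  have h : ‖y‖ ≠ 0 := norm_ne_zero_iff.2 hy
  simp only [radialOp_apply, inner_add_right, real_inner_smul_right, real_inner_self_eq_norm_sq,
    smul_add, smul_smul, add_assoc, ← add_smul]
  congr 2
  field_simp
  ring

theorem inner_radialOp_left {n : ℕ} (y : E n) (a b : ℝ) (ξ η : E n) :
    inner ℝ (radialOp y a b ξ) η = inner ℝ ξ (radialOp y a b η) := by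
  simp only [radialOp_apply, inner_add_right, inner_add_left, real_inner_smul_right,
    real_inner_smul_left]
  rw [real_inner_comm ξ y]
  ring

theorem radialOp_self {n : ℕ} {y : E n} (hy : y ≠ 0) (a b : ℝ) : radialOp y a b y = a • y := by
  have h : ‖y‖ ≠ 0 := norm_ne_zero_iff.2 hy
  rw [radialOp_apply, real_inner_self_eq_norm_sq, ← add_smul]
  congr 1
  field_simp
  ring

theorem radialOp_smul {n : ℕ} (y : E n) {c : ℝ} (hc : c ≠ 0) (a b : ℝ) :
    radialOp (c • y) a b = radialOp y a b := by
  ext1 ξ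
  rw [radialOp_apply, radialOp_apply, real_inner_smul_left, smul_smul, norm_smul]
  congr 2
  rw [mul_pow, Real.norm_eq_abs, sq_abs]
  field_simp

theorem norm_radialOp_le {n : ℕ} (y : E n) (a b : ℝ) (ξ : E n) :
    ‖radialOp y a b ξ‖ ≤ (|b| + |a - b|) * ‖ξ‖ := by
  rcases eq_or_ne y 0 with rfl | hy
  · rw [radialOp_apply]
    simp only [smul_zero, add_zero, norm_smul, Real.norm_eq_abs]
    gcongr
    simp
  · have h : 0 < ‖y‖ := norm_pos_iff.2 hy
    rw [radialOp_apply, add_mul]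
    refine (norm_add_le _ _).trans (add_le_add (by rw [norm_smul, Real.norm_eq_abs]) ?_)
    rw [norm_smul, norm_mul, norm_div, Real.norm_eq_abs, Real.norm_of_nonneg (sq_nonneg ‖y‖)]
    calc |a - b| / ‖y‖ ^ 2 * ‖inner ℝ y ξ‖ * ‖y‖
        ≤ |a - b| / ‖y‖ ^ 2 * (‖y‖ * ‖ξ‖) * ‖y‖ := by
          gcongr; exact norm_inner_le_norm _ _
      _ = |a - b| * ‖ξ‖ := by field_simp

theorem inner_radialOp_pos {n : ℕ} {y : E n} (hy : y ≠ 0) {a b : ℝ} (ha : 0 < a) (hb : 0 < b)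
    {ξ : E n} (hξ : ξ ≠ 0) : 0 < inner ℝ (radialOp y a b ξ) ξ := by
  have h : 0 < ‖y‖ := norm_pos_iff.2 hy
  have hx : 0 < ‖ξ‖ := norm_pos_iff.2 hξ
  have hcs : (inner ℝ y ξ) ^ 2 / ‖y‖ ^ 2 ≤ ‖ξ‖ ^ 2 := by
    rw [div_le_iff₀ (by positivity), ← mul_pow, mul_comm ‖ξ‖]
    exact sq_le_sq' (neg_le_of_abs_le (abs_real_inner_le_norm y ξ)) (real_inner_le_norm y ξ)
  have e : inner ℝ (radialOp y a b ξ) ξ =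
      b * (‖ξ‖ ^ 2 - (inner ℝ y ξ) ^ 2 / ‖y‖ ^ 2) + a * ((inner ℝ y ξ) ^ 2 / ‖y‖ ^ 2) := by
    rw [radialOp_apply, inner_add_left, real_inner_smul_left, real_inner_smul_left,
      real_inner_self_eq_norm_sq]
    ring
  rw [e]
  set t := (inner ℝ y ξ) ^ 2 / ‖y‖ ^ 2 with ht
  have ht0 : 0 ≤ t := by positivity
  rcases ht0.eq_or_lt with h0 | h0
  · rw [← h0]; simp; positivity
  · have := mul_nonneg hb.le (sub_nonneg.2 hcs)
    have := mul_pos ha h0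
    linarith

/-- The matrix of `radialOp y a b`. -/
def radialMatrix {n : ℕ} (y : E n) (a b : ℝ) : Matrix (Fin n) (Fin n) ℝ :=
  b • 1 + ((a - b) / ‖y‖ ^ 2) • Matrix.vecMulVec y.ofLp y.ofLp

theorem dotProduct_ofLp {n : ℕ} (x y : E n) : x.ofLp ⬝ᵥ y.ofLp = inner ℝ x y := by
  rw [EuclideanSpace.inner_eq_star_dotProduct, star_trivial, dotProduct_comm]

theorem toEuclideanLin_radialMatrix {n : ℕ} (y : E n) (a b : ℝ) (ξ : E n) :
    Matrix.toEuclideanLin (radialMatrix y a b) ξ = radialOp y a b ξ := by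
  rw [radialOp_apply, Matrix.toLpLin_apply, radialMatrix, Matrix.add_mulVec,
    Matrix.smul_mulVec, Matrix.smul_mulVec, Matrix.one_mulVec, Matrix.vecMulVec_mulVec,
    dotProduct_ofLp]
  ext i
  simp
  ring

theorem matrix_ext_toEuclideanLin {n : ℕ} {A B : Matrix (Fin n) (Fin n) ℝ}
    (h : ∀ ξ, Matrix.toEuclideanLin A ξ = Matrix.toEuclideanLin B ξ) : A = B :=
  Matrix.toEuclideanLin.injective (LinearMap.ext h)

theorem radialMatrix_mul {n : ℕ} {y : E n} (hy : y ≠ 0) (a b c d : ℝ) :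
    radialMatrix y a b * radialMatrix y c d = radialMatrix y (a * c) (b * d) := by
  refine matrix_ext_toEuclideanLin fun ξ => ?_
  rw [toEuclideanLin_radialMatrix, ← radialOp_comp hy, ← toEuclideanLin_radialMatrix,
    ← toEuclideanLin_radialMatrix]
  simp [Matrix.toLpLin_apply, Matrix.mulVec_mulVec]

theorem radialMatrix_one {n : ℕ} (y : E n) : radialMatrix y 1 1 = 1 := by
  simp [radialMatrix]

theorem radialMatrix_transpose {n : ℕ} (y : E n) (a b : ℝ) :
    (radialMatrix y a b)ᵀ = radialMatrix y a b := by
  simp [radialMatrix, Matrix.transpose_vecMulVec]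

theorem det_radialMatrix {n : ℕ} (hn : 1 ≤ n) {y : E n} (hy : y ≠ 0) (a : ℝ) {b : ℝ} (hb : b ≠ 0) :
    (radialMatrix y a b).det = a * b ^ (n - 1) := by
  have h : ‖y‖ ≠ 0 := norm_ne_zero_iff.2 hy
  have e : radialMatrix y a b = b • (1 + Matrix.replicateCol Unit (((a - b) / b / ‖y‖ ^ 2) • y.ofLp) *
      Matrix.replicateRow Unit y.ofLp) := by
    rw [← Matrix.vecMulVec_eq, Matrix.smul_vecMulVec, smul_add, smul_smul, radialMatrix]
    congr 2
    field_simp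
  rw [e, Matrix.det_smul, Matrix.det_one_add_replicateCol_mul_replicateRow, dotProduct_smul,
    dotProduct_ofLp, real_inner_self_eq_norm_sq, Fintype.card_fin, smul_eq_mul]
  obtain ⟨m, rfl⟩ : ∃ m, n = m + 1 := ⟨n - 1, by omega⟩
  rw [pow_succ, Nat.add_sub_cancel]
  field_simp
  ring

theorem hasGradientAt_norm {n : ℕ} {y : E n} (hy : y ≠ 0) :
    HasGradientAt (fun y : E n => ‖y‖) (‖y‖⁻¹ • y) y := by
  have h : ‖y‖ ≠ 0 := norm_ne_zero_iff.2 hy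
  have h1 := hasGradientAt_comp (f := fun y : E n => ‖y‖ ^ 2) (h := Real.sqrt)
    (Real.hasDerivAt_sqrt (pow_ne_zero 2 h)) (hasGradientAt_norm_sq y)
  simp only [Real.sqrt_sq (norm_nonneg _), smul_smul] at h1
  convert h1 using 2
  field_simp

/-- The derivative of the radial map `y ↦ (α + β/|y|) y`. -/
theorem hasFDerivAt_radial {n : ℕ} {y : E n} (hy : y ≠ 0) (α β : ℝ) :
    HasFDerivAt (fun y : E n => (α + β * ‖y‖⁻¹) • y) (radialOp y α (α + β * ‖y‖⁻¹)) y := by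
  have h : ‖y‖ ≠ 0 := norm_ne_zero_iff.2 hy
  have h1 := hasGradientAt_comp (f := fun y : E n => ‖y‖) (h := fun t => α + β * t⁻¹)
    (((hasDerivAt_inv h).const_mul β).const_add α) (hasGradientAt_norm hy)
  refine (h1.hasFDerivAt.smul (hasFDerivAt_id y)).congr_fderiv ?_
  ext1 ξ
  simp only [radialOp_apply, InnerProductSpace.toDual_apply_apply, _root_.add_apply,
    ContinuousLinearMap.smulRight_apply, _root_.smul_apply, id_eq,
    ContinuousLinearMap.id_apply, real_inner_smul_left]
  congr 2
  field_simp
  ring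

theorem blowDown_eq {n : ℕ} : blowDown (n := n) = fun y => (2 + -2 * ‖y‖⁻¹) • y := by
  funext y
  rcases eq_or_ne y 0 with rfl | hy
  · simp [blowDown]
  · have h : ‖y‖ ≠ 0 := norm_ne_zero_iff.2 hy
    rw [blowDown, smul_smul]
    congr 1
    field_simp
    ring

theorem blowUp_eq {n : ℕ} : blowUp (n := n) = fun y => (1 / 2 + 1 * ‖y‖⁻¹) • y := by
  funext y
  rcases eq_or_ne y 0 with rfl | hy
  · simp [blowUp]
  · have h : ‖y‖ ≠ 0 := norm_ne_zero_iff.2 hy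
    rw [blowUp, smul_smul]
    congr 1
    field_simp

/-- The stretching factor of `blowDown` in the directions tangential to spheres. -/
def tangFactor {n : ℕ} (y : E n) : ℝ := 2 + -2 * ‖y‖⁻¹

theorem tangFactor_pos {n : ℕ} {y : E n} (hy : 1 < ‖y‖) : 0 < tangFactor y := by
  have : ‖y‖⁻¹ < 1 := inv_lt_one_of_one_lt₀ hy
  rw [tangFactor]
  linarith

theorem tangFactor_le_one {n : ℕ} {y : E n} (hy : 1 < ‖y‖) (hy2 : ‖y‖ ≤ 2) : tangFactor y ≤ 1 := by
  have : (2 : ℝ)⁻¹ ≤ ‖y‖⁻¹ := inv_anti₀ (by linarith) hy2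
  rw [tangFactor]
  linarith

theorem ne_zero_of_one_lt {n : ℕ} {y : E n} (hy : 1 < ‖y‖) : y ≠ 0 :=
  norm_ne_zero_iff.1 (by linarith)

theorem hasFDerivAt_blowDown {n : ℕ} {y : E n} (hy : y ≠ 0) :
    HasFDerivAt blowDown (radialOp y 2 (tangFactor y)) y := by
  rw [blowDown_eq]
  exact hasFDerivAt_radial hy 2 (-2)

theorem hasFDerivAt_blowUp {n : ℕ} {x : E n} (hx : x ≠ 0) :
    HasFDerivAt blowUp (radialOp x (1 / 2) (1 / 2 + 1 * ‖x‖⁻¹)) x := by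
  rw [blowUp_eq]
  exact hasFDerivAt_radial hx (1 / 2) 1

theorem contDiffAt_radial {n : ℕ} {y : E n} (hy : y ≠ 0) (α β : ℝ) :
    ContDiffAt ℝ ∞ (fun y : E n => (α + β * ‖y‖⁻¹) • y) y :=
  (contDiffAt_const.add (contDiffAt_const.mul ((contDiffAt_norm ℝ hy).inv
    (norm_ne_zero_iff.2 hy)))).smul contDiffAt_id

theorem contDiffAt_blowDown {n : ℕ} {y : E n} (hy : y ≠ 0) : ContDiffAt ℝ ∞ blowDown y := by
  rw [blowDown_eq]; exact contDiffAt_radial hy _ _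

theorem contDiffAt_blowUp {n : ℕ} {y : E n} (hy : y ≠ 0) : ContDiffAt ℝ ∞ blowUp y := by
  rw [blowUp_eq]; exact contDiffAt_radial hy _ _

theorem det_radialOp {n : ℕ} (hn : 1 ≤ n) {y : E n} (hy : y ≠ 0) (a : ℝ) {b : ℝ} (hb : b ≠ 0) :
    (radialOp y a b).det = a * b ^ (n - 1) := by
  have e : ((radialOp y a b : E n →L[ℝ] E n) : E n →ₗ[ℝ] E n) =
      Matrix.toEuclideanLin (radialMatrix y a b) :=
    LinearMap.ext fun ξ => (toEuclideanLin_radialMatrix y a b ξ).symm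
  rw [ContinuousLinearMap.det, e]
  change LinearMap.det (Matrix.toLpLin 2 2 (radialMatrix y a b)) = _
  rw [Matrix.toLpLin_eq_toLin, LinearMap.det_toLin, det_radialMatrix hn hy a hb]

theorem jacobian_blowDown {n : ℕ} {y : E n} (hy : y ≠ 0) :
    jacobian blowDown y = radialMatrix y 2 (tangFactor y) := by
  ext p k
  rw [jacobian, Matrix.of_apply, (hasFDerivAt_blowDown hy).fderiv, ← toEuclideanLin_radialMatrix]
  simp [Matrix.toLpLin_apply]

/-- The singular conductivity outside the unit ball: it vanishes like `(|y|-1)^(n-1)` in the radial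
and like `(|y|-1)^(n-3)` in the tangential directions. -/
theorem conductivity_cloakMetric {n : ℕ} (hn : 3 ≤ n) (g : E n → Matrix (Fin n) (Fin n) ℝ)
    {y : E n} (hy : 1 < ‖y‖) : conductivity (cloakMetric g) y =
      radialMatrix y (tangFactor y ^ (n - 1) / 2) (2 * tangFactor y ^ (n - 3)) := by
  have hy0 := ne_zero_of_one_lt hy
  have hs := tangFactor_pos hy
  set s := tangFactor y with hsdef
  have hg : cloakMetric g y = radialMatrix y 4 (s ^ 2) := by
    rw [cloakMetric, if_pos hy, pullbackMetric, jacobian_blowDown hy0, euclideanMetric,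
      radialMatrix_transpose, mul_one, radialMatrix_mul hy0]
    congr 1
    · norm_num
    · ring
  have hinv : (radialMatrix y 4 (s ^ 2))⁻¹ = radialMatrix y (1 / 4) (s ^ 2)⁻¹ := by
    refine Matrix.inv_eq_right_inv ?_
    rw [radialMatrix_mul hy0, mul_inv_cancel₀ (by positivity), ← radialMatrix_one y]
    norm_num
  have hdet : Real.sqrt (radialMatrix y 4 (s ^ 2)).det = 2 * s ^ (n - 1) := by
    rw [det_radialMatrix (by omega) hy0 _ (by positivity)]
    have : 4 * (s ^ 2) ^ (n - 1) = (2 * s ^ (n - 1)) ^ 2 := by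
      rw [mul_pow, ← pow_mul, ← pow_mul, mul_comm 2]
      norm_num
    rw [this, Real.sqrt_sq (by positivity)]
  rw [conductivity, hg, hinv, hdet]
  have hpow : s ^ (n - 1) = s ^ (n - 3) * s ^ 2 := by
    rw [← pow_add]; congr 1; omega
  have e : 2 * s ^ (n - 1) * (s ^ 2)⁻¹ = 2 * s ^ (n - 3) := by
    rw [hpow]; field_simp
  rw [radialMatrix, radialMatrix, smul_add, smul_smul, smul_smul, e]
  congr 2
  rw [← e]
  ring

theorem flux_cloakMetric {n : ℕ} (hn : 3 ≤ n) (g : E n → Matrix (Fin n) (Fin n) ℝ)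
    (G : E n → E n) {y : E n} (hy : 1 < ‖y‖) : flux (conductivity (cloakMetric g)) G y =
      radialOp y (tangFactor y ^ (n - 1) / 2) (2 * tangFactor y ^ (n - 3)) (G y) := by
  rw [flux, conductivity_cloakMetric hn g hy, toEuclideanLin_radialMatrix]

/-! ### The change of variables -/

/-- The domain `1 < |y| < 2` outside the cloaked ball. -/
def outerShell (n : ℕ) : Set (E n) := Metric.ball 0 2 \ Metric.closedBall 0 1

theorem measurableSet_outerShell (n : ℕ) : MeasurableSet (outerShell n) :=
  measurableSet_ball.diff measurableSet_closedBall

theorem mem_outerShell {n : ℕ} {y : E n} : y ∈ outerShell n ↔ ‖y‖ < 2 ∧ 1 < ‖y‖ := by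
  simp [outerShell]

theorem image_blowDown (n : ℕ) : blowDown '' outerShell n = N n \ {0} := by
  have hinv := blowDown_invOn n
  refine Subset.antisymm (blowDown_mapsTo n).image_subset fun x hx => ?_
  exact ⟨blowUp x, blowUp_mapsTo n hx, hinv.1 hx⟩

theorem injOn_blowDown (n : ℕ) : InjOn blowDown (outerShell n) := (blowDown_invOn n).2.injOn

theorem restrict_N_sdiff (n : ℕ) (hn : 1 ≤ n) :
    (volume : Measure (E n)).restrict (N n \ {0}) = volN n := by
  have : Nonempty (Fin n) := ⟨⟨0, hn⟩⟩
  exact Measure.restrict_congr_set (sdiff_null_ae_eq_self (measure_singleton _))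

theorem abs_det_blowDown {n : ℕ} (hn : 1 ≤ n) {y : E n} (hy : 1 < ‖y‖) :
    |(radialOp y 2 (tangFactor y)).det| = 2 * tangFactor y ^ (n - 1) := by
  have hs := tangFactor_pos hy
  rw [det_radialOp hn (ne_zero_of_one_lt hy) _ hs.ne', abs_of_pos (by positivity)]

/-- The change of variables `x = blowDown y`, with Jacobian `2 (tangFactor y)^(n-1)`. -/
theorem integral_comp_blowDown {n : ℕ} (hn : 1 ≤ n) (F : E n → ℝ) :
    ∫ y in outerShell n, 2 * tangFactor y ^ (n - 1) * F (blowDown y) = ∫ x in N n, F x := by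
  have h := integral_image_eq_integral_abs_det_fderiv_smul volume (measurableSet_outerShell n)
    (fun y hy => (hasFDerivAt_blowDown
      (ne_zero_of_one_lt (mem_outerShell.1 hy).2)).hasFDerivWithinAt) (injOn_blowDown n) F
  rw [image_blowDown, restrict_N_sdiff n hn] at h
  rw [h]
  refine setIntegral_congr_fun (measurableSet_outerShell n) fun y hy => ?_
  rw [abs_det_blowDown hn (mem_outerShell.1 hy).2, smul_eq_mul]

theorem lintegral_comp_blowDown {n : ℕ} (hn : 1 ≤ n) (F : E n → ℝ≥0∞) :
    ∫⁻ y in outerShell n, ENNReal.ofReal (2 * tangFactor y ^ (n - 1)) * F (blowDown y) =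
      ∫⁻ x in N n, F x := by
  have h := lintegral_image_eq_lintegral_abs_det_fderiv_mul volume (measurableSet_outerShell n)
    (fun y hy => (hasFDerivAt_blowDown
      (ne_zero_of_one_lt (mem_outerShell.1 hy).2)).hasFDerivWithinAt) (injOn_blowDown n) F
  rw [image_blowDown, restrict_N_sdiff n hn] at h
  rw [h]
  refine setLIntegral_congr_fun (measurableSet_outerShell n) fun y hy => ?_
  rw [abs_det_blowDown hn (mem_outerShell.1 hy).2]

theorem measurable_blowDown (n : ℕ) : Measurable (blowDown (n := n)) := by
  rw [blowDown_eq]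
  fun_prop

theorem measurable_blowUp (n : ℕ) : Measurable (blowUp (n := n)) := by
  rw [blowUp_eq]
  fun_prop

theorem quasiMeasurePreserving_blowDown {n : ℕ} (hn : 1 ≤ n) :
    Measure.QuasiMeasurePreserving blowDown (volume.restrict (outerShell n)) (volN n) := by
  refine ⟨measurable_blowDown n, Measure.AbsolutelyContinuous.mk fun A hA h0 => ?_⟩
  rw [Measure.map_apply (measurable_blowDown n) hA,
    Measure.restrict_apply (measurable_blowDown n hA)]
  rw [← restrict_N_sdiff n hn, Measure.restrict_apply hA] at h0
  have hsub : blowDown ⁻¹' A ∩ outerShell n ⊆ blowUp '' (A ∩ (N n \ {0})) := fun y hy =>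
    ⟨blowDown y, ⟨hy.1, blowDown_mapsTo n hy.2⟩, (blowDown_invOn n).2 hy.2⟩
  refine measure_mono_null hsub
    (addHaar_image_eq_zero_of_differentiableOn_of_addHaar_eq_zero volume (fun x hx => ?_) h0)
  exact (hasFDerivAt_blowUp hx.2.2).differentiableAt.differentiableWithinAt

theorem quasiMeasurePreserving_blowUp {n : ℕ} (hn : 1 ≤ n) :
    Measure.QuasiMeasurePreserving blowUp (volN n) (volume.restrict (outerShell n)) := by
  rw [← restrict_N_sdiff n hn]
  refine ⟨measurable_blowUp n, Measure.AbsolutelyContinuous.mk fun A hA h0 => ?_⟩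
  rw [Measure.map_apply (measurable_blowUp n) hA,
    Measure.restrict_apply (measurable_blowUp n hA)]
  rw [Measure.restrict_apply hA] at h0
  have hsub : blowUp ⁻¹' A ∩ (N n \ {0}) ⊆ blowDown '' (A ∩ outerShell n) := fun x hx =>
    ⟨blowUp x, ⟨hx.1, blowUp_mapsTo n hx.2⟩, (blowDown_invOn n).1 hx.2⟩
  refine measure_mono_null hsub
    (addHaar_image_eq_zero_of_differentiableOn_of_addHaar_eq_zero volume (fun y hy => ?_) h0)
  exact (hasFDerivAt_blowDown
    (ne_zero_of_one_lt (mem_outerShell.1 hy.2).2)).differentiableAt.differentiableWithinAt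

/-- The function `v ∘ blowDown` outside the cloaked ball, continued by the constant `c` into the
cloaked ball. -/
def pullFun {n : ℕ} {V : Type*} (v : E n → V) (c : V) (y : E n) : V :=
  if 1 < ‖y‖ then v (blowDown y) else c

/-- The gradient of `v ∘ blowDown`, for `G = ∇v`, continued by zero into the cloaked ball. -/
def pullGrad {n : ℕ} (G : E n → E n) (y : E n) : E n :=
  if 1 < ‖y‖ then radialOp y 2 (tangFactor y) (G (blowDown y)) else 0

/-- The push-forward conductivity transports currents: the pairing of the transformed current with
a field `W` is the pairing of the current `G` with the pull-back of `W`. -/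
theorem integral_flux_pullGrad {n : ℕ} (hn : 3 ≤ n) (g : E n → Matrix (Fin n) (Fin n) ℝ)
    (G W : E n → E n) :
    ∫ y in N n, inner ℝ (flux (conductivity (cloakMetric g)) (pullGrad G) y) (W y) =
      ∫ x in N n, inner ℝ (G x) (radialOp x (1 / 2) (1 / 2 + 1 * ‖x‖⁻¹) (W (blowUp x))) := by
  have hsub : outerShell n ⊆ N n := sdiff_subset
  trans ∫ y in outerShell n, inner ℝ (flux (conductivity (cloakMetric g)) (pullGrad G) y) (W y)
  · refine setIntegral_eq_of_subset_of_forall_sdiff_eq_zero (measurableSet_N n) hsub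
      fun y hy => ?_
    have hy1 : ¬ 1 < ‖y‖ := fun h => hy.2 (mem_outerShell.2 ⟨by simpa [N] using hy.1, h⟩)
    simp [flux, pullGrad, hy1]
  · rw [← integral_comp_blowDown (by omega)]
    refine setIntegral_congr_fun (measurableSet_outerShell n) fun y hy => ?_
    have hy1 := (mem_outerShell.1 hy).2
    have hy0 := ne_zero_of_one_lt hy1
    have hs := tangFactor_pos hy1
    have hup : blowUp (blowDown y) = y := (blowDown_invOn n).2 hy
    have hnorm : ‖blowDown y‖ = 2 * (‖y‖ - 1) := norm_blowDown hy1
    have hdown : blowDown y = tangFactor y • y := by rw [blowDown_eq]; rfl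
    have hb : 1 / 2 + 1 * ‖blowDown y‖⁻¹ = (tangFactor y)⁻¹ := by
      rw [hnorm, tangFactor]
      have h1 : ‖y‖ ≠ 0 := by linarith
      have h2 : ‖y‖ - 1 ≠ 0 := by linarith
      have h3 : (2 : ℝ) + -2 * ‖y‖⁻¹ = 2 * (‖y‖ - 1) / ‖y‖ := by field_simp; ring
      rw [h3]
      field_simp
      ring
    have hL : radialOp (blowDown y) (1 / 2) (1 / 2 + 1 * ‖blowDown y‖⁻¹) =
        radialOp y (1 / 2) (tangFactor y)⁻¹ := by
      rw [hb, hdown, radialOp_smul y hs.ne']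
    rw [flux_cloakMetric hn g _ hy1, pullGrad, if_pos hy1, hup, hL, ← inner_radialOp_left,
      radialOp_comp hy0, ← real_inner_smul_left]
    congr 1
    have e : ∀ c a b : ℝ, c • radialOp y a b (G (blowDown y)) =
        radialOp y (c * a) (c * b) (G (blowDown y)) := fun c a b => by
      rw [radialOp_apply, radialOp_apply, smul_add, smul_smul, smul_smul]
      congr 2
      ring
    rw [e]
    have hpow : tangFactor y ^ (n - 1) = tangFactor y ^ (n - 3) * tangFactor y ^ 2 := by
      rw [← pow_add]; congr 1; omega
    congr 2
    · ring
    · rw [hpow]; field_simp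

/-! ### Bounds for the singular conductivity -/

theorem volN_eq_restrict_union (n : ℕ) (hn : 1 ≤ n) :
    volN n = volume.restrict (Metric.ball (0 : E n) 1 ∪ outerShell n) := by
  have : Nonempty (Fin n) := ⟨⟨0, hn⟩⟩
  refine (Measure.restrict_congr_set ?_).symm
  have h0 : ∀ᵐ x : E n, x ∉ Metric.sphere (0 : E n) 1 :=
    measure_eq_zero_iff_ae_notMem.1 (Measure.addHaar_sphere _ _ _)
  rw [Filter.eventuallyEq_set]
  filter_upwards [h0] with x hx
  rw [mem_sphere_zero_iff_norm] at hx
  rw [mem_union, mem_outerShell, N, mem_ball_zero_iff, mem_ball_zero_iff]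
  constructor
  · rintro (h | h)
    · linarith
    · exact h.1
  · intro h
    rcases lt_or_gt_of_ne hx with h1 | h1
    · exact Or.inl h1
    · exact Or.inr ⟨h, h1⟩

theorem aemeasurable_det {n : ℕ} {μ : Measure (E n)} {A : E n → Matrix (Fin n) (Fin n) ℝ}
    (hA : ∀ i j, AEMeasurable (fun x => A x i j) μ) : AEMeasurable (fun x => (A x).det) μ := by
  simp only [Matrix.det_apply]
  refine Finset.aemeasurable_fun_sum _ fun τ _ => ?_
  exact (Finset.aemeasurable_fun_prod _ fun i _ => hA _ _).const_smul _

theorem aemeasurable_conductivity {n : ℕ} {μ : Measure (E n)}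
    {A : E n → Matrix (Fin n) (Fin n) ℝ}
    (hA : ∀ i j, AEMeasurable (fun x => A x i j) μ) (i j : Fin n) :
    AEMeasurable (fun x => conductivity A x i j) μ := by
  have hdet := aemeasurable_det hA
  have hadj : AEMeasurable (fun x => (A x).adjugate i j) μ := by
    simp only [Matrix.adjugate_apply]
    refine aemeasurable_det fun k l => ?_
    by_cases h : k = j
    · subst h
      simp
    · simpa [Matrix.updateRow_ne h] using hA k l
  have e : (fun x => conductivity A x i j) =
      fun x => Real.sqrt (A x).det * ((A x).det⁻¹ * (A x).adjugate i j) := by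
    funext x
    simp [conductivity, Matrix.inv_def]
  rw [e]
  exact hdet.sqrt.mul (hdet.inv.mul hadj)

theorem aestronglyMeasurable_flux {n : ℕ} {μ : Measure (E n)}
    {σ : E n → Matrix (Fin n) (Fin n) ℝ} {G : E n → E n}
    (hσ : ∀ i j, AEMeasurable (fun x => σ x i j) μ) (hG : AEStronglyMeasurable G μ) :
    AEStronglyMeasurable (flux σ G) μ := by
  have hGi : ∀ j, AEMeasurable (fun x => G x j) μ := fun j =>
    (EuclideanSpace.proj j : E n →L[ℝ] ℝ).continuous.measurable.comp_aemeasurable hG.aemeasurable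
  have h1 : AEMeasurable (fun x => (σ x) *ᵥ (G x).ofLp) μ := by
    refine aemeasurable_pi_lambda _ fun i => ?_
    simp only [Matrix.mulVec, dotProduct]
    exact Finset.aemeasurable_fun_sum _ fun j _ => (hσ i j).mul (hGi j)
  have e : flux σ G = fun x => (EuclideanSpace.equiv (Fin n) ℝ).symm ((σ x) *ᵥ (G x).ofLp) := by
    funext x
    rw [flux, Matrix.toLpLin_apply]
    rfl
  rw [e]
  exact ((EuclideanSpace.equiv (Fin n) ℝ).symm.continuous.measurable.comp_aemeasurable
    h1).aestronglyMeasurable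

/-- The conductivity of a regular metric is bounded and positive definite. -/
theorem IsRegularMetricOn.conductivity_bounds {n : ℕ} {Ω : Set (E n)}
    {g : E n → Matrix (Fin n) (Fin n) ℝ} (hg : IsRegularMetricOn Ω g) :
    ∃ K : ℝ, 0 ≤ K ∧ ∀ x ∈ Ω, ∀ ξ : E n,
      ‖Matrix.toEuclideanLin (conductivity g x) ξ‖ ≤ K * ‖ξ‖ ∧
      (ξ ≠ 0 → 0 < inner ℝ (Matrix.toEuclideanLin (conductivity g x) ξ) ξ) := by
  obtain ⟨c, C, hc, hb⟩ := hg.bounds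
  refine ⟨Real.sqrt (n.factorial * (|C| ^ n)) * c⁻¹, by positivity, fun x hx ξ => ?_⟩
  have hsymm := hg.symm x hx
  have hpd : (g x).PosDef := by
    refine Matrix.PosDef.of_dotProduct_mulVec_pos ?_ fun {η} hη => ?_
    · rw [Matrix.IsHermitian, Matrix.conjTranspose_eq_transpose_of_trivial]
      exact hsymm
    · rw [star_trivial]
      refine lt_of_lt_of_le (mul_pos hc ?_) (hb x hx η).1
      have h0 : 0 ≤ η ⬝ᵥ η := Finset.sum_nonneg fun i _ => mul_self_nonneg _
      exact h0.lt_of_ne' fun h => hη (dotProduct_self_eq_zero.1 h)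
  have hdet := hpd.det_pos
  have hu : IsUnit (g x).det := hdet.ne'.isUnit
  -- the entries of `g x` are controlled by polarization
  have hentry : ∀ i j, |g x i j| ≤ |C| := by
    intro i j
    have hq : ∀ a b : ℝ, (a • Pi.single i (1 : ℝ) + b • Pi.single j (1 : ℝ) : Fin n → ℝ) ⬝ᵥ
        (g x *ᵥ (a • Pi.single i (1 : ℝ) + b • Pi.single j (1 : ℝ))) =
        a ^ 2 * g x i i + 2 * a * b * g x i j + b ^ 2 * g x j j := by
      intro a b
      have hji : g x j i = g x i j := hsymm.apply i j
      simp only [Matrix.mulVec_add, Matrix.mulVec_smul, add_dotProduct, dotProduct_add,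
        smul_dotProduct, dotProduct_smul, Matrix.mulVec_single_one, single_one_dotProduct,
        Matrix.col_apply, smul_eq_mul, hji]
      ring
    have hd : ∀ a b : ℝ, (a • Pi.single i (1 : ℝ) + b • Pi.single j (1 : ℝ) : Fin n → ℝ) ⬝ᵥ
        (a • Pi.single i (1 : ℝ) + b • Pi.single j (1 : ℝ)) =
        a ^ 2 + 2 * a * b * (Pi.single j (1 : ℝ) : Fin n → ℝ) i + b ^ 2 := by
      intro a b
      have hji : (Pi.single i (1 : ℝ) : Fin n → ℝ) j = (Pi.single j (1 : ℝ) : Fin n → ℝ) i := by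
        by_cases h : i = j
        · subst h; rfl
        · rw [Pi.single_eq_of_ne h, Pi.single_eq_of_ne (Ne.symm h)]
      simp only [add_dotProduct, dotProduct_add, smul_dotProduct, dotProduct_smul,
        single_one_dotProduct, smul_eq_mul, hji, Pi.single_eq_same]
      ring
    have p1 := hb x hx (((1 / 2 : ℝ) • Pi.single i (1 : ℝ)) + (1 / 2 : ℝ) • Pi.single j (1 : ℝ))
    have p2 := hb x hx (((1 / 2 : ℝ) • Pi.single i (1 : ℝ)) + (-1 / 2 : ℝ) • Pi.single j (1 : ℝ))
    rw [hq, hd] at p1 p2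
    set t := (Pi.single j (1 : ℝ) : Fin n → ℝ) i with ht
    have ht1 : t = 0 ∨ t = 1 := by
      by_cases h : i = j
      · right; subst h; simp [ht]
      · left; simp [ht, Pi.single_eq_of_ne h]
    have hC := le_abs_self C
    have hC0 := abs_nonneg C
    rw [abs_le]
    rcases ht1 with h | h <;> rw [h] at p1 p2 <;> constructor <;> nlinarith [p1.1, p1.2, p2.1, p2.2]
  have hdet_le : (g x).det ≤ n.factorial * |C| ^ n := by
    have h := Matrix.det_le (A := g x) (abv := AbsoluteValue.abs) (x := |C|) hentry
    rw [Fintype.card_fin, nsmul_eq_mul] at h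
    exact (le_abs_self _).trans h
  set η : E n := Matrix.toEuclideanLin (g x)⁻¹ ξ with hη
  have hgη : g x *ᵥ η.ofLp = ξ.ofLp := by
    rw [hη, Matrix.toLpLin_apply, Matrix.mulVec_mulVec, Matrix.mul_nonsing_inv _ hu,
      Matrix.one_mulVec]
  have hcη : c * ‖η‖ ^ 2 ≤ inner ℝ η ξ := by
    have h := (hb x hx η.ofLp).1
    rwa [hgη, dotProduct_ofLp, dotProduct_ofLp, real_inner_self_eq_norm_sq] at h
  have hηle : ‖η‖ ≤ c⁻¹ * ‖ξ‖ := by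
    rw [inv_mul_eq_div, le_div_iff₀ hc]
    rcases (norm_nonneg η).eq_or_lt with h0 | h0
    · rw [← h0, zero_mul]; exact norm_nonneg _
    · have h := hcη.trans (real_inner_le_norm η ξ)
      nlinarith
  have hσ : Matrix.toEuclideanLin (conductivity g x) ξ = Real.sqrt (g x).det • η := by
    rw [conductivity, map_smul, LinearMap.smul_apply, hη]
  rw [hσ]
  constructor
  · rw [norm_smul, Real.norm_of_nonneg (Real.sqrt_nonneg _), mul_assoc]
    gcongr
  · intro hξ
    rw [real_inner_smul_left]
    refine mul_pos (Real.sqrt_pos.2 hdet) (lt_of_lt_of_le ?_ hcη)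
    have hη0 : η ≠ 0 := by
      intro h0
      rw [h0] at hgη
      apply hξ
      ext i
      rw [← hgη]
      simp
    have := norm_pos_iff.2 hη0
    positivity

theorem conductivity_cloakMetric_ball {n : ℕ} (g : E n → Matrix (Fin n) (Fin n) ℝ)
    {x : E n} (hx : ‖x‖ < 1) : conductivity (cloakMetric g) x = conductivity g x := by
  rw [conductivity, conductivity, cloakMetric, if_neg hx.le.not_gt]

/-- The singular conductivity is bounded, and positive definite off the unit sphere. -/
theorem isAdmissible_cloakMetric {n : ℕ} (hn : 3 ≤ n) {g : E n → Matrix (Fin n) (Fin n) ℝ}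
    (hg : IsRegularMetricOn (Metric.ball (0 : E n) 1) g) :
    IsAdmissible (conductivity (cloakMetric g)) := by
  obtain ⟨K, hK, hb⟩ := hg.conductivity_bounds
  have hae : ∀ᵐ x ∂(volN n), x ∈ Metric.ball (0 : E n) 1 ∪ outerShell n := by
    rw [volN_eq_restrict_union n (by omega)]
    exact ae_restrict_mem (measurableSet_ball.union (measurableSet_outerShell n))
  refine ⟨fun G hG => ?_, ?_⟩
  · have hsub1 : Metric.ball (0 : E n) 1 ⊆ N n := Metric.ball_subset_ball (by norm_num)
    have hsub2 : outerShell n ⊆ N n := sdiff_subset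
    have hmeas : AEStronglyMeasurable (flux (conductivity (cloakMetric g)) G) (volN n) := by
      rw [volN_eq_restrict_union n (by omega), aestronglyMeasurable_union_iff]
      constructor
      · have e : flux (conductivity g) G =ᵐ[volume.restrict (Metric.ball (0 : E n) 1)]
            flux (conductivity (cloakMetric g)) G := by
          filter_upwards [ae_restrict_mem measurableSet_ball] with x hx
          rw [flux, flux, conductivity_cloakMetric_ball g (by simpa using hx)]
        refine AEStronglyMeasurable.congr ?_ e
        refine aestronglyMeasurable_flux (fun i j => ?_) (hG.1.mono_measure
          (Measure.restrict_mono hsub1 le_rfl))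
        refine aemeasurable_conductivity (fun k l => ?_) i j
        exact (hg.smooth k l).continuousOn.aemeasurable measurableSet_ball
      · have hG2 : AEStronglyMeasurable G (volume.restrict (outerShell n)) :=
          hG.1.mono_measure (Measure.restrict_mono hsub2 le_rfl)
        have hs : Measurable (tangFactor (n := n)) := by unfold tangFactor; fun_prop
        have e : (fun y => (2 * tangFactor y ^ (n - 3)) • G y +
            ((tangFactor y ^ (n - 1) / 2 - 2 * tangFactor y ^ (n - 3)) / ‖y‖ ^ 2 *
              inner ℝ y (G y)) • y) =ᵐ[volume.restrict (outerShell n)]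
            flux (conductivity (cloakMetric g)) G := by
          filter_upwards [ae_restrict_mem (measurableSet_outerShell n)] with y hy
          rw [flux_cloakMetric hn g G (mem_outerShell.1 hy).2, radialOp_apply]
        refine AEStronglyMeasurable.congr ?_ e
        have m1 : Measurable fun y : E n => (tangFactor y ^ (n - 1) / 2 -
            2 * tangFactor y ^ (n - 3)) / ‖y‖ ^ 2 := by fun_prop
        have m2 : AEStronglyMeasurable (fun y : E n => y) (volume.restrict (outerShell n)) :=
          measurable_id.aestronglyMeasurable
        exact (((hs.pow_const _).const_mul _).aestronglyMeasurable.smul hG2).add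
          ((m1.aestronglyMeasurable.mul (m2.inner hG2)).smul m2)
    refine MemLp.of_le_mul hG hmeas (c := K + 6) ?_
    filter_upwards [hae] with x hx
    rcases hx with hx | hx
    · rw [flux, conductivity_cloakMetric_ball g (by simpa using hx)]
      refine (hb x hx (G x)).1.trans ?_
      gcongr
      linarith
    · obtain ⟨hx2, hx1⟩ := mem_outerShell.1 hx
      rw [flux_cloakMetric hn g G hx1]
      refine (norm_radialOp_le _ _ _ _).trans ?_
      have h0 := (tangFactor_pos hx1).le
      have h1 := tangFactor_le_one hx1 hx2.le
      have p1 := pow_le_one₀ h0 h1 (n := n - 1)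
      have p2 := pow_le_one₀ h0 h1 (n := n - 3)
      have q1 := pow_nonneg h0 (n - 1)
      have q2 := pow_nonneg h0 (n - 3)
      refine mul_le_mul_of_nonneg_right ?_ (norm_nonneg _)
      rw [abs_of_nonneg (by positivity)]
      have : |tangFactor x ^ (n - 1) / 2 - 2 * tangFactor x ^ (n - 3)| ≤ 3 := by
        rw [abs_le]; constructor <;> linarith
      linarith
  · filter_upwards [hae] with x hx ξ hξ
    rcases hx with hx | hx
    · rw [conductivity_cloakMetric_ball g (by simpa using hx)]
      exact (hb x hx ξ).2 hξ
    · obtain ⟨hx2, hx1⟩ := mem_outerShell.1 hx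
      rw [conductivity_cloakMetric hn g hx1, toEuclideanLin_radialMatrix]
      have h0 := tangFactor_pos hx1
      exact inner_radialOp_pos (ne_zero_of_one_lt hx1) (by positivity) (by positivity) hξ

/-! ### Transformation of functions with trace -/

theorem hasGradientAt_comp_of_symm {n : ℕ} {ζ : E n → ℝ} {Z : E n} {F : E n → E n} {y w : E n}
    {a b : ℝ} (hζ : HasGradientAt ζ Z (F y)) (hF : HasFDerivAt F (radialOp w a b) y) :
    HasGradientAt (fun y => ζ (F y)) (radialOp w a b Z) y := by
  rw [hasGradientAt_iff_hasFDerivAt] at *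
  refine (hζ.comp y hF).congr_fderiv ?_
  ext1 ξ
  simp [InnerProductSpace.toDual_apply_apply, inner_radialOp_left]

theorem hasGradientAt_comp_blowDown {n : ℕ} {ζ : E n → ℝ} (hζ : ContDiff ℝ ∞ ζ) {y : E n}
    (hy : y ≠ 0) : HasGradientAt (fun y => ζ (blowDown y))
      (radialOp y 2 (tangFactor y) (∇ ζ (blowDown y))) y :=
  hasGradientAt_comp_of_symm (hasGradientAt_of_contDiff hζ _) (hasFDerivAt_blowDown hy)

theorem hasGradientAt_of_eventually_const {n : ℕ} {f : E n → ℝ} {y : E n} {c : ℝ}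
    (h : f =ᶠ[𝓝 y] fun _ => c) : HasGradientAt f 0 y :=
  (hasGradientAt_const y c).congr_of_eventuallyEq h

/-- Smooth functions that vanish near the origin are transformed into smooth functions. -/
theorem pullFun_smooth {n : ℕ} {ζ : E n → ℝ} (hζ : ContDiff ℝ ∞ ζ) {ρ : ℝ} (hρ : 0 < ρ)
    (h0 : ∀ x, ‖x‖ < ρ → ζ x = 0) :
    ContDiff ℝ ∞ (pullFun ζ 0) ∧ ∇ (pullFun ζ 0) = pullGrad (∇ ζ) := by
  have hout : ∀ y : E n, 1 < ‖y‖ → pullFun ζ 0 =ᶠ[𝓝 y] fun y => ζ (blowDown y) := fun y hy => by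
    filter_upwards [continuous_norm.continuousAt.eventually (lt_mem_nhds hy)] with z hz
    rw [pullFun, if_pos hz]
  have hin : ∀ y : E n, ‖y‖ ≤ 1 → pullFun ζ 0 =ᶠ[𝓝 y] fun _ => 0 := fun y hy => by
    filter_upwards [continuous_norm.continuousAt.eventually
      (gt_mem_nhds (show ‖y‖ < 1 + ρ / 2 by linarith))] with z hz
    rw [pullFun]
    split_ifs with h
    · exact h0 _ (by rw [norm_blowDown h]; linarith)
    · rfl
  refine ⟨contDiff_iff_contDiffAt.2 fun y => ?_, funext fun y => ?_⟩
  · rcases lt_or_ge 1 ‖y‖ with hy | hy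
    · exact (hζ.contDiffAt.comp y (contDiffAt_blowDown (ne_zero_of_one_lt hy))).congr_of_eventuallyEq
        (hout y hy)
    · exact contDiffAt_const.congr_of_eventuallyEq (hin y hy)
  · rcases lt_or_ge 1 ‖y‖ with hy | hy
    · rw [pullGrad, if_pos hy]
      exact ((hasGradientAt_comp_blowDown hζ (ne_zero_of_one_lt hy)).congr_of_eventuallyEq
        (hout y hy)).gradient
    · rw [pullGrad, if_neg (not_lt.2 hy)]
      exact (hasGradientAt_of_eventually_const (hin y hy)).gradient

/-- Smooth functions that vanish near the cloaked ball are transformed back into smooth functions. -/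
theorem comp_blowUp_smooth {n : ℕ} {ζ : E n → ℝ} (hζ : ContDiff ℝ ∞ ζ) {ρ : ℝ} (hρ : 1 < ρ)
    (h0 : ∀ y, ‖y‖ < ρ → ζ y = 0) :
    ContDiff ℝ ∞ (fun x => ζ (blowUp x)) ∧ ∀ x, x ≠ 0 → ∇ (fun x => ζ (blowUp x)) x =
      radialOp x (1 / 2) (1 / 2 + 1 * ‖x‖⁻¹) (∇ ζ (blowUp x)) := by
  refine ⟨contDiff_iff_contDiffAt.2 fun x => ?_, fun x hx =>
    (hasGradientAt_comp_of_symm (hasGradientAt_of_contDiff hζ _) (hasFDerivAt_blowUp hx)).gradient⟩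
  rcases eq_or_ne x 0 with rfl | hx
  · have : (fun x => ζ (blowUp x)) =ᶠ[𝓝 (0 : E n)] fun _ => 0 := by
      filter_upwards [Metric.ball_mem_nhds (0 : E n) (show 0 < 2 * (ρ - 1) by linarith)] with z hz
      rw [mem_ball_zero_iff] at hz
      refine h0 _ ?_
      rcases eq_or_ne z 0 with rfl | hz0
      · simp only [blowUp, smul_zero, norm_zero]; linarith
      · rw [norm_blowUp hz0]; linarith
    exact contDiffAt_const.congr_of_eventuallyEq this
  · exact hζ.contDiffAt.comp x (contDiffAt_blowUp hx)

theorem tangFactor_eq {n : ℕ} {y : E n} (hy : 1 < ‖y‖) : tangFactor y = 2 * (‖y‖ - 1) / ‖y‖ := by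
  have : ‖y‖ ≠ 0 := by linarith
  rw [tangFactor]
  field_simp
  ring

theorem aestronglyMeasurable_pullFun {n : ℕ} (hn : 1 ≤ n) {V : Type*} [NormedAddCommGroup V]
    {F : E n → V} (hF : AEStronglyMeasurable F (volN n)) :
    AEStronglyMeasurable (pullFun F 0) (volN n) := by
  have h1 := hF.comp_quasiMeasurePreserving (quasiMeasurePreserving_blowDown hn)
  have hsub : outerShell n ⊆ N n := sdiff_subset
  have h2 : AEStronglyMeasurable ((outerShell n).indicator (F ∘ blowDown)) (volN n) := by
    rw [aestronglyMeasurable_indicator_iff (measurableSet_outerShell n),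
      Measure.restrict_restrict (measurableSet_outerShell n), inter_eq_self_of_subset_left hsub]
    exact h1
  refine h2.congr ?_
  filter_upwards [ae_restrict_mem (measurableSet_N n)] with y hy
  have hy2 : ‖y‖ < 2 := by simpa [N] using hy
  rw [pullFun]
  split_ifs with h
  · rw [indicator_of_mem (mem_outerShell.2 ⟨hy2, h⟩)]; rfl
  · rw [indicator_of_notMem (fun h' => h (mem_outerShell.1 h').2)]

/-- Away from the origin the transformation is bounded in `L²`. -/
theorem eLpNorm_pullFun_le {n : ℕ} (hn : 1 ≤ n) {V : Type*} [NormedAddCommGroup V]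
    {F : E n → V} (h0 : ∀ x, ‖x‖ < 1 / 2 → F x = 0) :
    eLpNorm (pullFun F 0) 2 (volN n) ≤ 2 ^ (n - 1) * eLpNorm F 2 (volN n) := by
  rw [← ENNReal.pow_le_pow_left_iff two_ne_zero, mul_pow, eLpNorm_two_sq, eLpNorm_two_sq,
    ← pow_mul, mul_comm (n - 1), pow_mul,
    ← lintegral_comp_blowDown hn (fun x => ‖F x‖ₑ ^ 2), ← lintegral_const_mul' _ _ (by norm_num),
    ← lintegral_indicator (measurableSet_outerShell n), ← lintegral_indicator (measurableSet_N n)]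
  refine lintegral_mono fun y => ?_
  by_cases hy : y ∈ outerShell n
  · obtain ⟨hy2, hy1⟩ := mem_outerShell.1 hy
    have hyN : y ∈ N n := sdiff_subset hy
    rw [indicator_of_mem hy, indicator_of_mem hyN, pullFun, if_pos hy1]
    by_cases hF : ‖blowDown y‖ < 1 / 2
    · rw [h0 _ hF]; simp
    · rw [norm_blowDown hy1, not_lt] at hF
      -- here the Jacobian is bounded from below
      have hs : 1 / 4 ≤ tangFactor y := by
        rw [tangFactor_eq hy1, le_div_iff₀ (by linarith)]
        nlinarith
      rw [← mul_assoc]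
      refine le_mul_of_one_le_left' ?_
      have e : ((2 : ℝ≥0∞) ^ 2) ^ (n - 1) = ENNReal.ofReal (4 ^ (n - 1)) := by
        rw [ENNReal.ofReal_pow (by norm_num), ENNReal.ofReal_ofNat]
        norm_num
      rw [e, ← ENNReal.ofReal_mul (by positivity), ENNReal.one_le_ofReal]
      have h4 : 1 ≤ (4 * tangFactor y) ^ (n - 1) := one_le_pow₀ (by linarith)
      rw [mul_pow] at h4
      linarith
  · rw [indicator_of_notMem hy]
    by_cases hyN : y ∈ N n
    · have hy1 : ¬ 1 < ‖y‖ := fun h => hy (mem_outerShell.2 ⟨by simpa [N] using hyN, h⟩)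
      rw [indicator_of_mem hyN, pullFun, if_neg hy1]
      simp
    · rw [indicator_of_notMem hyN]

theorem norm_pullGrad_le {n : ℕ} (F : E n → E n) {y : E n} (hy : y ∈ N n) :
    ‖pullGrad F y‖ ≤ 2 * ‖pullFun F 0 y‖ := by
  rw [pullGrad, pullFun]
  split_ifs with h
  · refine (norm_radialOp_le _ _ _ _).trans ?_
    have h2 : ‖y‖ < 2 := by simpa [N] using hy
    have h0 := tangFactor_pos h
    have h1 := tangFactor_le_one h h2.le
    gcongr
    rw [abs_of_pos h0, abs_of_pos (by linarith)]
    linarith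
  · simp

theorem pullGrad_add {n : ℕ} (F H : E n → E n) : pullGrad (F + H) = pullGrad F + pullGrad H := by
  funext y
  simp only [pullGrad, Pi.add_apply]
  split_ifs <;> simp

theorem pullGrad_sub {n : ℕ} (F H : E n → E n) : pullGrad (F - H) = pullGrad F - pullGrad H := by
  funext y
  simp only [pullGrad, Pi.sub_apply]
  split_ifs <;> simp

theorem aestronglyMeasurable_pullGrad {n : ℕ} (hn : 1 ≤ n) {F : E n → E n}
    (hF : AEStronglyMeasurable F (volN n)) : AEStronglyMeasurable (pullGrad F) (volN n) := by
  have h := aestronglyMeasurable_pullFun hn hF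
  have hs : Measurable (tangFactor (n := n)) := by unfold tangFactor; fun_prop
  have e : pullGrad F = fun y => tangFactor y • pullFun F 0 y +
      ((2 - tangFactor y) / ‖y‖ ^ 2 * inner ℝ y (pullFun F 0 y)) • y := by
    funext y
    rw [pullGrad, pullFun]
    split_ifs
    · rw [radialOp_apply]
    · simp
  rw [e]
  have m1 : Measurable fun y : E n => (2 - tangFactor y) / ‖y‖ ^ 2 := by fun_prop
  have m2 : AEStronglyMeasurable (fun y : E n => y) (volN n) := measurable_id.aestronglyMeasurable
  exact (hs.aestronglyMeasurable.smul h).add ((m1.aestronglyMeasurable.mul (m2.inner h)).smul m2)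

theorem eLpNorm_pullGrad_le {n : ℕ} (hn : 1 ≤ n) {F : E n → E n}
    (h0 : ∀ x, ‖x‖ < 1 / 2 → F x = 0) :
    eLpNorm (pullGrad F) 2 (volN n) ≤ 2 * 2 ^ (n - 1) * eLpNorm F 2 (volN n) := by
  have h : eLpNorm (pullGrad F) 2 (volN n) ≤ ENNReal.ofReal 2 * eLpNorm (pullFun F 0) 2 (volN n) := by
    refine eLpNorm_le_mul_eLpNorm_of_ae_le_mul ?_ 2
    filter_upwards [ae_restrict_mem (measurableSet_N n)] with y hy
    exact norm_pullGrad_le F hy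
  rw [ENNReal.ofReal_ofNat] at h
  refine h.trans ?_
  rw [mul_assoc]
  gcongr
  exact eLpNorm_pullFun_le hn h0

theorem blowDown_eq_self {n : ℕ} {y : E n} (hy : ‖y‖ = 2) : blowDown y = y := by
  rw [blowDown, hy, smul_smul]
  norm_num

theorem blowUp_eq_self {n : ℕ} {y : E n} (hy : ‖y‖ = 2) : blowUp y = y := by
  rw [blowUp, hy, smul_smul]
  norm_num

/-- The transformation of a function with trace that is cut off near the origin. -/
theorem HasTrace.pull_of_cutoff {n : ℕ} (hn : 1 ≤ n) {v : E n → ℝ} {G : E n → E n}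
    {f : BoundaryL2 n} (hv : HasTrace v G f) {χ : E n → ℝ} (hχ : ContDiff ℝ ∞ χ)
    (hχ1 : ∀ x, |χ x| ≤ 1) (hχ0 : ∀ x, ‖x‖ < 3 / 5 → χ x = 0) (hχ2 : ∀ x, ‖x‖ = 2 → χ x = 1) :
    HasTrace (pullFun (fun x => χ x * v x) 0)
      (pullGrad fun x => χ x • G x + v x • ∇ χ x) f := by
  obtain ⟨C, hC⟩ := (isCompact_closedBall (0 : E n) 2).exists_bound_of_continuousOn
    (continuous_gradient hχ).continuousOn
  have hgχ0 : ∀ x, ‖x‖ < 1 / 2 → ∇ χ x = 0 := fun x hx => by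
    refine (hasGradientAt_of_eventually_const (c := 0) ?_).gradient
    filter_upwards [continuous_norm.continuousAt.eventually
      (gt_mem_nhds (show ‖x‖ < 3 / 5 by linarith))] with z hz
    exact hχ0 z hz
  have mχ : AEStronglyMeasurable χ (volN n) := hχ.continuous.aestronglyMeasurable
  have mgχ : AEStronglyMeasurable (∇ χ) (volN n) := (continuous_gradient hχ).aestronglyMeasurable
  -- the bounds for products with the cutoff function
  have b1 : ∀ {V : Type} [NormedAddCommGroup V] [NormedSpace ℝ V] (F : E n → V),
      eLpNorm (fun x => χ x • F x) 2 (volN n) ≤ eLpNorm F 2 (volN n) := fun F =>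
    eLpNorm_mono fun x => by
      rw [norm_smul]; exact mul_le_of_le_one_left (norm_nonneg _) (hχ1 x)
  have b2 : ∀ F : E n → ℝ, eLpNorm (fun x => F x • ∇ χ x) 2 (volN n) ≤
      ENNReal.ofReal C * eLpNorm F 2 (volN n) := fun F => by
    refine eLpNorm_le_mul_eLpNorm_of_ae_le_mul ?_ 2
    filter_upwards [ae_restrict_mem (measurableSet_N n)] with x hx
    rw [norm_smul, mul_comm]
    gcongr
    exact hC x (Metric.ball_subset_closedBall hx)
  have b3 : ∀ (F : E n → ℝ) (H : E n → E n), AEStronglyMeasurable F (volN n) →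
      AEStronglyMeasurable H (volN n) →
      eLpNorm (pullGrad fun x => χ x • H x + F x • ∇ χ x) 2 (volN n) ≤
        2 * 2 ^ (n - 1) * (eLpNorm H 2 (volN n) + ENNReal.ofReal C * eLpNorm F 2 (volN n)) := by
    intro F H hF hH
    refine (eLpNorm_pullGrad_le hn fun x hx => ?_).trans ?_
    · rw [hgχ0 x hx, hχ0 x (by linarith)]; simp
    · gcongr
      exact (eLpNorm_add_le (mχ.smul hH) (hF.smul mgχ) (by norm_num)).trans
        (add_le_add (b1 H) (b2 F))
  have b4 : ∀ F : E n → ℝ, eLpNorm (pullFun (fun x => χ x * F x) 0) 2 (volN n) ≤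
      2 ^ (n - 1) * eLpNorm F 2 (volN n) := fun F => by
    refine (eLpNorm_pullFun_le hn fun x hx => ?_).trans ?_
    · rw [hχ0 x (by linarith), zero_mul]
    · gcongr
      exact b1 F
  have mv := hv.1.memLp
  have mG := hv.1.memLp_grad
  have mu : MemLp (pullFun (fun x => χ x * v x) 0) 2 (volN n) :=
    ⟨aestronglyMeasurable_pullFun hn (mχ.mul mv.1),
      (b4 v).trans_lt (ENNReal.mul_lt_top (by simp) mv.2)⟩
  have mH : MemLp (pullGrad fun x => χ x • G x + v x • ∇ χ x) 2 (volN n) :=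
    ⟨aestronglyMeasurable_pullGrad hn ((mχ.smul mG.1).add (mv.1.smul mgχ)),
      (b3 v G mv.1 mG.1).trans_lt (ENNReal.mul_lt_top (ENNReal.mul_lt_top (by simp) (by simp))
        (ENNReal.add_lt_top.2 ⟨mG.2, ENNReal.mul_lt_top ENNReal.ofReal_lt_top mv.2⟩))⟩
  refine hasTrace_of_approx mu mH fun ε hε => ?_
  set K : ℝ≥0∞ := 2 * 2 ^ (n - 1) * (1 + ENNReal.ofReal C) with hK
  have h1p : (1 : ℝ≥0∞) ≤ 2 ^ (n - 1) := one_le_pow₀ (by norm_num)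
  have hKt : K ≠ ⊤ := ENNReal.mul_ne_top (ENNReal.mul_ne_top (by simp) (by simp))
    (ENNReal.add_ne_top.2 ⟨by simp, ENNReal.ofReal_ne_top⟩)
  have hpK : 2 ^ (n - 1) ≤ K := by
    rw [hK]
    calc (2 : ℝ≥0∞) ^ (n - 1) = 1 * 2 ^ (n - 1) * 1 := by ring
      _ ≤ 2 * 2 ^ (n - 1) * (1 + ENNReal.ofReal C) := by
        gcongr
        · norm_num
        · exact le_self_add
  have hK0 : K ≠ 0 := (zero_lt_one.trans_le (h1p.trans hpK)).ne'
  have hεK : K * (ε / K) = ε := ENNReal.mul_div_cancel hK0 hKt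
  obtain ⟨φ, hφ, h1, h2, h3⟩ := hv.exists_approx (ENNReal.div_ne_zero.2 ⟨hε, hKt⟩ : ε / K ≠ 0)
  have mφ : AEStronglyMeasurable φ (volN n) := hφ.continuous.aestronglyMeasurable
  have mgφ : AEStronglyMeasurable (∇ φ) (volN n) := (continuous_gradient hφ).aestronglyMeasurable
  obtain ⟨hs, hg⟩ := pullFun_smooth (hχ.mul hφ) (ρ := 3 / 5) (by norm_num)
    (fun x hx => by simp [hχ0 x hx])
  have hgr : ∇ (fun x => χ x * φ x) = fun x => χ x • ∇ φ x + φ x • ∇ χ x :=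
    funext fun x => gradient_mul hχ hφ x
  refine ⟨_, hs, ?_, ?_, ?_⟩
  · have e : pullFun (fun x => χ x * φ x) 0 - pullFun (fun x => χ x * v x) 0 =
        pullFun (fun x => χ x * (φ - v) x) 0 := by
      funext y
      simp only [pullFun, Pi.sub_apply]
      split_ifs <;> ring
    rw [e]
    calc _ ≤ 2 ^ (n - 1) * (ε / K) := (b4 _).trans (by gcongr)
      _ ≤ K * (ε / K) := by gcongr
      _ = ε := hεK
  · rw [hg, hgr, ← pullGrad_sub]
    have e : ((fun x => χ x • ∇ φ x + φ x • ∇ χ x) - fun x => χ x • G x + v x • ∇ χ x) =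
        fun x => χ x • (∇ φ - G) x + (φ - v) x • ∇ χ x := by
      funext x
      simp only [Pi.sub_apply, smul_sub, sub_smul]
      abel
    rw [e]
    calc _ ≤ 2 * 2 ^ (n - 1) * (ε / K + ENNReal.ofReal C * (ε / K)) :=
          (b3 _ _ (mφ.sub mv.1) (mgφ.sub mG.1)).trans (by gcongr)
      _ = K * (ε / K) := by rw [hK]; ring
      _ = ε := hεK
  · have e : pullFun (fun x => χ x * φ x) 0 - ⇑f =ᵐ[surfaceMeasure n] φ - ⇑f := by
      filter_upwards [surfaceMeasure_ae_norm] with x hx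
      rw [Pi.sub_apply, Pi.sub_apply, pullFun, if_pos (by rw [hx]; norm_num), blowDown_eq_self hx,
        hχ2 x hx, one_mul]
    rw [eLpNorm_congr_ae e]
    refine h3.trans (ENNReal.div_le_of_le_mul (le_mul_of_one_le_right' (h1p.trans hpK)))

/-- The cutoff functions that vanish for `|y|² ≤ 1 + ε` and equal one for `|y|² ≥ 1 + 2ε`. -/
def outerCutoff {n : ℕ} (ε : ℝ) : E n → ℝ := cutoff (1 / ε) (-1 / ε - 1)

theorem outerCutoff_arg {n : ℕ} (ε : ℝ) (y : E n) :
    1 / ε * ‖y‖ ^ 2 + (-1 / ε - 1) = (‖y‖ ^ 2 - 1) / ε - 1 := by ring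

theorem outerCutoff_eq_zero {n : ℕ} {ε : ℝ} (hε : 0 < ε) {y : E n} (hy : ‖y‖ ^ 2 ≤ 1 + ε) :
    outerCutoff ε y = 0 := by
  refine cutoff_eq_zero ?_
  rw [outerCutoff_arg, sub_nonpos, div_le_one hε]
  linarith

theorem outerCutoff_eq_one {n : ℕ} {ε : ℝ} (hε : 0 < ε) {y : E n} (hy : 1 + 2 * ε ≤ ‖y‖ ^ 2) :
    outerCutoff ε y = 1 := by
  refine cutoff_eq_one ?_
  rw [outerCutoff_arg, le_sub_iff_add_le, le_div_iff₀ hε]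
  linarith

theorem gradient_outerCutoff {n : ℕ} (ε : ℝ) (y : E n) : ∇ (outerCutoff ε) y =
    (deriv Real.smoothTransition ((‖y‖ ^ 2 - 1) / ε - 1) * (2 / ε)) • y := by
  rw [outerCutoff, gradient_cutoff, outerCutoff_arg]
  congr 2
  ring

theorem gradient_outerCutoff_eq_zero {n : ℕ} {ε : ℝ} (hε : 0 < ε) {y : E n}
    (hy : 1 + 2 * ε < ‖y‖ ^ 2) : ∇ (outerCutoff ε) y = 0 := by
  rw [gradient_outerCutoff, deriv_smoothTransition_of_gt, zero_mul, zero_smul]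
  rw [lt_sub_iff_add_lt, lt_div_iff₀ hε]
  linarith

/-- For every `y` outside the closed unit ball, the cutoff functions for `ε = 1/(k+1)` are
eventually one near `y`. -/
theorem eventually_outerCutoff {n : ℕ} {y : E n} (hy : 1 < ‖y‖) :
    ∀ᶠ k : ℕ in atTop, 1 + 2 * (1 / ((k : ℝ) + 1)) < ‖y‖ ^ 2 := by
  have h : 0 < (‖y‖ ^ 2 - 1) / 2 := by nlinarith
  filter_upwards [tendsto_one_div_add_atTop_nhds_zero_nat.eventually (gt_mem_nhds h)] with k hk
  linarith

/-- The transformation of a smooth function that is supported in the unit ball: the result is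
Lipschitz continuous, and constant in the cloaked ball. -/
theorem hasTrace_pull_of_contDiff {n : ℕ} {V : E n → ℝ} (hV : ContDiff ℝ ∞ V)
    (hV0 : ∀ x, 1 ≤ ‖x‖ → V x = 0) :
    HasTrace (pullFun V (V 0)) (pullGrad (∇ V)) 0 := by
  have hVc : HasCompactSupport V := by
    refine HasCompactSupport.intro (isCompact_closedBall (0 : E n) 1) fun x hx => hV0 x ?_
    rw [mem_closedBall_zero_iff, not_le] at hx
    exact hx.le
  obtain ⟨B, hB⟩ := hVc.exists_bound_of_continuous hV.continuous
  obtain ⟨B', hB'⟩ := (hasCompactSupport_gradient hVc).exists_bound_of_continuous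
    (continuous_gradient hV)
  obtain ⟨L, hL⟩ := ContDiff.lipschitzWith_of_hasCompactSupport hVc (hV.of_le (by simp))
    (one_ne_zero)
  obtain ⟨M, hM, hSM⟩ := exists_deriv_smoothTransition_bound
  set e : ℕ → ℝ := fun k => 1 / ((k : ℝ) + 1) with he
  have he0 : ∀ k, 0 < e k := fun k => by simp only [he]; positivity
  have he1 : ∀ k, e k ≤ 1 := fun k => by
    simp only [he]
    rw [div_le_one (by positivity)]
    simp
  set d : E n → ℝ := fun y => V (blowDown y) - V 0 with hd
  have hds : ∀ y : E n, y ≠ 0 → ContDiffAt ℝ ∞ d y := fun y hy =>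
    (hV.contDiffAt.comp y (contDiffAt_blowDown hy)).sub contDiffAt_const
  have hdg : ∀ y : E n, y ≠ 0 →
      HasGradientAt d (radialOp y 2 (tangFactor y) (∇ V (blowDown y))) y := fun y hy => by
    have h := (hasGradientAt_comp_blowDown hV hy).hasFDerivAt.sub_const (V 0)
    exact hasGradientAt_iff_hasFDerivAt.2 h
  set U : ℕ → E n → ℝ := fun k y => V 0 + outerCutoff (e k) y * d y with hU
  have hin : ∀ k (y : E n), ‖y‖ ≤ 1 → U k =ᶠ[𝓝 y] fun _ => V 0 := fun k y hy => by
    have hlt : ‖y‖ ^ 2 < 1 + e k := by nlinarith [he0 k, norm_nonneg y]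
    have hc : ContinuousAt (fun z : E n => ‖z‖ ^ 2) y := (continuous_norm.pow 2).continuousAt
    filter_upwards [hc.eventually (gt_mem_nhds hlt)] with z hz
    simp only [hU]
    rw [outerCutoff_eq_zero (he0 k) hz.le, zero_mul, add_zero]
  have hκs : ∀ k, ContDiff ℝ ∞ (outerCutoff (n := n) (e k)) := fun k => contDiff_cutoff _ _
  have hUs : ∀ k, ContDiff ℝ ∞ (U k) := fun k => contDiff_iff_contDiffAt.2 fun y => by
    rcases lt_or_ge 1 ‖y‖ with hy | hy
    · exact contDiffAt_const.add ((hκs k).contDiffAt.mul (hds y (ne_zero_of_one_lt hy)))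
    · exact contDiffAt_const.congr_of_eventuallyEq (hin k y hy)
  have hUg : ∀ k (y : E n), 1 < ‖y‖ → ∇ (U k) y = outerCutoff (e k) y •
      radialOp y 2 (tangFactor y) (∇ V (blowDown y)) + d y • ∇ (outerCutoff (e k)) y := by
    intro k y hy
    have h := hasGradientAt_mul (hasGradientAt_of_contDiff (hκs k) y)
      (hdg y (ne_zero_of_one_lt hy))
    have h2 := h.hasFDerivAt.const_add (V 0)
    exact (hasGradientAt_iff_hasFDerivAt.2 h2).gradient
  have hUg0 : ∀ k (y : E n), ‖y‖ ≤ 1 → ∇ (U k) y = 0 := fun k y hy =>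
    (hasGradientAt_of_eventually_const (hin k y hy)).gradient
  have hκ1 : ∀ k (y : E n), |outerCutoff (e k) y| ≤ 1 := fun k y => by
    exact (abs_of_nonneg (cutoff_nonneg _ _ _)).trans_le (cutoff_le_one _ _ _)
  have hB0 : 0 ≤ B := (norm_nonneg _).trans (hB 0)
  have hB0' : 0 ≤ B' := (norm_nonneg _).trans (hB' 0)
  have hUb : ∀ k y, ‖U k y‖ ≤ 3 * B := fun k y => by
    have h1 : ‖d y‖ ≤ 2 * B := by
      refine (norm_sub_le _ _).trans ?_
      linarith [hB (blowDown y), hB 0]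
    calc ‖U k y‖ ≤ ‖V 0‖ + ‖outerCutoff (e k) y * d y‖ := norm_add_le _ _
      _ ≤ B + 1 * (2 * B) := by
        rw [norm_mul]
        gcongr
        · exact hB 0
        · exact hκ1 k y
      _ = 3 * B := by ring
  have hUgb : ∀ k, ∀ y ∈ N n, ‖∇ (U k) y‖ ≤ 2 * B' + 8 * L * M := by
    intro k y hy
    have hy2 : ‖y‖ < 2 := by simpa [N] using hy
    rcases lt_or_ge 1 ‖y‖ with hy1 | hy1
    · rw [hUg k y hy1]
      refine (norm_add_le _ _).trans (add_le_add ?_ ?_)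
      · have h := norm_pullGrad_le (∇ V) hy
        rw [pullGrad, pullFun, if_pos hy1, if_pos hy1] at h
        rw [norm_smul]
        exact (mul_le_of_le_one_left (norm_nonneg _) (hκ1 k y)).trans
          (h.trans (by gcongr; exact hB' _))
      · rcases lt_or_ge (1 + 2 * e k) (‖y‖ ^ 2) with h | h
        · rw [gradient_outerCutoff_eq_zero (he0 k) h, smul_zero, norm_zero]
          positivity
        · -- `|d| ≤ 2Lε` compensates the growth of the gradient of the cutoff
          have h1 : ‖d y‖ ≤ L * (2 * e k) := by
            have hl := hL.dist_le_mul (blowDown y) 0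
            rw [dist_zero_right, norm_blowDown hy1, Real.dist_eq] at hl
            refine hl.trans ?_
            gcongr
            nlinarith
          rw [norm_smul, gradient_outerCutoff, norm_smul, norm_mul, Real.norm_eq_abs (deriv _ _),
            Real.norm_of_nonneg (by have := he0 k; positivity : 0 ≤ 2 / e k)]
          calc ‖d y‖ * (|deriv Real.smoothTransition ((‖y‖ ^ 2 - 1) / e k - 1)| * (2 / e k) * ‖y‖)
              ≤ (L * (2 * e k)) * (M * (2 / e k) * 2) := by
                have := he0 k
                gcongr
                exact hSM _
            _ = 8 * L * M := by
                have := (he0 k).ne'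
                field_simp
                norm_num
    · rw [hUg0 k y hy1, norm_zero]
      positivity
  have hlim : ∀ y, Tendsto (fun k => U k y) atTop (𝓝 (pullFun V (V 0) y)) := fun y => by
    rcases lt_or_ge 1 ‖y‖ with hy | hy
    · refine tendsto_const_nhds.congr' ?_
      filter_upwards [eventually_outerCutoff hy] with k hk
      simp only [hU, hd]
      rw [outerCutoff_eq_one (he0 k) hk.le, pullFun, if_pos hy]
      ring
    · refine tendsto_const_nhds.congr fun k => ?_
      rw [pullFun, if_neg (not_lt.2 hy), (hin k y hy).eq_of_nhds]
  have hlimg : ∀ y, Tendsto (fun k => ∇ (U k) y) atTop (𝓝 (pullGrad (∇ V) y)) := fun y => by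
    rcases lt_or_ge 1 ‖y‖ with hy | hy
    · refine tendsto_const_nhds.congr' ?_
      filter_upwards [eventually_outerCutoff hy] with k hk
      rw [hUg k y hy, outerCutoff_eq_one (he0 k) hk.le, gradient_outerCutoff_eq_zero (he0 k) hk,
        pullGrad, if_pos hy, one_smul, smul_zero, add_zero]
    · refine tendsto_const_nhds.congr fun k => ?_
      rw [pullGrad, if_neg (not_lt.2 hy), hUg0 k y hy]
  have m1 : ∀ k, AEStronglyMeasurable (U k) (volN n) := fun k =>
    (hUs k).continuous.aestronglyMeasurable
  have m2 : ∀ k, AEStronglyMeasurable (∇ (U k)) (volN n) := fun k =>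
    (continuous_gradient (hUs k)).aestronglyMeasurable
  have t1 := tendsto_eLpNorm_of_dominated (g := fun _ => 3 * B) m1 (memLp_const _)
    (fun k => Eventually.of_forall (hUb k)) (Eventually.of_forall hlim)
  have t2 := tendsto_eLpNorm_of_dominated (g := fun _ => 2 * B' + 8 * L * M) m2 (memLp_const _)
    (fun k => by
      filter_upwards [ae_restrict_mem (measurableSet_N n)] with y hy
      exact hUgb k y hy) (Eventually.of_forall hlimg)
  refine hasTrace_of_approx ?_ ?_ fun ε hε => ?_
  · refine MemLp.of_bound (aestronglyMeasurable_of_tendsto_ae _ m1 (Eventually.of_forall hlim))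
      (3 * B) (Eventually.of_forall fun y => ?_)
    exact le_of_tendsto (hlim y).norm (Eventually.of_forall fun k => hUb k y)
  · refine MemLp.of_bound (aestronglyMeasurable_of_tendsto_ae _ m2 (Eventually.of_forall hlimg))
      (2 * B' + 8 * L * M) ?_
    filter_upwards [ae_restrict_mem (measurableSet_N n)] with y hy
    exact le_of_tendsto (hlimg y).norm (Eventually.of_forall fun k => hUgb k y hy)
  · obtain ⟨k, k1, k2⟩ := ((tendsto_zero_iff_approx.1 t1 ε hε).and
      (tendsto_zero_iff_approx.1 t2 ε hε)).exists
    refine ⟨U k, hUs k, k1, k2, ?_⟩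
    rw [eLpNorm_congr_ae (g := 0)]
    · simp
    · filter_upwards [Lp.coeFn_zero ℝ 2 (surfaceMeasure n), surfaceMeasure_ae_norm] with x hx hx2
      rw [Pi.sub_apply, hx]
      simp only [hU, hd]
      rw [outerCutoff_eq_one (he0 k) (by rw [hx2]; linarith [he1 k]), blowDown_eq_self hx2,
        hV0 x (by rw [hx2]; norm_num)]
      simp

/-! ### Transformation of harmonic functions -/

theorem IsDivFree.congr_ae {n : ℕ} {G H : E n → E n} (hG : IsDivFree G) (h : G =ᵐ[volN n] H) :
    IsDivFree H := fun φ hφ => by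
  rw [← hG φ hφ]
  exact integral_congr_ae (by filter_upwards [h] with x hx; rw [hx])

theorem boundedFunctions_congr {n : ℕ} {u v : E n → ℝ} (h : u =ᵐ[volN n] v) :
    u ∈ boundedFunctions n ↔ v ∈ boundedFunctions n := by
  refine exists_congr fun M => eventually_congr ?_
  filter_upwards [h] with x hx
  rw [hx]

/-- A harmonic function with trace `f` is transformed into a function with trace `f`, after a
modification on a null set: near the origin, where the transformation is singular, it is replaced
by its smooth representative. The value at the origin extends it into the cloaked ball. -/
theorem exists_hasTrace_pull {n : ℕ} (hn : 1 ≤ n) {v : E n → ℝ} {G : E n → E n}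
    {f : BoundaryL2 n} (hv : HasTrace v G f) (hG : IsDivFree G) :
    ∃ (v' : E n → ℝ) (G' : E n → E n) (c : ℝ), v' =ᵐ[volN n] v ∧ G' =ᵐ[volN n] G ∧
      HasTrace (pullFun v' c) (pullGrad G') f := by
  obtain ⟨V, hV, hVv⟩ := exists_smooth_of_isDivFree hv hG
  have hVv' : ∀ᵐ x ∂(volN n), x ∈ Metric.ball (0 : E n) 1 → v x = V x ∧ G x = ∇ V x :=
    ae_restrict_of_ae ((ae_restrict_iff' measurableSet_ball).1 hVv)
  -- `χ` is one for `|x|² ≤ 1/2` and zero for `|x|² ≥ 3/4`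
  set χ : E n → ℝ := cutoff (-4) 3 with hχ
  have sχ : ContDiff ℝ ∞ χ := contDiff_cutoff _ _
  set θ : E n → ℝ := fun x => 1 - χ x with hθ
  have sθ : ContDiff ℝ ∞ θ := contDiff_const.sub sχ
  have gθ : ∀ x, ∇ θ x = -∇ χ x := fun x => by
    have h := (hasGradientAt_of_contDiff sχ x).hasFDerivAt.const_sub 1
    refine HasGradientAt.gradient ?_
    rw [hasGradientAt_iff_hasFDerivAt]
    exact h.congr_fderiv (by rw [map_neg])
  have χ0 : ∀ x : E n, 1 ≤ ‖x‖ → χ x = 0 := fun x hx => cutoff_eq_zero (by nlinarith)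
  have gχ0 : ∀ x : E n, 1 ≤ ‖x‖ → ∇ χ x = 0 := fun x hx => by
    rw [hχ, gradient_cutoff, deriv_smoothTransition_of_neg (by nlinarith), zero_mul, zero_smul]
  have h1 := hasTrace_pull_of_contDiff (V := fun x => χ x * V x) (sχ.mul hV)
    fun x hx => by rw [χ0 x hx, zero_mul]
  have h2 := hv.pull_of_cutoff hn sθ
    (fun x => by
      rw [abs_of_nonneg (sub_nonneg.2 (cutoff_le_one _ _ x))]
      exact sub_le_self _ (cutoff_nonneg _ _ x))
    (fun x hx => by
      have : χ x = 1 := cutoff_eq_one (by nlinarith [norm_nonneg x])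
      simp only [hθ, this, sub_self])
    (fun x hx => by simp only [hθ]; rw [χ0 x (by linarith), sub_zero])
  have h := h1.add h2
  rw [zero_add, ← pullGrad_add] at h
  have e : pullFun (fun x => χ x * V x) (χ 0 * V 0) + pullFun (fun x => θ x * v x) 0 =
      pullFun (fun x => χ x * V x + θ x * v x) (χ 0 * V 0) := by
    funext y
    simp only [pullFun, Pi.add_apply]
    split_ifs <;> simp
  rw [e] at h
  refine ⟨_, _, _, ?_, ?_, h⟩
  · filter_upwards [hVv'] with x hx
    rcases lt_or_ge ‖x‖ 1 with h1 | h1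
    · rw [(hx (by simpa using h1)).1]
      simp only [hθ]
      ring
    · simp only [hθ]
      rw [χ0 x h1]
      ring
  · filter_upwards [hVv'] with x hx
    rw [Pi.add_apply, gradient_mul sχ hV, gθ]
    rcases lt_or_ge ‖x‖ 1 with h1 | h1
    · obtain ⟨a, b⟩ := hx (by simpa using h1)
      rw [← a, ← b]
      simp only [hθ]
      module
    · simp only [hθ]
      rw [χ0 x h1, gχ0 x h1]
      simp

/-- Pairing the transformed current with the gradient of a smooth function that vanishes near the
cloaked ball. -/
theorem integral_flux_pullGrad_gradient {n : ℕ} (hn : 3 ≤ n)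
    (g : E n → Matrix (Fin n) (Fin n) ℝ) (G : E n → E n) {ζ : E n → ℝ} (hζ : ContDiff ℝ ∞ ζ)
    {ρ : ℝ} (hρ : 1 < ρ) (h0 : ∀ y, ‖y‖ < ρ → ζ y = 0) :
    ∫ y in N n, inner ℝ (flux (conductivity (cloakMetric g)) (pullGrad G) y) (∇ ζ y) =
      ∫ x in N n, inner ℝ (G x) (∇ (fun x => ζ (blowUp x)) x) := by
  have hr := restrict_N_sdiff n (by omega)
  rw [volN] at hr
  rw [integral_flux_pullGrad hn, ← hr]
  refine setIntegral_congr_fun (measurableSet_ball.diff (measurableSet_singleton 0))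
    fun x hx => ?_
  rw [(comp_blowUp_smooth hζ hρ h0).2 x hx.2]

/-- The transformed current is orthogonal to the gradients of test functions that vanish near the
cloaked ball. -/
theorem IsDivFree.integral_flux_pullGrad {n : ℕ} (hn : 3 ≤ n)
    (g : E n → Matrix (Fin n) (Fin n) ℝ) {G : E n → E n} (hG : IsDivFree G) {ζ : E n → ℝ}
    (hζ : IsTest ζ) {ρ : ℝ} (hρ : 1 < ρ) (h0 : ∀ y, ‖y‖ < ρ → ζ y = 0) :
    ∫ y in N n, inner ℝ (flux (conductivity (cloakMetric g)) (pullGrad G) y) (∇ ζ y) = 0 := by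
  rw [integral_flux_pullGrad_gradient hn g G hζ.smooth hρ h0]
  obtain ⟨R, hR1, hR2, hR⟩ := hζ.exists_radius
  refine hG _ (isTest_of_eq_zero (comp_blowUp_smooth hζ.smooth hρ h0).1
    (R := 2 * (R - 1)) (by linarith) fun x hx => hR _ ?_)
  have hx0 : x ≠ 0 := norm_pos_iff.1 (by linarith)
  rw [norm_blowUp hx0]
  linarith

/-- The transformed current has divergence zero across the boundary of the cloaked ball: its radial
component vanishes there like `|y| - 1`, which compensates the growth of the gradients of the
cutoff functions. -/
theorem isSolution_pull {n : ℕ} (hn : 3 ≤ n) {g : E n → Matrix (Fin n) (Fin n) ℝ}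
    (hg : IsRegularMetricOn (Metric.ball (0 : E n) 1) g) {u : E n → ℝ} {G : E n → E n}
    (hu : IsH1 u (pullGrad G)) (hG : IsDivFree G) :
    IsSolution (conductivity (cloakMetric g)) u (pullGrad G) := by
  have mF := (isAdmissible_cloakMetric hn hg).memLp_flux _ hu.memLp_grad
  set F := flux (conductivity (cloakMetric g)) (pullGrad G) with hF
  have iF : IntegrableOn F (N n) := mF.integrable (by norm_num)
  refine ⟨hu, iF.locallyIntegrableOn, fun φ hφ hc hs => ?_⟩
  have hφt : IsTest φ := ⟨hφ, hc, hs⟩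
  obtain ⟨M, hM, hSM⟩ := exists_deriv_smoothTransition_bound
  obtain ⟨B, hB⟩ := hc.exists_bound_of_continuous hφ.continuous
  obtain ⟨B', hB'⟩ := (hasCompactSupport_gradient hc).exists_bound_of_continuous
    (continuous_gradient hφ)
  have hB0 : 0 ≤ B := (norm_nonneg _).trans (hB 0)
  set e : ℕ → ℝ := fun k => 1 / ((k : ℝ) + 1) with he
  have he0 : ∀ k, 0 < e k := fun k => by simp only [he]; positivity
  have hκs : ∀ k, ContDiff ℝ ∞ (outerCutoff (n := n) (e k)) := fun k => contDiff_cutoff _ _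
  have hF0 : ∀ y : E n, ‖y‖ ≤ 1 → F y = 0 := fun y hy => by
    rw [hF, flux, pullGrad, if_neg (not_lt.2 hy), map_zero]
  -- the pairing with the gradient of the cutoff function
  have hκF : ∀ k, ∀ y ∈ N n, ‖inner ℝ (F y) (∇ (outerCutoff (e k)) y)‖ ≤
      4 * M * ‖pullGrad G y‖ := by
    intro k y hy
    have hy2 : ‖y‖ < 2 := by simpa [N] using hy
    rcases lt_or_ge 1 ‖y‖ with hy1 | hy1
    swap
    · rw [hF0 y hy1, inner_zero_left, norm_zero]
      positivity
    rcases lt_or_ge (1 + 2 * e k) (‖y‖ ^ 2) with h | h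
    · rw [gradient_outerCutoff_eq_zero (he0 k) h, inner_zero_right, norm_zero]
      positivity
    have hs0 := tangFactor_pos hy1
    have hs1 := tangFactor_le_one hy1 hy2.le
    have hs2 : tangFactor y ≤ 2 * e k := by
      rw [tangFactor_eq hy1, div_le_iff₀ (by linarith)]
      have := he0 k
      nlinarith
    have hsn : tangFactor y ^ (n - 1) ≤ 2 * e k :=
      (pow_le_of_le_one hs0.le hs1 (by omega)).trans hs2
    rw [hF, flux_cloakMetric hn g _ hy1, gradient_outerCutoff, inner_radialOp_left, map_smul,
      radialOp_self (ne_zero_of_one_lt hy1), real_inner_smul_right, real_inner_smul_right]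
    have hek := he0 k
    rw [norm_mul, norm_mul, norm_mul, Real.norm_eq_abs (deriv _ _),
      Real.norm_of_nonneg (by positivity : 0 ≤ 2 / e k),
      Real.norm_of_nonneg (by positivity : 0 ≤ tangFactor y ^ (n - 1) / 2)]
    have hin : ‖inner ℝ (pullGrad G y) y‖ ≤ ‖pullGrad G y‖ * 2 :=
      (norm_inner_le_norm _ _).trans (by gcongr)
    calc _ ≤ M * (2 / e k) * (2 * e k / 2 * (‖pullGrad G y‖ * 2)) := by
          gcongr
          exact hSM _
      _ = 4 * M * ‖pullGrad G y‖ := by field_simp; ring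
  have hprod : ∀ k y, ∇ (fun y => outerCutoff (e k) y * φ y) y =
      outerCutoff (e k) y • ∇ φ y + φ y • ∇ (outerCutoff (e k)) y := fun k y =>
    gradient_mul (hκs k) hφ y
  have hzero : ∀ k, ∫ y in N n, inner ℝ (F y) (∇ (fun y => outerCutoff (e k) y * φ y) y) = 0 := by
    intro k
    obtain ⟨R, hR1, hR2, hR⟩ := hφt.exists_radius
    have hek := he0 k
    have hek1 : e k ≤ 1 := by
      simp only [he]
      rw [div_le_one (by positivity)]
      simp
    refine hG.integral_flux_pullGrad hn g (isTest_of_eq_zero ((hκs k).mul hφ) hR2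
      fun x hx => by rw [hR x hx, mul_zero]) (ρ := 1 + e k / 4) (by linarith) fun y hy => ?_
    rw [outerCutoff_eq_zero hek (by nlinarith [norm_nonneg y]), zero_mul]
  have hlim : Tendsto (fun k => ∫ y in N n,
      inner ℝ (F y) (∇ (fun y => outerCutoff (e k) y * φ y) y)) atTop
      (𝓝 (∫ y in N n, inner ℝ (F y) (∇ φ y))) := by
    refine tendsto_integral_of_dominated_convergence
      (fun y => ‖F y‖ * B' + B * (4 * M * ‖pullGrad G y‖)) (fun k => ?_) ?_ (fun k => ?_) ?_
    · exact mF.1.inner (continuous_gradient ((hκs k).mul hφ)).aestronglyMeasurable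
    · have iH : IntegrableOn (pullGrad G) (N n) := hu.memLp_grad.integrable (by norm_num)
      exact (iF.norm.mul_const _).add ((iH.norm.const_mul _).const_mul _)
    · filter_upwards [ae_restrict_mem (measurableSet_N n)] with y hy
      rw [hprod, inner_add_right, real_inner_smul_right, real_inner_smul_right]
      refine (norm_add_le _ _).trans ?_
      rw [norm_mul, norm_mul]
      have hκ1 : ‖outerCutoff (e k) y‖ ≤ 1 :=
        (Real.norm_of_nonneg (cutoff_nonneg _ _ _)).trans_le (cutoff_le_one _ _ _)
      have h1 : ‖inner ℝ (F y) (∇ φ y)‖ ≤ ‖F y‖ * B' :=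
        (norm_inner_le_norm _ _).trans (by gcongr; exact hB' y)
      refine add_le_add ((mul_le_of_le_one_left (norm_nonneg _) hκ1).trans h1) ?_
      gcongr
      · exact hB y
      · exact hκF k y hy
    · refine Eventually.of_forall fun y => ?_
      rcases lt_or_ge 1 ‖y‖ with hy | hy
      · refine tendsto_const_nhds.congr' ?_
        filter_upwards [eventually_outerCutoff hy] with k hk
        rw [hprod, outerCutoff_eq_one (he0 k) hk.le, gradient_outerCutoff_eq_zero (he0 k) hk,
          one_smul, smul_zero, add_zero]
      · simp [hF0 y hy]
  simp only [hzero] at hlim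
  exact tendsto_nhds_unique hlim tendsto_const_nhds |>.symm ▸ rfl

/-! ### Boundary measurements -/

/-- The transformation fixes the boundary and preserves the pairing of currents with gradients. -/
theorem integral_flux_pullGrad_eq {n : ℕ} (hn : 3 ≤ n) {g : E n → Matrix (Fin n) (Fin n) ℝ}
    {u : E n → ℝ} {G : E n → E n} (hu : IsSolution (conductivity (cloakMetric g)) u (pullGrad G))
    (hF : MemLp (flux (conductivity (cloakMetric g)) (pullGrad G)) 2 (volN n))
    (hGm : MemLp G 2 (volN n)) (hG : IsDivFree G) {φ : E n → ℝ} (hφ : ContDiff ℝ ∞ φ) :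
    ∫ y in N n, inner ℝ (flux (conductivity (cloakMetric g)) (pullGrad G) y) (∇ φ y) =
      ∫ x in N n, inner ℝ (G x) (∇ φ x) := by
  -- the cutoff function vanishes for `|y|² ≤ 2` and equals one for `|y|² ≥ 3`
  set ψ : E n → ℝ := fun y => cutoff 1 (-2) y * φ y with hψ
  have sψ : ContDiff ℝ ∞ ψ := (contDiff_cutoff _ _).mul hφ
  have hψ1 : ∀ y : E n, 7 / 4 < ‖y‖ → ψ y = φ y := fun y hy => by
    simp only [hψ]
    rw [cutoff_eq_one (by nlinarith), one_mul]
  have hψ0 : ∀ y : E n, ‖y‖ < 5 / 4 → ψ y = 0 := fun y hy => by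
    simp only [hψ]
    rw [cutoff_eq_zero (by nlinarith [norm_nonneg y]), zero_mul]
  have ht : IsTest (φ - ψ) := isTest_of_eq_zero (hφ.sub sψ) (R := 7 / 4) (by norm_num)
    fun x hx => by rw [Pi.sub_apply, hψ1 x hx, sub_self]
  have h0 := hu.weak _ ht.smooth ht.compact ht.supp
  simp only [gradient_sub hφ sψ, Pi.sub_apply, inner_sub_right] at h0
  rw [integral_sub (integrable_inner hF (memLp_volN_of_continuous (continuous_gradient hφ)))
    (integrable_inner hF (memLp_volN_of_continuous (continuous_gradient sψ)))] at h0
  rw [sub_eq_zero.1 h0, integral_flux_pullGrad_gradient hn g G sψ (ρ := 5 / 4) (by norm_num) hψ0]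
  have s2 := (comp_blowUp_smooth sψ (ρ := 5 / 4) (by norm_num) hψ0).1
  have t1 := hasTrace_of_contDiff hφ
  have t2 := hasTrace_of_contDiff s2
  have e : (memLp_surface_of_continuous s2.continuous).toLp (fun x => ψ (blowUp x)) =
      (memLp_surface_of_continuous hφ.continuous).toLp φ := by
    rw [MemLp.toLp_eq_toLp_iff]
    filter_upwards [surfaceMeasure_ae_norm] with x hx
    rw [blowUp_eq_self hx, hψ1 x (by rw [hx]; norm_num)]
  rw [e] at t2
  exact hG.integral_inner_eq (by omega) hGm t2 t1

theorem hasConormal_pull {n : ℕ} (hn : 3 ≤ n) {g : E n → Matrix (Fin n) (Fin n) ℝ}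
    (hg : IsRegularMetricOn (Metric.ball (0 : E n) 1) g) {u : E n → ℝ} {G : E n → E n}
    (hu : IsSolution (conductivity (cloakMetric g)) u (pullGrad G))
    (hGm : MemLp G 2 (volN n)) (hG : IsDivFree G) {h : Module.Dual ℝ (HHalf n)}
    (hh : HasConormal (conductivity (euclideanMetric n)) G h) :
    HasConormal (conductivity (cloakMetric g)) (pullGrad G) h := by
  intro w W k hw
  have hF := (isAdmissible_cloakMetric hn hg).memLp_flux _ hu.isH1.memLp_grad
  refine ⟨integrable_inner hF hw.1.memLp_grad, Eq.symm ?_⟩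
  have hhk := (hh w W k hw).2
  rw [flux_euclideanMetric] at hhk
  have hK : eLpNorm G 2 (volN n) + 1 ≠ ⊤ := ENNReal.add_ne_top.2 ⟨hGm.2.ne, by simp⟩
  refine integral_inner_eq_of_approx hF hw.1.memLp_grad fun ε hε => ?_
  obtain ⟨φ, hφ, -, h2, -⟩ := hw.exists_approx
    (ENNReal.div_ne_zero.2 ⟨hε, hK⟩ : ε / (eLpNorm G 2 (volN n) + 1) ≠ 0)
  have mφ : MemLp (∇ φ) 2 (volN n) := memLp_volN_of_continuous (continuous_gradient hφ)
  refine ⟨∇ φ, mφ, h2.trans (ENNReal.div_le_of_le_mul (le_mul_of_one_le_right' (by simp))), ?_⟩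
  rw [integral_flux_pullGrad_eq hn hu hF hGm hG hφ, hhk,
    ← integral_sub (integrable_inner hGm mφ) (integrable_inner hGm hw.1.memLp_grad)]
  simp only [← inner_sub_right]
  refine (enorm_integral_inner_le hGm (mφ.sub hw.1.memLp_grad)).trans ?_
  calc eLpNorm G 2 (volN n) * eLpNorm (∇ φ - W) 2 (volN n)
      ≤ (eLpNorm G 2 (volN n) + 1) * (ε / (eLpNorm G 2 (volN n) + 1)) := by
        gcongr
        exact le_self_add
    _ = ε := ENNReal.mul_div_cancel (by simp) hK

theorem pullFun_mem_boundedFunctions {n : ℕ} (hn : 1 ≤ n) {v : E n → ℝ} {c : ℝ} :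
    pullFun v c ∈ boundedFunctions n ↔ v ∈ boundedFunctions n := by
  constructor
  · rintro ⟨M, hM⟩
    refine ⟨M, ?_⟩
    have hsub : outerShell n ⊆ N n := sdiff_subset
    have h1 := (quasiMeasurePreserving_blowUp hn).ae (ae_restrict_of_ae_restrict_of_subset hsub hM)
    have h2 : ∀ᵐ x ∂(volN n), x ∈ N n \ {0} := by
      rw [← restrict_N_sdiff n hn]
      exact ae_restrict_mem (measurableSet_ball.diff (measurableSet_singleton 0))
    filter_upwards [h1, h2] with x hx hx0
    have h3 : blowDown (blowUp x) = x := (blowDown_invOn n).1 hx0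
    have h4 : 1 < ‖blowUp x‖ := (mem_outerShell.1 (blowUp_mapsTo n hx0)).2
    rwa [pullFun, if_pos h4, h3] at hx
  · rintro ⟨M, hM⟩
    refine ⟨max M |c|, ?_⟩
    have h1 := (quasiMeasurePreserving_blowDown hn).ae hM
    rw [ae_restrict_iff' (measurableSet_outerShell n)] at h1
    filter_upwards [ae_restrict_of_ae h1, ae_restrict_mem (measurableSet_N n)] with y hy hyN
    rw [pullFun]
    split_ifs with h
    · exact (hy (mem_outerShell.2 ⟨by simpa [N] using hyN, h⟩)).trans (le_max_left _ _)
    · exact le_max_right _ _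

/-- Every harmonic function corresponds to a solution for the singular conductivity with the same
trace and the same conormal derivative, and boundedness is preserved. -/
theorem exists_solution_cloakMetric {n : ℕ} (hn : 3 ≤ n) {g : E n → Matrix (Fin n) (Fin n) ℝ}
    (hg : IsRegularMetricOn (Metric.ball (0 : E n) 1) g) {v : E n → ℝ} {G : E n → E n}
    {f : BoundaryL2 n} (hv : HasTrace v G f)
    (hvs : IsSolution (conductivity (euclideanMetric n)) v G) {h : Module.Dual ℝ (HHalf n)}
    (hh : HasConormal (conductivity (euclideanMetric n)) G h) :
    ∃ u H, IsSolution (conductivity (cloakMetric g)) u H ∧ HasTrace u H f ∧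
      HasConormal (conductivity (cloakMetric g)) H h ∧
      (u ∈ boundedFunctions n ↔ v ∈ boundedFunctions n) := by
  have hG := (isSolution_euclideanMetric_iff.1 hvs).2
  obtain ⟨v', G', c, e1, e2, ht⟩ := exists_hasTrace_pull (by omega) hv hG
  have hG' := hG.congr_ae e2.symm
  have hs := isSolution_pull hn hg ht.1 hG'
  have hh' : HasConormal (conductivity (euclideanMetric n)) G' h := fun w W k hw => by
    have h0 := hh w W k hw
    rw [flux_euclideanMetric] at h0 ⊢
    have e : (fun x => inner ℝ (G x) (W x)) =ᵐ[volN n] fun x => inner ℝ (G' x) (W x) := by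
      filter_upwards [e2] with x hx
      rw [hx]
    exact ⟨h0.1.congr e, h0.2.trans (integral_congr_ae e)⟩
  exact ⟨_, _, hs, ht, hasConormal_pull hn hg hs ((memLp_congr_ae e2).2 hv.1.memLp_grad) hG' hh',
    (pullFun_mem_boundedFunctions (by omega)).trans (boundedFunctions_congr e1)⟩

/-- Solutions with the same trace have the same conormal derivative. -/
theorem HasConormal.unique {n : ℕ} (hn : 3 ≤ n) {σ : E n → Matrix (Fin n) (Fin n) ℝ}
    (hσ : IsAdmissible σ) {u v : E n → ℝ} {G H : E n → E n} {f : BoundaryL2 n}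
    (hu : IsSolution σ u G) (hv : IsSolution σ v H) (huf : HasTrace u G f) (hvf : HasTrace v H f)
    {h k : Module.Dual ℝ (HHalf n)} (hh : HasConormal σ G h) (hk : HasConormal σ H k) : h = k := by
  ext l
  obtain ⟨w, W, hw⟩ := l.2
  rw [(hh w W l hw).2, (hk w W l hw).2]
  refine integral_congr_ae ?_
  filter_upwards [(hu.ae_eq hn hσ hv huf hvf).2] with x hx
  rw [flux, flux, hx]

/-- Since solutions are determined by their trace, one solution for each trace suffices to compare
Cauchy data. -/
theorem cauchyData_subset {n : ℕ} (hn : 3 ≤ n) {σ τ : E n → Matrix (Fin n) (Fin n) ℝ}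
    (hσ : IsAdmissible σ) {S : Set (E n → ℝ)}
    (hS : ∀ u v : E n → ℝ, u =ᵐ[volN n] v → u ∈ S → v ∈ S)
    (h : ∀ f : HHalf n, ∃ (u : E n → ℝ) (G : E n → E n) (v : E n → ℝ) (H : E n → E n)
      (k : Module.Dual ℝ (HHalf n)), IsSolution σ u G ∧ HasTrace u G f ∧ HasConormal σ G k ∧
      IsSolution τ v H ∧ HasTrace v H f ∧ HasConormal τ H k ∧ (u ∈ S → v ∈ S)) :
    cauchyData S σ ⊆ cauchyData S τ := by
  rintro ⟨f, l⟩ ⟨u', G', hu'S, hu's, hu't, hu'c⟩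
  obtain ⟨u, G, v, H, k, hus, hut, huc, hvs, hvt, hvc, huv⟩ := h f
  have e : l = k := HasConormal.unique hn hσ hu's hus hu't hut hu'c huc
  exact ⟨v, H, huv (hS _ _ (hu's.ae_eq hn hσ hus hu't hut).1 hu'S), hvs, hvt, e ▸ hvc⟩

end Cloaking

end

open Cloaking in
theorem theorem1 (n : ℕ) (hn : 3 ≤ n) (g : E n → Matrix (Fin n) (Fin n) ℝ)
    (hg : IsRegularMetricOn (Metric.ball (0 : E n) 1) g) :
    (∃ Λ : HHalf n →ₗ[ℝ] Module.Dual ℝ (HHalf n),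
      (IsDNMap (boundedFunctions n) (boundedData n) (conductivity (euclideanMetric n)) Λ ∧
        IsDNMap (boundedFunctions n) (boundedData n) (conductivity (cloakMetric g)) Λ) ∧
      (IsDNMap Set.univ Set.univ (conductivity (euclideanMetric n)) Λ ∧
        IsDNMap Set.univ Set.univ (conductivity (cloakMetric g)) Λ)) ∧
    cauchyData (boundedFunctions n) (conductivity (cloakMetric g)) =
      cauchyData (boundedFunctions n) (conductivity (euclideanMetric n)) ∧
    cauchyData Set.univ (conductivity (cloakMetric g)) =
      cauchyData Set.univ (conductivity (euclideanMetric n)) := by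
  obtain ⟨Λ, hΛ⟩ := exists_dnMap hn
  have a0 := isAdmissible_euclideanMetric n
  have a1 := isAdmissible_cloakMetric hn hg
  -- for each boundary value, a harmonic function and its transform
  have key : ∀ f : HHalf n, ∃ (v : E n → ℝ) (G : E n → E n) (u : E n → ℝ) (H : E n → E n),
      IsSolution (conductivity (euclideanMetric n)) v G ∧ HasTrace v G f ∧
      HasConormal (conductivity (euclideanMetric n)) G (Λ f) ∧
      IsSolution (conductivity (cloakMetric g)) u H ∧ HasTrace u H f ∧
      HasConormal (conductivity (cloakMetric g)) H (Λ f) ∧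
      (u ∈ boundedFunctions n ↔ v ∈ boundedFunctions n) ∧
      (f ∈ boundedData n → v ∈ boundedFunctions n) := by
    intro f
    obtain ⟨v, G, hv, hG⟩ := exists_dirichlet hn f
    have hs := isSolution_euclideanMetric_iff.2 ⟨hv.1, hG⟩
    have hc : HasConormal (conductivity (euclideanMetric n)) G (Λ f) := fun w W k hw => by
      rw [flux_euclideanMetric]
      exact ⟨integrable_inner hv.1.memLp_grad hw.1.memLp_grad, hΛ f v G hv hG w W k hw⟩
    obtain ⟨u, H, h1, h2, h3, h4⟩ := exists_solution_cloakMetric hn hg hv hs hc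
    exact ⟨v, G, u, H, hs, hv, hc, h1, h2, h3, h4, fun ⟨M, hM⟩ => hv.bounded hn hG hM⟩
  refine ⟨⟨Λ, ⟨fun f hf => ⟨?_, ?_⟩, fun f hf => ⟨?_, ?_⟩⟩, fun f _ => ⟨?_, ?_⟩,
    fun f _ => ⟨?_, ?_⟩⟩, ?_, ?_⟩
  · obtain ⟨v, G, u, H, h1, h2, h3, -, -, -, -, h8⟩ := key f
    exact ⟨v, G, h8 hf, h1, h2, h3⟩
  · exact fun u G v H _ hu hut _ hv hvt => (hu.ae_eq hn a0 hv hut hvt).1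
  · obtain ⟨v, G, u, H, -, -, -, h4, h5, h6, h7, h8⟩ := key f
    exact ⟨u, H, h7.2 (h8 hf), h4, h5, h6⟩
  · exact fun u G v H _ hu hut _ hv hvt => (hu.ae_eq hn a1 hv hut hvt).1
  · obtain ⟨v, G, u, H, h1, h2, h3, -⟩ := key f
    exact ⟨v, G, trivial, h1, h2, h3⟩
  · exact fun u G v H _ hu hut _ hv hvt => (hu.ae_eq hn a0 hv hut hvt).1
  · obtain ⟨v, G, u, H, -, -, -, h4, h5, h6, -⟩ := key f
    exact ⟨u, H, trivial, h4, h5, h6⟩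
  · exact fun u G v H _ hu hut _ hv hvt => (hu.ae_eq hn a1 hv hut hvt).1
  · refine Set.Subset.antisymm
      (cauchyData_subset hn a1 (fun u v e => (boundedFunctions_congr e).1) fun f => ?_)
      (cauchyData_subset hn a0 (fun u v e => (boundedFunctions_congr e).1) fun f => ?_)
    · obtain ⟨v, G, u, H, h1, h2, h3, h4, h5, h6, h7, -⟩ := key f
      exact ⟨u, H, v, G, Λ f, h4, h5, h6, h1, h2, h3, h7.1⟩
    · obtain ⟨v, G, u, H, h1, h2, h3, h4, h5, h6, h7, -⟩ := key f
      exact ⟨v, G, u, H, Λ f, h1, h2, h3, h4, h5, h6, h7.2⟩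
  · refine Set.Subset.antisymm (cauchyData_subset hn a1 (fun _ _ _ _ => trivial) fun f => ?_)
      (cauchyData_subset hn a0 (fun _ _ _ _ => trivial) fun f => ?_)
    · obtain ⟨v, G, u, H, h1, h2, h3, h4, h5, h6, -⟩ := key f
      exact ⟨u, H, v, G, Λ f, h4, h5, h6, h1, h2, h3, fun _ => trivial⟩
    · obtain ⟨v, G, u, H, h1, h2, h3, h4, h5, h6, -⟩ := key f
      exact ⟨v, G, u, H, Λ f, h1, h2, h3, h4, h5, h6, fun _ => trivial⟩
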